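/- \textbf{Definitions.} Let $\Sigma,\Gamma$ be finite alphabets and $C$ a set of $k$ colors. An \emph{lo-graph} is a finite directed graph with edge relations named by $\Gamma$, vertex labels in $\Sigma\cup\{\varepsilon\}$, and a relation $\mathrm{Succ}$ that is the successor relation of a linear order on the vertices; its \emph{word} is the concatenation of the vertex labels along $\mathrm{Succ}$. \emph{Special-treewidth expressions} over $(C,\Sigma,\Gamma)$ are built from the empty graph $\bot$ by the operations: add a new vertex labelled $a\in\Sigma\cup\{\varepsilon\}$ with a color $c$ that is not in use; add a $\mathrm{Succ}$-edge from the $c_1$-colored vertex to the $c_2$-colored vertex, provided that these are the last vertex and the first vertex, respectively, of two different maximal $\mathrm{Succ}$-paths; add a $\gamma$-edge from the $c_1$-colored to the $c_2$-colored vertex (if both exist); forget the color $c$; and disjoint union ($\mathrm{Join}$) of two graphs whose sets of colors in use are disjoint. A \emph{width-$k$ tree automaton} $\mathcal A$ is a deterministic bottom-up tree automaton (a finite state set, partial transition functions for the operations, a state for $\bot$, and accepting states) that reads such expressions over $k$ colors. Its word language $L_{\mathrm w}(\mathcal A)$ is the set of words of those lo-graphs that are described, after removing colors, by an accepted expression.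 Let $|\mathcal A|$ be the number of states plus the number of transitions of $\mathcal A$. A \emph{multiple context-free grammar} (MCFG) has finitely many nonterminals $A$, each of an arity $\ge 1$, a start nonterminal of arity $1$, and finitely many productions $A(s_1,\dots,s_n)\leftarrow\{B_1(x_{1,1},\dots,x_{1,n_1}),\dots,B_m(x_{m,1},\dots,x_{m,n_m})\}$, where the $x_{i,j}$ are pairwise distinct variables, the $s_i$ are words over letters and these variables, and each variable occurs at most once in $s_1\cdots s_n$. It derives tuples of words in the usual way, and its language is the set of words derived from the start nonterminal. A \emph{$k$-MCFG(2)} is an MCFG in which all arities are at most $k$ and every production has $m\le 2$. The \emph{size} of an MCFG is the number of its nonterminals and variables plus the total length of its productions. \textbf{Theorem.} There are an algorithm and a function $f(k)=O(k\log k)$ such that for every $k\ge 1$ and every width-$k$ tree automaton $\mathcal A$, the algorithm, given $\mathcal A$ (together with the number $k$), constructs a $k$-MCFG(2) $\mathcal G$ with $L(\mathcal G)=L_{\mathrm w}(\mathcal A)$ in at most $|\mathcal A|\cdot 2^{f(k)}$ steps. In particular the size of $\mathcal G$ is at most $|\mathcal A|\cdot 2^{f(k)}$. (Steps are the primitive operations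 of first-order functional programs on binary trees: reading a variable, constructing or taking apart a pair, producing the empty tree, testing for it, binding a local variable, calling a function. Letters, edge names, states, nonterminals and variables are represented by arbitrary pairwise distinct trees, colors and arities by unary numerals, and finite sets by lists.) -/

import Mathlib

/-! ### A machine model with a step count

First-order functional programs over binary trees (S-expressions), evaluated call-by-value.
Every primitive operation costs one step. -/

/-- Binary trees, the data on which programs operate. -/
inductive Data : Type
  | nil : Data
  | cons : Data → Data → Data

namespace Data

def head : Data → Data
  | nil => nil
  | cons a _ => a

def tail : Data → Data
  | nil => nil
  | cons _ b => b

def ofList : List Data → Data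
  | [] => nil
  | a :: l => cons a (ofList l)

/-- Unary numerals. -/
def num (n : ℕ) : Data := ofList (List.replicate n nil)

end Data

/-- Program expressions. `var i` is the `i`-th value of the local environment, `letIn e b` adds the
value of `e` in front of the environment of `b`, `ite c a b` is `a` if `c` is not `nil` and `b`
otherwise, and `call f e` calls the `f`-th function of the program. -/
inductive Code : Type
  | var : ℕ → Code
  | nil : Code
  | cons : Code → Code → Code
  | head : Code → Code
  | tail : Code → Code
  | ite : Code → Code → Code → Code
  | letIn : Code → Code → Code
  | call : ℕ → Code → Code

/-- `Code.Eval P env e v t`: with the function bodies listed in `P` and in the environment `env`,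
the expression `e` evaluates to `v` in exactly `t` steps. -/
inductive Code.Eval (P : List Code) : List Data → Code → Data → ℕ → Prop
  | var {env : List Data} {i : ℕ} {v : Data} : env[i]? = some v → Code.Eval P env (.var i) v 1
  | nil {env : List Data} : Code.Eval P env .nil .nil 1
  | cons {env : List Data} {e₁ e₂ : Code} {v₁ v₂ : Data} {t₁ t₂ : ℕ} :
      Code.Eval P env e₁ v₁ t₁ → Code.Eval P env e₂ v₂ t₂ →
      Code.Eval P env (.cons e₁ e₂) (.cons v₁ v₂) (t₁ + t₂ + 1)
  | head {env : List Data} {e : Code} {v : Data} {t : ℕ} :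
      Code.Eval P env e v t → Code.Eval P env (.head e) v.head (t + 1)
  | tail {env : List Data} {e : Code} {v : Data} {t : ℕ} :
      Code.Eval P env e v t → Code.Eval P env (.tail e) v.tail (t + 1)
  | iteTrue {env : List Data} {c a b : Code} {x y v : Data} {s t : ℕ} :
      Code.Eval P env c (.cons x y) s → Code.Eval P env a v t →
      Code.Eval P env (.ite c a b) v (s + t + 1)
  | iteFalse {env : List Data} {c a b : Code} {v : Data} {s t : ℕ} :
      Code.Eval P env c .nil s → Code.Eval P env b v t →
      Code.Eval P env (.ite c a b) v (s + t + 1)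
  | letIn {env : List Data} {e b : Code} {u v : Data} {s t : ℕ} :
      Code.Eval P env e u s → Code.Eval P (u :: env) b v t →
      Code.Eval P env (.letIn e b) v (s + t + 1)
  | call {env : List Data} {f : ℕ} {e body : Code} {u v : Data} {s t : ℕ} :
      P[f]? = some body → Code.Eval P env e u s → Code.Eval P [u] body v t →
      Code.Eval P env (.call f e) v (s + t + 1)

/-- A program is a finite list of function bodies, each with one argument; the main function is the
one at index `0`. `RunsInSteps P x y t`: on input `x` the program halts with output `y` after
exactly `t` steps. -/
def RunsInSteps (P : List Code) (x y : Data) (t : ℕ) : Prop :=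
  Code.Eval P [x] (.call 0 (.var 0)) y t

/-! ### Linearly ordered graphs -/

/-- A finite vertex set with a binary relation `succ`, named edge relations, and vertex labels in
the alphabet extended by the empty word (`none`). -/
structure SuccGraph (T Γ : Type) where
  V : Type
  finite : Finite V
  succ : V → V → Prop
  edge : Γ → V → V → Prop
  label : V → Option T

/-- The graph is an lo-graph: `succ` is the successor relation of a linear order. -/
def SuccGraph.IsLoGraph {T Γ : Type} (G : SuccGraph T Γ) : Prop :=
  ∃ _ : LinearOrder G.V, ∀ u v : G.V, G.succ u v ↔ u ⋖ v

/-- `w` is the sequence of the labels of all vertices, read along `succ`. -/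
def SuccGraph.HasWord {T Γ : Type} (G : SuccGraph T Γ) (w : List T) : Prop :=
  ∃ vs : List G.V, vs.Nodup ∧ (∀ v, v ∈ vs) ∧ vs.IsChain G.succ ∧ w = vs.filterMap G.label

/-- Graphs together with a partial vertex colouring. -/
structure ColoredGraph (C T Γ : Type) extends SuccGraph T Γ where
  color : V → Option C

namespace ColoredGraph

variable {C T Γ : Type}

def empty : ColoredGraph C T Γ where
  V := Empty
  finite := inferInstance
  succ := fun _ _ => False
  edge := fun _ _ _ => False
  label := fun _ => none
  color := fun _ => none

def single (c : C) (a : Option T) : ColoredGraph C T Γ where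
  V := Unit
  finite := inferInstance
  succ := fun _ _ => False
  edge := fun _ _ _ => False
  label := fun _ => a
  color := fun _ => some c

/-- Disjoint union. -/
def union (G H : ColoredGraph C T Γ) : ColoredGraph C T Γ where
  V := G.V ⊕ H.V
  finite := by
    have := G.finite
    have := H.finite
    infer_instance
  succ := Sum.LiftRel G.succ H.succ
  edge := fun γ => Sum.LiftRel (G.edge γ) (H.edge γ)
  label := Sum.elim G.label H.label
  color := Sum.elim G.color H.color

def addSucc (c₁ c₂ : C) (G : ColoredGraph C T Γ) : ColoredGraph C T Γ :=
  { G with succ := fun u v => G.succ u v ∨ (G.color u = some c₁ ∧ G.color v = some c₂) }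

def addEdge (γ : Γ) (c₁ c₂ : C) (G : ColoredGraph C T Γ) : ColoredGraph C T Γ :=
  { G with edge := fun γ' u v =>
      G.edge γ' u v ∨ (γ' = γ ∧ G.color u = some c₁ ∧ G.color v = some c₂) }

def forget [DecidableEq C] (c : C) (G : ColoredGraph C T Γ) : ColoredGraph C T Γ :=
  { G with color := fun v => if G.color v = some c then none else G.color v }

end ColoredGraph

/-! ### Special-treewidth expressions -/

/-- The unary operations: add a new vertex of colour `c` labelled with a letter or with the empty
word, add a successor edge, add a `γ`-edge, forget a colour. -/
inductive UnaryOp (C T Γ : Type) : Type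
  | node : C → Option T → UnaryOp C T Γ
  | addSucc : C → C → UnaryOp C T Γ
  | addEdge : Γ → C → C → UnaryOp C T Γ
  | forget : C → UnaryOp C T Γ

/-- Terms over the unary operations, the constant `bot` (the empty graph) and the binary `join`
(disjoint union). -/
inductive LoExpr (C T Γ : Type) : Type
  | bot : LoExpr C T Γ
  | unary : UnaryOp C T Γ → LoExpr C T Γ → LoExpr C T Γ
  | join : LoExpr C T Γ → LoExpr C T Γ → LoExpr C T Γ

def UnaryOp.apply {C T Γ : Type} [DecidableEq C] :
    UnaryOp C T Γ → ColoredGraph C T Γ → ColoredGraph C T Γ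
  | .node c a, G => G.union (.single c a)
  | .addSucc c₁ c₂, G => G.addSucc c₁ c₂
  | .addEdge γ c₁ c₂, G => G.addEdge γ c₁ c₂
  | .forget c, G => G.forget c

/-- When an operation may be applied: a new vertex gets a colour that is not in use, and a successor
edge goes from the last vertex of a piece (a maximal `succ`-path) to the first vertex of a different
piece. -/
def UnaryOp.Applicable {C T Γ : Type} : UnaryOp C T Γ → ColoredGraph C T Γ → Prop
  | .node c _, G => ∀ v, G.color v ≠ some c
  | .addSucc c₁ c₂, G => ∃ u v, G.color u = some c₁ ∧ G.color v = some c₂ ∧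
      (∀ x, ¬ G.succ u x) ∧ (∀ x, ¬ G.succ x v) ∧ ¬ Relation.ReflTransGen G.succ v u
  | .addEdge _ _ _, _ => True
  | .forget _, _ => True

/-- The coloured graph described by an expression. -/
def LoExpr.graph {C T Γ : Type} [DecidableEq C] : LoExpr C T Γ → ColoredGraph C T Γ
  | .bot => .empty
  | .unary op ψ => op.apply ψ.graph
  | .join ψ₁ ψ₂ => ψ₁.graph.union ψ₂.graph

/-- Well-formed expressions: all operations are applicable, and the operands of a join use disjoint
sets of colours. -/
def LoExpr.WellFormed {C T Γ : Type} [DecidableEq C] : LoExpr C T Γ → Prop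
  | .bot => True
  | .unary op ψ => ψ.WellFormed ∧ op.Applicable ψ.graph
  | .join ψ₁ ψ₂ => ψ₁.WellFormed ∧ ψ₂.WellFormed ∧
      ∀ u v c, ψ₁.graph.color u = some c → ψ₂.graph.color v ≠ some c

/-! ### Tree automata over expressions -/

/-- Deterministic bottom-up tree automata with partial transition functions. -/
structure TreeAutomaton (C T Γ Q : Type) where
  bot : Q
  unary : UnaryOp C T Γ → Q → Option Q
  join : Q → Q → Option Q
  accept : Set Q

namespace TreeAutomaton

variable {C T Γ Q : Type}

def run (A : TreeAutomaton C T Γ Q) : LoExpr C T Γ → Option Q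
  | .bot => some A.bot
  | .unary op ψ => (A.run ψ).bind (A.unary op)
  | .join ψ₁ ψ₂ => (A.run ψ₁).bind fun q₁ => (A.run ψ₂).bind fun q₂ => A.join q₁ q₂

/-- The well-formed expressions that the automaton accepts. -/
def exprLanguage [DecidableEq C] (A : TreeAutomaton C T Γ Q) : Set (LoExpr C T Γ) :=
  {ψ | ψ.WellFormed ∧ ∃ q ∈ A.accept, A.run ψ = some q}

/-- The lo-graphs described by accepted expressions, with the colours removed. -/
def graphLanguage [DecidableEq C] (A : TreeAutomaton C T Γ Q) : Set (SuccGraph T Γ) :=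
  {G | G.IsLoGraph ∧ ∃ ψ ∈ A.exprLanguage, G = ψ.graph.toSuccGraph}

def wordLanguage [DecidableEq C] (A : TreeAutomaton C T Γ Q) : Set (List T) :=
  {w | ∃ G ∈ A.graphLanguage, G.HasWord w}

/-- The number of states plus the number of transitions. -/
noncomputable def size (A : TreeAutomaton C T Γ Q) : ℕ :=
  Nat.card Q + {p : UnaryOp C T Γ × Q | (A.unary p.1 p.2).isSome}.ncard +
    {p : Q × Q | (A.join p.1 p.2).isSome}.ncard

end TreeAutomaton

/-! ### Multiple context-free grammars -/

/-- A production `head(args) ← body`; the members of `body` are terms `B(y₁, …, yₙ)`. -/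
structure MCFGRule (T N X : Type) where
  head : N
  args : List (List (T ⊕ X))
  body : List (N × List X)

namespace MCFGRule

variable {T N X : Type}

/-- The variable occurrences on the left-hand side. -/
def leftVars (r : MCFGRule T N X) : List X := r.args.flatten.filterMap Sum.getRight?

/-- The variable occurrences on the right-hand side. -/
def rightVars (r : MCFGRule T N X) : List X := r.body.flatMap Prod.snd

def size (r : MCFGRule T N X) : ℕ :=
  1 + (r.args.map fun s => 1 + s.length).sum + (r.body.map fun b => 1 + b.2.length).sum

end MCFGRule

structure MCFG (T N X : Type) where
  arity : N → ℕ
  arity_pos : ∀ A, 1 ≤ arity A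
  start : N
  arity_start : arity start = 1
  rules : List (MCFGRule T N X)
  args_length : ∀ r ∈ rules, r.args.length = arity r.head
  body_length : ∀ r ∈ rules, ∀ b ∈ r.body, b.2.length = arity b.1
  rightVars_nodup : ∀ r ∈ rules, r.rightVars.Nodup
  leftVars_nodup : ∀ r ∈ rules, r.leftVars.Nodup
  leftVars_subset : ∀ r ∈ rules, r.leftVars ⊆ r.rightVars

namespace MCFG

variable {T N X : Type}

/-- Extension of `η : X → T*` to words over letters and variables. -/
def subst (η : X → List T) (s : List (T ⊕ X)) : List T :=
  s.flatMap (Sum.elim (fun a => [a]) η)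

/-- The tuples of words derivable from a nonterminal. -/
inductive Derives (G : MCFG T N X) : N → List (List T) → Prop
  | rule (r : MCFGRule T N X) (hr : r ∈ G.rules) (η : X → List T)
      (h : ∀ b ∈ r.body, Derives G b.1 (b.2.map η)) :
      Derives G r.head (r.args.map (subst η))

def language (G : MCFG T N X) : Set (List T) := {w | G.Derives G.start [w]}

/-- `G` is a `d`-MCFG(`m`): its dimension is at most `d` and its rank is at most `m`. -/
def HasDimRank (G : MCFG T N X) (d m : ℕ) : Prop :=
  (∀ A, G.arity A ≤ d) ∧ ∀ r ∈ G.rules, r.body.length ≤ m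

noncomputable def size (G : MCFG T N X) : ℕ :=
  Nat.card N + Nat.card X + (G.rules.map MCFGRule.size).sum

end MCFG

/-! ### Representation of automata and grammars as data

Letters, edge names, states, nonterminals and variables are represented by arbitrary pairwise
distinct trees (their names), colours `0, …, k - 1` and arities by unary numerals, and finite sets
by lists of their members in any order, without repetitions. -/

def UnaryOp.encode {k : ℕ} {T Γ : Type} (nT : T ↪ Data) (nΓ : Γ ↪ Data) :
    UnaryOp (Fin k) T Γ → Data
  | .node c a => .ofList [.num 0, .num c, .ofList (a.toList.map nT)]
  | .addSucc c₁ c₂ => .ofList [.num 1, .num c₁, .num c₂]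
  | .addEdge γ c₁ c₂ => .ofList [.num 2, nΓ γ, .num c₁, .num c₂]
  | .forget c => .ofList [.num 3, .num c]

/-- `d` represents the tree automaton `A`: it consists of the number `k` of colours, the states, the
state of `bot`, the accepting states, and the two lists of transitions. -/
def TreeAutomaton.EncodedBy {k : ℕ} {T Γ Q : Type} (nT : T ↪ Data) (nΓ : Γ ↪ Data) (nQ : Q ↪ Data)
    (A : TreeAutomaton (Fin k) T Γ Q) (d : Data) : Prop :=
  ∃ (states acc : List Q) (us : List (UnaryOp (Fin k) T Γ × Q × Q)) (js : List (Q × Q × Q)),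
    states.Nodup ∧ (∀ q, q ∈ states) ∧
    acc.Nodup ∧ (∀ q, q ∈ acc ↔ q ∈ A.accept) ∧
    us.Nodup ∧ (∀ op q q', (op, q, q') ∈ us ↔ A.unary op q = some q') ∧
    js.Nodup ∧ (∀ q₁ q₂ q, (q₁, q₂, q) ∈ js ↔ A.join q₁ q₂ = some q) ∧
    d = .ofList [.num k, .ofList (states.map nQ), nQ A.bot, .ofList (acc.map nQ),
      .ofList (us.map fun t => .ofList [t.1.encode nT nΓ, nQ t.2.1, nQ t.2.2]),
      .ofList (js.map fun t => .ofList [nQ t.1, nQ t.2.1, nQ t.2.2])]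

def MCFGRule.encode {T N X : Type} (nT : T ↪ Data) (nN : N ↪ Data) (nX : X ↪ Data)
    (r : MCFGRule T N X) : Data :=
  .ofList [nN r.head,
    .ofList (r.args.map fun s => .ofList (s.map
      (Sum.elim (fun a => .ofList [.num 0, nT a]) (fun x => .ofList [.num 1, nX x])))),
    .ofList (r.body.map fun b => .ofList [nN b.1, .ofList (b.2.map nX)])]

/-- `d` represents the grammar `G`: it consists of the nonterminals with their arities, the
variables, the productions and the start nonterminal. -/
def MCFG.EncodedBy {T N X : Type} (nT : T ↪ Data) (nN : N ↪ Data) (nX : X ↪ Data)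
    (G : MCFG T N X) (d : Data) : Prop :=
  ∃ (nts : List N) (vars : List X), nts.Nodup ∧ (∀ A, A ∈ nts) ∧ vars.Nodup ∧ (∀ x, x ∈ vars) ∧
    d = .ofList [.ofList (nts.map fun A => .ofList [nN A, .num (G.arity A)]),
      .ofList (vars.map nX), .ofList (G.rules.map (MCFGRule.encode nT nN nX)), nN G.start]

/-! The `Succ`-edges of a graph described by an expression form a family of disjoint maximal paths,
its pieces. Everything that later operations can see of a piece is the colour of its first vertex
and the colour of its last vertex; everything that the final word needs is the word along the piece.
So an expression is evaluated in an abstract domain: `AbsState` is a list of pieces (two optional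
colours and a word) together with the list of colours in use. `AbsEval.wellFormed` and
`WellFormed.exists_absEval` show that abstract evaluation succeeds exactly on the well-formed
expressions and describes their graphs. Such a graph is an lo-graph if and only if it has at most
one piece, and then the word of the state is the word of the graph (`mem_wordLanguage_iff`).

A priori the number of pieces is unbounded. But a piece with no coloured end can never be connected
to another one, so a state with such a piece and at least one more piece is `Dead`: no later
operation leads back to a single piece. In a state that is not dead, every piece (if there are at
least two) has its own colour, hence there are at most `k` pieces. Forgetting the words leaves a
shape, and there are only polynomially many shapes in `(k + 2) ^ k = 2 ^ O(k log k)`.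

The nonterminals of the grammar are the pairs of an automaton state and a shape, besides the start
symbol. Such a pair derives the words of the pieces, as a `k`-tuple padded with empty words. The
productions come from symbolic evaluation: the words of a state are replaced by distinct variables
and the operation is carried out. Operations decide by colours alone and only concatenate words, so
they commute with substitution (`unary_mapWord`, `join_mapWord`). Induction on derivations and on
abstract evaluations gives `sound` and `complete`.

Each transition of the automaton yields rules for at most all pairs of shapes, which gives a grammar
of size linear in the automaton and polynomial in `(k + 2) ^ k`. The same bound holds for the
running time. It is obtained from a calculus of computable families (`Comp`), closed under pairing,
case distinction and list recursion, in which the time bound is carried along. Names of letters,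
states and edges are only copied, never compared, so their size is irrelevant. -/

/-! ### Extending and relocating programs -/

/-! ### Programs, time bounds, and a calculus of computable families. -/

namespace Code

/-- Relocation: all function indices are increased by `s`. -/
def shift (s : ℕ) : Code → Code
  | var i => var i
  | nil => nil
  | cons a b => cons (a.shift s) (b.shift s)
  | head a => head (a.shift s)
  | tail a => tail (a.shift s)
  | ite c a b => ite (c.shift s) (a.shift s) (b.shift s)
  | letIn a b => letIn (a.shift s) (b.shift s)
  | call f a => call (f + s) (a.shift s)

namespace Eval

variable {P : List Code} {env : List Data} {e : Code} {v : Data} {t : ℕ}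

/-- Together with `append_prog` this allows two programs to share one function list: one keeps its
indices, the other is moved behind it. Step counts do not change. -/
theorem relocate (h : Eval P env e v t) (P₀ : List Code) :
    Eval (P₀ ++ P.map (Code.shift P₀.length)) env (e.shift P₀.length) v t := by
  induction h with
  | var h => exact .var h
  | nil => exact .nil
  | cons _ _ h₁ h₂ => exact .cons h₁ h₂
  | head _ h => exact .head h
  | tail _ h => exact .tail h
  | iteTrue _ _ h₁ h₂ => exact .iteTrue h₁ h₂
  | iteFalse _ _ h₁ h₂ => exact .iteFalse h₁ h₂
  | letIn _ _ h₁ h₂ => exact .letIn h₁ h₂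
  | call hf _ _ h₁ h₂ =>
    refine .call ?_ h₁ h₂
    rw [List.getElem?_append_right (by omega)]
    simp [hf]

theorem append_prog (h : Eval P env e v t) (P₁ : List Code) : Eval (P ++ P₁) env e v t := by
  induction h with
  | var h => exact .var h
  | nil => exact .nil
  | cons _ _ h₁ h₂ => exact .cons h₁ h₂
  | head _ h => exact .head h
  | tail _ h => exact .tail h
  | iteTrue _ _ h₁ h₂ => exact .iteTrue h₁ h₂
  | iteFalse _ _ h₁ h₂ => exact .iteFalse h₁ h₂
  | letIn _ _ h₁ h₂ => exact .letIn h₁ h₂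
  | call hf _ _ h₁ h₂ =>
    refine .call ?_ h₁ h₂
    rw [List.getElem?_append_left (List.getElem?_eq_some_iff.mp hf).1]
    exact hf

theorem append_env (h : Eval P env e v t) (env' : List Data) : Eval P (env ++ env') e v t := by
  induction h with
  | var h =>
    refine .var ?_
    rw [List.getElem?_append_left (List.getElem?_eq_some_iff.mp h).1]
    exact h
  | nil => exact .nil
  | cons _ _ h₁ h₂ => exact .cons h₁ h₂
  | head _ h => exact .head h
  | tail _ h => exact .tail h
  | iteTrue _ _ h₁ h₂ => exact .iteTrue h₁ h₂
  | iteFalse _ _ h₁ h₂ => exact .iteFalse h₁ h₂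
  | letIn _ _ h₁ h₂ => exact .letIn h₁ h₂
  -- A function body runs in its own one-element environment, so its evaluation is reused unchanged
  -- and the induction hypothesis for it is not wanted.
  | call hf _ hb h₁ _ => exact .call hf h₁ hb

end Eval

end Code

/-! ### Bounds that are polynomial in one parameter and linear in another -/

/-- `f` is bounded by a polynomial in `m`, times `n + 1`. -/
def Bdd {ι : Type*} (n m f : ι → ℕ) : Prop :=
  ∃ C : ℕ, ∀ i, f i ≤ (n i + 1) * (m i + 2) ^ C

namespace Bdd

variable {ι : Type*} {n m f g : ι → ℕ}

theorem mono (h : Bdd n m f) (hg : ∀ i, g i ≤ f i) : Bdd n m g :=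
  let ⟨C, hC⟩ := h
  ⟨C, fun i => (hg i).trans (hC i)⟩

theorem mono_left {n' : ι → ℕ} (h : Bdd n m f) (hn : ∀ i, n i ≤ n' i) : Bdd n' m f :=
  let ⟨C, hC⟩ := h
  ⟨C, fun i => (hC i).trans (Nat.mul_le_mul_right _ (Nat.succ_le_succ (hn i)))⟩

theorem of_zero (h : Bdd (fun _ => 0) m f) : Bdd n m f := h.mono_left fun _ => Nat.zero_le _

theorem pull {κ : Type*} (h : Bdd n m f) (π : κ → ι) :
    Bdd (fun j => n (π j)) (fun j => m (π j)) (fun j => f (π j)) :=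
  let ⟨C, hC⟩ := h
  ⟨C, fun j => hC (π j)⟩

theorem param : Bdd n m m :=
  ⟨1, fun i => by nlinarith [Nat.zero_le (n i), Nat.zero_le (m i)]⟩

theorem linear : Bdd n m n := ⟨0, fun i => by simp⟩

/-- Only one factor may depend on `n`, since the bound has to stay linear in `n`. -/
theorem mul (hf : Bdd n m f) (hg : Bdd (fun _ => 0) m g) : Bdd n m fun i => f i * g i := by
  obtain ⟨C, hC⟩ := hf
  obtain ⟨D, hD⟩ := hg
  refine ⟨C + D, fun i => (Nat.mul_le_mul (hC i) (hD i)).trans (le_of_eq ?_)⟩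
  ring

theorem const (c : ℕ) : Bdd n m fun _ => c := by
  refine ⟨c, fun i => ?_⟩
  calc c ≤ 2 ^ c := Nat.lt_two_pow_self.le
    _ ≤ (m i + 2) ^ c := Nat.pow_le_pow_left (by omega) c
    _ ≤ _ := Nat.le_mul_of_pos_left _ (by omega)

theorem add (hf : Bdd n m f) (hg : Bdd n m g) : Bdd n m fun i => f i + g i := by
  obtain ⟨C, hC⟩ := hf
  obtain ⟨D, hD⟩ := hg
  -- The additional exponent absorbs the factor 2 of the sum, because the base is at least 2.
  refine ⟨C + D + 1, fun i => ?_⟩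
  have h1 : (m i + 2) ^ C ≤ (m i + 2) ^ (C + D) := Nat.pow_le_pow_right (by omega) (by omega)
  have h2 : (m i + 2) ^ D ≤ (m i + 2) ^ (C + D) := Nat.pow_le_pow_right (by omega) (by omega)
  calc f i + g i ≤ (n i + 1) * (m i + 2) ^ (C + D) + (n i + 1) * (m i + 2) ^ (C + D) :=
        Nat.add_le_add ((hC i).trans (Nat.mul_le_mul_left _ h1))
          ((hD i).trans (Nat.mul_le_mul_left _ h2))
    _ = (n i + 1) * ((m i + 2) ^ (C + D) * 2) := by ring
    _ ≤ _ := Nat.mul_le_mul_left _ (by rw [pow_succ]; exact Nat.mul_le_mul_left _ (by omega))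

end Bdd

/-! ### Feasibly computable families -/

/-- Some program computes `out i` from `inp i`, for every index `i`, and its running time is bounded
by a polynomial in `m i`, times `n i + 1`. -/
def Comp {ι : Type*} (n m : ι → ℕ) (inp out : ι → Data) : Prop :=
  ∃ (P : List Code) (e : Code) (b : ι → ℕ), Bdd n m b ∧
    ∀ i, ∃ t ≤ b i, Code.Eval P [inp i] e (out i) t

namespace Comp

variable {ι κ : Type*} {n m : ι → ℕ} {inp out out₁ out₂ : ι → Data}

theorem id : Comp n m inp inp := ⟨[], .var 0, _, .const 1, fun _ => ⟨1, le_rfl, .var rfl⟩⟩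

theorem nil : Comp n m inp fun _ => .nil := ⟨[], .nil, _, .const 1, fun _ => ⟨1, le_rfl, .nil⟩⟩

theorem of_eq (h : Comp n m inp out₁) (he : ∀ i, out₁ i = out₂ i) : Comp n m inp out₂ :=
  funext he ▸ h

theorem pull (h : Comp n m inp out) (π : κ → ι) :
    Comp (fun j => n (π j)) (fun j => m (π j)) (fun j => inp (π j)) (fun j => out (π j)) :=
  let ⟨P, e, _, hb, h⟩ := h
  ⟨P, e, _, hb.pull π, fun j => h (π j)⟩

theorem of_zero (h : Comp (fun _ => 0) m inp out) : Comp n m inp out :=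
  let ⟨P, e, b, hb, h⟩ := h
  ⟨P, e, b, hb.of_zero, h⟩

/-- Two computations can be carried out by one program. -/
theorem merge {n' m' : κ → ℕ} {inp' out' : κ → Data} (h : Comp n m inp out)
    (h' : Comp n' m' inp' out') :
    ∃ (P : List Code) (e e' : Code) (b : ι → ℕ) (b' : κ → ℕ), Bdd n m b ∧ Bdd n' m' b' ∧
      (∀ i, ∃ t ≤ b i, Code.Eval P [inp i] e (out i) t) ∧
      ∀ i, ∃ t ≤ b' i, Code.Eval P [inp' i] e' (out' i) t := by
  obtain ⟨P, e, b, hb, h⟩ := h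
  obtain ⟨P', e', b', hb', h'⟩ := h'
  refine ⟨P ++ P'.map (Code.shift P.length), e, e'.shift P.length, b, b', hb, hb', fun i => ?_,
    fun i => ?_⟩
  · obtain ⟨t, ht, h⟩ := h i
    exact ⟨t, ht, h.append_prog _⟩
  · obtain ⟨t, ht, h⟩ := h' i
    exact ⟨t, ht, h.relocate _⟩

theorem merge₃ {κ₁ κ₂ : Type*} {n₁ m₁ : κ₁ → ℕ} {inp₁ out₁ : κ₁ → Data} {n₂ m₂ : κ₂ → ℕ}
    {inp₂ out₂ : κ₂ → Data} (h : Comp n m inp out) (h₁ : Comp n₁ m₁ inp₁ out₁)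
    (h₂ : Comp n₂ m₂ inp₂ out₂) :
    ∃ (P : List Code) (e e₁ e₂ : Code) (b : ι → ℕ) (b₁ : κ₁ → ℕ) (b₂ : κ₂ → ℕ),
      Bdd n m b ∧ Bdd n₁ m₁ b₁ ∧ Bdd n₂ m₂ b₂ ∧
      (∀ i, ∃ t ≤ b i, Code.Eval P [inp i] e (out i) t) ∧
      (∀ i, ∃ t ≤ b₁ i, Code.Eval P [inp₁ i] e₁ (out₁ i) t) ∧
      ∀ i, ∃ t ≤ b₂ i, Code.Eval P [inp₂ i] e₂ (out₂ i) t := by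
  obtain ⟨P, e, e₁, b, b₁, hb, hb₁, h, h₁⟩ := h.merge h₁
  obtain ⟨P', e', b', hb', h'⟩ := h₂
  refine ⟨P ++ P'.map (Code.shift P.length), e, e₁, e'.shift P.length, b, b₁, b', hb, hb₁, hb',
    fun i => ?_, fun i => ?_, fun i => ?_⟩
  · obtain ⟨t, ht, h⟩ := h i
    exact ⟨t, ht, h.append_prog _⟩
  · obtain ⟨t, ht, h⟩ := h₁ i
    exact ⟨t, ht, h.append_prog _⟩
  · obtain ⟨t, ht, h⟩ := h' i
    exact ⟨t, ht, h.relocate _⟩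

theorem cons (h₁ : Comp n m inp out₁) (h₂ : Comp n m inp out₂) :
    Comp n m inp fun i => .cons (out₁ i) (out₂ i) := by
  obtain ⟨P, e₁, e₂, b₁, b₂, hb₁, hb₂, h₁, h₂⟩ := h₁.merge h₂
  refine ⟨P, .cons e₁ e₂, _, (hb₁.add hb₂).add (.const 1), fun i => ?_⟩
  obtain ⟨t₁, ht₁, h₁⟩ := h₁ i
  obtain ⟨t₂, ht₂, h₂⟩ := h₂ i
  exact ⟨_, by omega, .cons h₁ h₂⟩

theorem head (h : Comp n m inp out) : Comp n m inp fun i => (out i).head := by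
  obtain ⟨P, e, b, hb, h⟩ := h
  refine ⟨P, .head e, _, hb.add (.const 1), fun i => ?_⟩
  obtain ⟨t, ht, h⟩ := h i
  exact ⟨_, by omega, .head h⟩

theorem tail (h : Comp n m inp out) : Comp n m inp fun i => (out i).tail := by
  obtain ⟨P, e, b, hb, h⟩ := h
  refine ⟨P, .tail e, _, hb.add (.const 1), fun i => ?_⟩
  obtain ⟨t, ht, h⟩ := h i
  exact ⟨_, by omega, .tail h⟩

/-- A local binding puts the intermediate value at position 0, where the second program expects its
input; the old input behind it does no harm. -/
theorem comp (h₁ : Comp n m inp out₁) (h₂ : Comp n m out₁ out₂) : Comp n m inp out₂ := by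
  obtain ⟨P, e₁, e₂, b₁, b₂, hb₁, hb₂, h₁, h₂⟩ := h₁.merge h₂
  refine ⟨P, .letIn e₁ e₂, _, (hb₁.add hb₂).add (.const 1), fun i => ?_⟩
  obtain ⟨t₁, ht₁, h₁⟩ := h₁ i
  obtain ⟨t₂, ht₂, h₂⟩ := h₂ i
  exact ⟨_, by omega, .letIn h₁ (h₂.append_env [inp i])⟩

/-- Computation in an extended context. -/
theorem lift (h : Comp n m inp out) (π : κ → ι) (y : κ → Data) :
    Comp (fun j => n (π j)) (fun j => m (π j)) (fun j => .cons (inp (π j)) (y j))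
      (fun j => out (π j)) :=
  (id.head).comp (h.pull π)

/-- Definition by cases. -/
theorem ite {c : ι → Data} (hc : Comp n m inp c)
    (h₁ : Comp (fun i : {i // c i ≠ .nil} => n i) (fun i => m i) (fun i => inp i) (fun i => out i))
    (h₂ : Comp (fun i : {i // c i = .nil} => n i) (fun i => m i) (fun i => inp i)
      (fun i => out i)) :
    Comp n m inp out := by
  classical
  obtain ⟨P, e, e₁, e₂, b, b₁, b₂, hb, hb₁, hb₂, h, h₁, h₂⟩ := hc.merge₃ h₁ h₂
  obtain ⟨C₁, hC₁⟩ := hb₁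
  obtain ⟨C₂, hC₂⟩ := hb₂
  -- The bounds `b₁` and `b₂` exist only on the indices of their branch, so the total bound uses the
  -- closed expressions that dominate them, which make sense for every index.
  refine ⟨P, .ite e e₁ e₂,
    fun i => b i + ((n i + 1) * (m i + 2) ^ C₁ + (n i + 1) * (m i + 2) ^ C₂) + 1,
    (hb.add (.add ⟨C₁, fun _ => le_rfl⟩ ⟨C₂, fun _ => le_rfl⟩)).add (.const 1), fun i => ?_⟩
  obtain ⟨t, ht, h⟩ := h i
  by_cases hi : c i = .nil
  · obtain ⟨t₂, ht₂, h₂⟩ := h₂ ⟨i, hi⟩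
    rw [hi] at h
    have := hC₂ ⟨i, hi⟩
    exact ⟨t + t₂ + 1, by dsimp only at this ⊢; omega, .iteFalse h h₂⟩
  · obtain ⟨t₁, ht₁, h₁⟩ := h₁ ⟨i, hi⟩
    have := hC₁ ⟨i, hi⟩
    obtain ⟨x, y, hxy⟩ : ∃ x y, c i = .cons x y := by
      cases hx : c i with
      | nil => exact absurd hx hi
      | cons x y => exact ⟨x, y, rfl⟩
    rw [hxy] at h
    exact ⟨t + t₁ + 1, by dsimp only at this ⊢; omega, .iteTrue h h₁⟩

end Comp

/-- The elements of a family of lists. -/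
structure ListElem {ι : Type*} {α : ι → Type*} (ls : ∀ i, List (α i)) where
  idx : ι
  elem : α idx
  mem : elem ∈ ls idx

/-- The nonempty suffixes of a family of lists. -/
structure ListSuffix {ι : Type*} {α : ι → Type*} (ls : ∀ i, List (α i)) where
  idx : ι
  hd : α idx
  tl : List (α idx)
  suffix : hd :: tl <:+ ls idx

namespace Comp

variable {ι κ : Type*} {n m : ι → ℕ} {inp out out₁ out₂ : ι → Data} {α : ι → Type*}

/-- Recursion over a list. -/
theorem foldr {ls : ∀ i, List (α i)} {e : ∀ i, α i → Data} (F : ∀ i, List (α i) → Data)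
    (hl : Comp n m inp fun i => .ofList ((ls i).map (e i)))
    (hlen : Bdd n m fun i => (ls i).length)
    (h₀ : Comp n m inp fun i => F i [])
    (hs : Comp (fun _ => 0) (fun p : ListSuffix ls => m p.idx)
      (fun p => .cons (inp p.idx) (.cons (e _ p.hd) (F _ p.tl))) (fun p => F _ (p.hd :: p.tl))) :
    Comp n m inp fun i => F i (ls i) := by
  obtain ⟨P, el, e₀, es, bl, b₀, bs, hbl, hb₀, ⟨C, hC⟩, hl, h₀, hs⟩ := hl.merge₃ h₀ hs
  -- The loop is a new function at the end of the program that calls itself. Its argument is the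
  -- pair of the context and the remaining list, so `tail (var 0)` doubles as the test for the empty
  -- list.
  set body : Code := .ite (.tail (.var 0))
    (.letIn (.cons (.head (.var 0)) (.cons (.head (.tail (.var 0)))
      (.call P.length (.cons (.head (.var 0)) (.tail (.tail (.var 0))))))) es)
    (.letIn (.head (.var 0)) e₀) with hbody
  have hcall : (P ++ [body])[P.length]? = some body := by simp
  -- Each round costs at most `(m i + 2) ^ C` plus the overhead of the loop, for which 20 is ample.
  -- A round must not depend on `n`; the only linear factor is then the length of the list.
  refine ⟨P ++ [body], .call P.length (.cons (.var 0) el),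
    fun i => bl i + (b₀ i + ((ls i).length + 1) * ((m i + 2) ^ C + 20)) + 10,
    (hbl.add (hb₀.add ((hlen.add (.const 1)).mul (.add ⟨C, fun i => by simp⟩ (.const 20))))).add
      (.const 10), fun i => ?_⟩
  have key : ∀ l : List (α i), l <:+ ls i → ∃ t ≤ b₀ i + (l.length + 1) * ((m i + 2) ^ C + 20),
      Code.Eval (P ++ [body]) [.cons (inp i) (.ofList (l.map (e i)))] body (F i l) t := by
    intro l
    induction l with
    | nil =>
      intro _
      obtain ⟨t, ht, h⟩ := h₀ i
      have hrun : Code.Eval (P ++ [body]) [.cons (inp i) (.ofList (([] : List (α i)).map (e i)))]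
          body (F i []) _ :=
        .iteFalse (.tail (v := .cons (inp i) .nil) (.var rfl))
          (.letIn (.head (.var rfl)) ((h.append_prog _).append_env _))
      exact ⟨_, by simp only [List.length_nil]; omega, hrun⟩
    | cons a l ih =>
      intro hsuf
      obtain ⟨t, ht, h⟩ := ih ((List.suffix_cons a l).trans hsuf)
      obtain ⟨t', ht', h'⟩ := hs ⟨i, a, l, hsuf⟩
      have hb := hC ⟨i, a, l, hsuf⟩
      simp only [Nat.zero_add, one_mul] at hb ht'
      have htail : Code.Eval (P ++ [body]) [.cons (inp i) (.ofList ((a :: l).map (e i)))]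
          (.tail (.var 0)) (.cons (e i a) (.ofList (l.map (e i)))) 2 :=
        .tail (v := .cons (inp i) (.ofList ((a :: l).map (e i)))) (.var rfl)
      have hrun : Code.Eval (P ++ [body]) [.cons (inp i) (.ofList ((a :: l).map (e i)))]
          body (F i (a :: l)) _ :=
        .iteTrue htail (.letIn (.cons (.head (.var rfl)) (.cons (.head htail)
          (.call hcall (.cons (.head (.var rfl)) (.tail htail)) h)))
            ((h'.append_prog _).append_env _))
      refine ⟨_, ?_, hrun⟩
      simp only [List.length_cons]
      have : (l.length + 1 + 1) * ((m i + 2) ^ C + 20)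
        = (l.length + 1) * ((m i + 2) ^ C + 20) + ((m i + 2) ^ C + 20) := by ring
      omega
  obtain ⟨t, ht, h⟩ := key (ls i) List.suffix_rfl
  obtain ⟨t', ht', h'⟩ := hl i
  exact ⟨_, by dsimp only; omega, .call hcall (.cons (.var rfl) (h'.append_prog _)) h⟩

/-- A computation yields a program whose main function carries it out. -/
theorem exists_program (h : Comp n m inp out) :
    ∃ (P : List Code) (b : ι → ℕ), Bdd n m b ∧
      ∀ i, ∃ t ≤ b i, RunsInSteps P (inp i) (out i) t := by
  obtain ⟨P, e, b, hb, h⟩ := h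
  -- The main function has to sit at index 0, so all other functions move up by one; the call and
  -- the reading of its argument cost two steps.
  refine ⟨e.shift 1 :: P.map (Code.shift 1), _, hb.add (.const 2), fun i => ?_⟩
  obtain ⟨t, ht, h⟩ := h i
  have := h.relocate [e.shift 1]
  exact ⟨1 + t + 1, by omega, .call rfl (.var rfl) this⟩

end Comp

/-! ### Graphs as families of maximal paths, and their abstract states. -/

section

/-! ### Consecutive members of a list -/

/-- `u` and `v` are consecutive members of `p`. -/
def List.Consec {V : Type*} (p : List V) (u v : V) : Prop := [u, v] <:+: p

namespace List.Consec

variable {V W : Type*} {p q : List V} {u v : V}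

@[simp] theorem nil_iff : ¬ ([] : List V).Consec u v := by simp [List.Consec]

theorem cons_iff {a : V} : (a :: p).Consec u v ↔ (a = u ∧ p.head? = some v) ∨ p.Consec u v := by
  unfold List.Consec
  rw [List.infix_cons_iff, List.cons_prefix_cons]
  cases p with
  | nil => simp
  | cons b p => simp [List.cons_prefix_cons, eq_comm]

theorem left_mem (h : p.Consec u v) : u ∈ p := h.subset (by simp)

theorem right_mem (h : p.Consec u v) : v ∈ p := h.subset (by simp)

theorem append_iff : (p ++ q).Consec u v ↔
    p.Consec u v ∨ q.Consec u v ∨ (p.getLast? = some u ∧ q.head? = some v) := by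
  induction p with
  | nil => simp
  | cons a p ih =>
    rw [List.cons_append, cons_iff, ih, cons_iff]
    cases p with
    | nil => simp; tauto
    | cons b p => simp; tauto

theorem map_iff {f : V → W} {x y : W} : (p.map f).Consec x y ↔
    ∃ u v, f u = x ∧ f v = y ∧ p.Consec u v := by
  induction p with
  | nil => simp
  | cons a p ih =>
    simp only [List.map_cons, cons_iff, ih, List.head?_map, Option.map_eq_some_iff]
    constructor
    · rintro (⟨rfl, v, hv, rfl⟩ | ⟨u, v, rfl, rfl, h⟩)
      · exact ⟨a, v, rfl, rfl, .inl ⟨rfl, hv⟩⟩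
      · exact ⟨u, v, rfl, rfl, .inr h⟩
    · rintro ⟨u, v, rfl, rfl, ⟨rfl, h⟩ | h⟩
      · exact .inl ⟨rfl, v, h, rfl⟩
      · exact .inr ⟨u, v, rfl, rfl, h⟩

theorem not_of_getLast? (hp : p.Nodup) (hu : p.getLast? = some u) : ¬ p.Consec u v := by
  induction p with
  | nil => simp
  | cons a p ih =>
    rw [cons_iff]
    rw [List.nodup_cons] at hp
    cases p with
    | nil => simp
    | cons b p =>
      rw [List.getLast?_cons_cons] at hu
      rintro (⟨rfl, -⟩ | h)
      · exact hp.1 (List.mem_of_getLast? hu)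
      · exact ih hp.2 hu h

theorem not_of_head? (hp : p.Nodup) (hv : p.head? = some v) : ¬ p.Consec u v := by
  cases p with
  | nil => simp
  | cons a p =>
    obtain rfl : a = v := by simpa using hv
    rw [cons_iff]
    rw [List.nodup_cons] at hp
    rintro (⟨-, h⟩ | h)
    · exact hp.1 (List.mem_of_head? h)
    · exact hp.1 h.right_mem

theorem getLast?_of_forall_not (hu : u ∈ p) (h : ∀ v, ¬ p.Consec u v) : p.getLast? = some u := by
  induction p with
  | nil => simp at hu
  | cons a p ih =>
    simp only [cons_iff, not_or, not_and] at h
    cases p with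
    | nil => simpa [eq_comm] using hu
    | cons b p =>
      rw [List.getLast?_cons_cons]
      rcases List.mem_cons.mp hu with rfl | hu
      · exact absurd rfl ((h b).1 rfl)
      · exact ih hu fun v => (h v).2

theorem head?_of_forall_not (hv : v ∈ p) (h : ∀ u, ¬ p.Consec u v) : p.head? = some v := by
  induction p with
  | nil => simp at hv
  | cons a p ih =>
    rcases List.mem_cons.mp hv with rfl | hv
    · rfl
    · simp only [cons_iff, not_or, not_and] at h
      exact absurd (ih hv fun u => (h u).2) ((h a).1 rfl)

/-- Serves to translate the applicability condition of a successor edge: the target does not reach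
the source only if the two ends lie on different paths. -/
theorem reachable (hv : p.head? = some v) (hu : u ∈ p) :
    Relation.ReflTransGen p.Consec v u := by
  induction p generalizing v with
  | nil => simp at hu
  | cons a p ih =>
    obtain rfl : a = v := by simpa using hv
    rcases List.mem_cons.mp hu with rfl | hu
    · exact .refl
    · cases p with
      | nil => simp at hu
      | cons b p =>
        exact .head (cons_iff.mpr (.inl ⟨rfl, rfl⟩))
          (Relation.ReflTransGen.mono (fun x y h => cons_iff.mpr (.inr h)) _ _ (ih rfl hu))

end List.Consec

/-! ### Abstract states: the pieces of a graph and the colours in use -/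

/-- A piece of a graph: the colours of its first and its last vertex, and its word. -/
structure Piece (C Z : Type) where
  first : Option C
  last : Option C
  word : List Z

/-- The list of the pieces of a graph, and the list of the colours in use. -/
structure AbsState (C Z : Type) where
  pieces : List (Piece C Z)
  used : List C

variable {C T Γ Z : Type}

namespace AbsState

def empty : AbsState C Z := ⟨[], []⟩

def append (S₁ S₂ : AbsState C Z) : AbsState C Z :=
  ⟨S₁.pieces ++ S₂.pieces, S₁.used ++ S₂.used⟩

def single (c : C) (w : List Z) : AbsState C Z := ⟨[⟨some c, some c, w⟩], [c]⟩

variable [DecidableEq C]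

/-- Disjoint union, in case the sets of colours in use are disjoint. -/
def join (S₁ S₂ : AbsState C Z) : List (AbsState C Z) :=
  if (S₁.used.filter (· ∈ S₂.used)).isEmpty then [S₁.append S₂] else []

/-- The possible results of joining a piece with last colour `c₁` to a piece with first colour
`c₂`. -/
def addSucc (c₁ c₂ : C) (S : AbsState C Z) : List (AbsState C Z) :=
  (S.pieces.filter fun r => r.last = some c₁ ∧ r.first ≠ some c₂).flatMap fun r₁ =>
    (S.pieces.filter fun r => r.first = some c₂ ∧ r.last ≠ some c₁).map fun r₂ =>
      ⟨⟨r₁.first, r₂.last, r₁.word ++ r₂.word⟩ ::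
        S.pieces.filter fun r => r.last ≠ some c₁ ∧ r.first ≠ some c₂, S.used⟩

def forgetColor (c : C) (o : Option C) : Option C := if o = some c then none else o

def forget (c : C) (S : AbsState C Z) : AbsState C Z :=
  ⟨S.pieces.map fun r => ⟨forgetColor c r.first, forgetColor c r.last, r.word⟩,
    S.used.filter (· ≠ c)⟩

/-- The effect of a unary operation: the list of the possible results; `ℓ` turns vertex labels into
words. -/
def unary (ℓ : Option T → List Z) : UnaryOp C T Γ → AbsState C Z → List (AbsState C Z)
  | .node c a, S => if c ∈ S.used then [] else [S.append (single c (ℓ a))]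
  | .addSucc c₁ c₂, S => S.addSucc c₁ c₂
  | .addEdge _ _ _, S => [S]
  | .forget c, S => [S.forget c]

end AbsState

/-! ### Abstract states represent graphs -/

/-- The piece with the list of vertices `p`. -/
def Piece.ofPath {V : Type*} (color : V → Option C) (label : V → Option T) (p : List V) :
    Piece C T :=
  ⟨p.head?.bind color, p.getLast?.bind color, p.filterMap label⟩

/-- `ps` lists the maximal paths of the relation `succ`, and different vertices have different
colours. -/
structure IsPaths {V : Type} (succ : V → V → Prop) (color : V → Option C) (ps : List (List V)) :
    Prop where
  nodup : ps.flatten.Nodup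
  mem : ∀ v, v ∈ ps.flatten
  ne_nil : ∀ p ∈ ps, p ≠ []
  succ_iff : ∀ u v, succ u v ↔ ∃ p ∈ ps, p.Consec u v
  inj : ∀ u v c, color u = some c → color v = some c → u = v

/-- `S` represents the graph with the given successor relation, labels and colours. -/
structure Represents {V : Type} (succ : V → V → Prop) (label : V → Option T) (color : V → Option C)
    (S : AbsState C T) (ps : List (List V)) : Prop extends IsPaths succ color ps where
  pieces_eq : S.pieces = ps.map (Piece.ofPath color label)
  mem_used : ∀ c, c ∈ S.used ↔ ∃ v, color v = some c
  used_nodup : S.used.Nodup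

variable {V W : Type} {succ : V → V → Prop} {label : V → Option T} {color : V → Option C}
  {S S' : AbsState C T} {ps : List (List V)}

namespace IsPaths

variable (h : IsPaths succ color ps)
include h

theorem eq_of_mem {p q : List V} {v : V} (hp : p ∈ ps) (hq : q ∈ ps) (hvp : v ∈ p)
    (hvq : v ∈ q) : p = q := by
  by_contra hne
  have : Std.Symm (List.Disjoint (α := V)) := ⟨fun _ _ h => h.symm⟩
  have := (List.nodup_flatten.mp h.nodup).2.forall hp hq hne
  exact this hvp hvq

theorem path_nodup {p : List V} (hp : p ∈ ps) : p.Nodup := (List.nodup_flatten.mp h.nodup).1 p hp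

/-- Disjointness alone would allow the empty path to be repeated; nonemptiness excludes this. -/
theorem paths_nodup : ps.Nodup := by
  refine (List.nodup_flatten.mp h.nodup).2.imp_of_mem fun {p q} hp _ hpq heq => ?_
  subst heq
  obtain ⟨v, hv⟩ := List.exists_mem_of_ne_nil p (h.ne_nil p hp)
  exact hpq hv hv

/-- The path through a vertex is unique, so all successors of a vertex can be read off from any path
known to contain it. The primed version does the same for predecessors. -/
theorem succ_iff_consec {p : List V} {u v : V} (hp : p ∈ ps) (hu : u ∈ p) :
    succ u v ↔ p.Consec u v := by
  rw [h.succ_iff]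
  exact ⟨fun ⟨q, hq, hc⟩ => h.eq_of_mem hp hq hu hc.left_mem ▸ hc, fun hc => ⟨p, hp, hc⟩⟩

theorem succ_iff_consec' {p : List V} {u v : V} (hp : p ∈ ps) (hv : v ∈ p) :
    succ u v ↔ p.Consec u v := by
  rw [h.succ_iff]
  exact ⟨fun ⟨q, hq, hc⟩ => h.eq_of_mem hp hq hv hc.right_mem ▸ hc, fun hc => ⟨p, hp, hc⟩⟩

theorem exists_path (v : V) : ∃ p ∈ ps, v ∈ p := by
  simpa using h.mem v

end IsPaths

namespace Represents

theorem empty (succ : Empty → Empty → Prop) (label : Empty → Option T)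
    (color : Empty → Option C) : Represents succ label color .empty [] where
  nodup := by simp
  mem := fun v => nomatch v
  ne_nil := by simp
  succ_iff := fun v => nomatch v
  inj := fun v => nomatch v
  pieces_eq := rfl
  mem_used := by simp [AbsState.empty]
  used_nodup := by simp [AbsState.empty]

theorem single (c : C) (a : Option T) :
    Represents (fun _ _ : Unit => False) (fun _ => a) (fun _ => some c) (.single c a.toList) [[()]] where
  nodup := by simp
  mem := fun v => by simp
  ne_nil := by simp
  succ_iff := fun u v => by simp [List.Consec.cons_iff]
  inj := fun _ _ _ _ _ => rfl
  pieces_eq := by cases a <;> simp [AbsState.single, Piece.ofPath]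
  mem_used := fun c' => by simp [AbsState.single, eq_comm]
  used_nodup := by simp [AbsState.single]

/-- The paths of both sides are kept, in separate summands. Disjointness of the colours is what
keeps each colour on at most one vertex; adding a vertex is the special case of a one-vertex right
operand. -/
theorem union {succ' : W → W → Prop} {label' : W → Option T} {color' : W → Option C}
    {S₁ S₂ : AbsState C T} {qs : List (List W)}
    (h₁ : Represents succ label color S₁ ps) (h₂ : Represents succ' label' color' S₂ qs)
    (hd : ∀ u v c, color u = some c → color' v ≠ some c) :
    Represents (Sum.LiftRel succ succ') (Sum.elim label label') (Sum.elim color color') (S₁.append S₂)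
      (ps.map (List.map Sum.inl) ++ qs.map (List.map Sum.inr)) where
  nodup := by
    rw [List.flatten_append, ← List.map_flatten, ← List.map_flatten, List.nodup_append]
    refine ⟨h₁.nodup.map Sum.inl_injective, h₂.nodup.map Sum.inr_injective, ?_⟩
    simp only [List.mem_map]
    rintro _ ⟨u, -, rfl⟩ _ ⟨v, -, rfl⟩
    exact Sum.inl_ne_inr
  mem := by
    rw [List.flatten_append, ← List.map_flatten, ← List.map_flatten]
    rintro (v | v)
    · exact List.mem_append_left _ (List.mem_map_of_mem (h₁.mem v))
    · exact List.mem_append_right _ (List.mem_map_of_mem (h₂.mem v))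
  ne_nil := by
    simp only [List.mem_append, List.mem_map]
    rintro _ (⟨p, hp, rfl⟩ | ⟨p, hp, rfl⟩)
    · simpa using h₁.ne_nil p hp
    · simpa using h₂.ne_nil p hp
  succ_iff := by
    have hG := h₁.succ_iff
    have hH := h₂.succ_iff
    rintro (u | u) (v | v) <;>
      simp [List.Consec.map_iff, hG, hH, or_and_right, exists_or]
  inj := by
    rintro (u | u) (v | v) c hu hv
    · exact congrArg _ (h₁.inj u v c hu hv)
    · exact absurd hv (hd u v c hu)
    · exact absurd hu (hd v u c hv)
    · exact congrArg _ (h₂.inj u v c hu hv)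
  pieces_eq := by
    simp only [AbsState.append, h₁.pieces_eq, h₂.pieces_eq, List.map_append, List.map_map]
    congr 1 <;> refine List.map_congr_left fun p _ => ?_ <;>
      simp [Piece.ofPath, List.filterMap_map, Function.comp_def,
        Option.bind_map]
  mem_used := fun c => by
    simp [AbsState.append, h₁.mem_used, h₂.mem_used]
  used_nodup := by
    refine List.nodup_append.mpr ⟨h₁.used_nodup, h₂.used_nodup, ?_⟩
    rintro c hc₁ _ hc₂ rfl
    obtain ⟨u, hu⟩ := (h₁.mem_used c).mp hc₁
    obtain ⟨v, hv⟩ := (h₂.mem_used c).mp hc₂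
    exact hd u v c hu hv

variable [DecidableEq C]

theorem forget (h : Represents succ label color S ps) (c : C) :
    Represents succ label (fun v => if color v = some c then none else color v) (S.forget c) ps where
  nodup := h.nodup
  mem := h.mem
  ne_nil := h.ne_nil
  succ_iff := h.succ_iff
  inj := by
    intro u v c' hu hv
    refine h.inj u v c' ?_ ?_ <;> grind
  pieces_eq := by
    simp only [AbsState.forget, h.pieces_eq, List.map_map]
    refine List.map_congr_left fun p _ => ?_
    have key : ∀ o : Option V, AbsState.forgetColor c (o.bind color)
        = o.bind (fun v => if color v = some c then none else color v) := by
      rintro (_ | v) <;> simp [AbsState.forgetColor]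
    simp only [Function.comp, Piece.ofPath, key]
  mem_used := fun c' => by
    simp only [AbsState.forget, List.mem_filter, h.mem_used]
    constructor
    · rintro ⟨⟨v, hv⟩, hc⟩
      exact ⟨v, by simp_all⟩
    · rintro ⟨v, hv⟩
      have : color v = some c' ∧ c' ≠ c := by grind
      exact ⟨⟨v, this.1⟩, by simpa using this.2⟩
  used_nodup := h.used_nodup.filter _

/-- Since a colour marks one vertex, the filters select the unique path ending in `c₁` and the
unique path starting with `c₂`. The new edge glues them, and the third filter retains precisely the
other paths. -/
theorem of_mem_addSucc {c₁ c₂ : C} (h : Represents succ label color S ps) (hS : S' ∈ S.addSucc c₁ c₂) :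
    (∃ u v, color u = some c₁ ∧ color v = some c₂ ∧
      (∀ x, ¬ succ u x) ∧ (∀ x, ¬ succ x v) ∧ ¬ Relation.ReflTransGen succ v u) ∧
    ∃ qs, Represents (fun u v => succ u v ∨ (color u = some c₁ ∧ color v = some c₂)) label color S' qs := by
  simp only [AbsState.addSucc, List.mem_flatMap, List.mem_map, List.mem_filter, h.pieces_eq,
    decide_eq_true_eq] at hS
  obtain ⟨_, ⟨⟨p, hp, rfl⟩, hpl, hpf⟩, _, ⟨⟨q, hq, rfl⟩, hqf, hql⟩, rfl⟩ := hS
  simp only [Piece.ofPath, Option.bind_eq_some_iff] at hpl hqf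
  obtain ⟨u, hpu, hu⟩ := hpl
  obtain ⟨v, hqv, hv⟩ := hqf
  have hup := List.mem_of_getLast? hpu
  have hvq := List.mem_of_head? hqv
  -- Here the second half of the filter condition is needed: a path from the `c₂`-vertex to the
  -- `c₁`-vertex itself would be closed to a cycle, and it fails the test.
  have hne : p ≠ q := by
    rintro rfl
    exact hpf (by simp [Piece.ofPath, hqv, hv])
  refine ⟨⟨u, v, hu, hv, fun x hx => ?_, fun x hx => ?_, fun hr => ?_⟩, ?_⟩
  · exact List.Consec.not_of_getLast? (h.path_nodup hp) hpu ((h.succ_iff_consec hp hup).mp hx)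
  · exact List.Consec.not_of_head? (h.path_nodup hq) hqv ((h.succ_iff_consec' hq hvq).mp hx)
  -- Everything reachable from `v` stays on `q`, so `u` would lie on both paths.
  · refine hne (h.eq_of_mem hp hq hup ?_)
    clear hpu hu hup
    induction hr with
    | refl => exact hvq
    | tail _ hs ih => exact ((h.succ_iff_consec hq ih).mp hs).right_mem
  have hlast : ∀ r ∈ ps, (Piece.ofPath color label r).last = some c₁ ↔ r = p := by
    intro r hr
    simp only [Piece.ofPath, Option.bind_eq_some_iff]
    constructor
    · rintro ⟨x, hx, hxc⟩
      obtain rfl := h.inj x u c₁ hxc hu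
      exact h.eq_of_mem hr hp (List.mem_of_getLast? hx) hup
    · rintro rfl
      exact ⟨u, hpu, hu⟩
  have hfirst : ∀ r ∈ ps, (Piece.ofPath color label r).first = some c₂ ↔ r = q := by
    intro r hr
    simp only [Piece.ofPath, Option.bind_eq_some_iff]
    constructor
    · rintro ⟨x, hx, hxc⟩
      obtain rfl := h.inj x v c₂ hxc hv
      exact h.eq_of_mem hr hq (List.mem_of_head? hx) hvq
    · rintro rfl
      exact ⟨v, hqv, hv⟩
  set rest := ps.filter fun r => (Piece.ofPath color label r).last ≠ some c₁ ∧
    (Piece.ofPath color label r).first ≠ some c₂ with hrest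
  have hmem : ∀ r, r ∈ rest ↔ r ∈ ps ∧ r ≠ p ∧ r ≠ q := by
    intro r
    simp only [hrest, List.mem_filter, decide_eq_true_eq]
    constructor
    · rintro ⟨hr, h1, h2⟩
      exact ⟨hr, fun e => h1 ((hlast r hr).mpr e), fun e => h2 ((hfirst r hr).mpr e)⟩
    · rintro ⟨hr, h1, h2⟩
      exact ⟨hr, fun e => h1 ((hlast r hr).mp e), fun e => h2 ((hfirst r hr).mp e)⟩
  -- Moving the two selected paths to the front reduces all conditions on the new family to
  -- statements about `p ++ q`.
  have hperm : ps.Perm (p :: q :: rest) := by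
    refine (List.perm_ext_iff_of_nodup h.paths_nodup ?_).mpr fun r => ?_
    · have := h.paths_nodup.filter (p := fun r => (Piece.ofPath color label r).last ≠ some c₁ ∧
        (Piece.ofPath color label r).first ≠ some c₂)
      simp only [List.nodup_cons, List.mem_cons, hmem]
      exact ⟨fun h => h.elim hne fun h => h.2.1 rfl, fun h => h.2.2 rfl, this⟩
    · simp only [List.mem_cons, hmem]
      constructor
      · intro hr
        exact or_iff_not_imp_left.mpr fun h₁ => or_iff_not_imp_left.mpr fun h₂ => ⟨hr, h₁, h₂⟩
      · rintro (rfl | rfl | hr)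
        exacts [hp, hq, hr.1]
  have hflat : ps.flatten.Perm ((p ++ q) :: rest).flatten := by
    simpa using hperm.flatten
  have hpn : p ≠ [] := h.ne_nil p hp
  have hqn : q ≠ [] := h.ne_nil q hq
  refine ⟨(p ++ q) :: rest, ⟨⟨hflat.nodup_iff.mp h.nodup, fun x => hflat.mem_iff.mp (h.mem x), ?_,
    ?_, h.inj⟩, ?_, h.mem_used, h.used_nodup⟩⟩
  · intro r hr
    rcases List.mem_cons.mp hr with rfl | hr
    · simp [hpn]
    · exact h.ne_nil r ((hmem r).mp hr).1
  · intro x y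
    have hxy : (color x = some c₁ ∧ color y = some c₂) ↔
        p.getLast? = some x ∧ q.head? = some y := by
      constructor
      · rintro ⟨hx, hy⟩
        rw [h.inj x u c₁ hx hu, h.inj y v c₂ hy hv]
        exact ⟨hpu, hqv⟩
      · rintro ⟨hx, hy⟩
        rw [hpu, Option.some.injEq] at hx
        rw [hqv, Option.some.injEq] at hy
        exact ⟨hx ▸ hu, hy ▸ hv⟩
    rw [h.succ_iff, hxy]
    simp only [hperm.mem_iff, List.mem_cons, exists_eq_or_imp, List.Consec.append_iff]
    have (P Q E A : Prop) : (P ∨ Q ∨ E) ∨ A ↔ (P ∨ Q ∨ A) ∨ E := by tauto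
    exact this _ _ _ _
  · have hh : (p ++ q).head? = p.head? := by
      rw [List.head?_append_of_ne_nil _ hpn]
    have hl : (p ++ q).getLast? = q.getLast? := by
      rw [List.getLast?_append_of_ne_nil _ hqn]
    simp only [List.map_cons, List.filter_map, hrest]
    refine congrArg₂ _ ?_ ?_
    · simp only [Piece.ofPath, hh, hl, List.filterMap_append]
    · rfl

/-- A vertex without successor ends its path and one without predecessor starts its path, so both
ends are visible in the abstract state; unreachability makes the paths different, which lets them
pass the filters. -/
theorem exists_mem_addSucc {c₁ c₂ : C} (h : Represents succ label color S ps)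
    (ha : ∃ u v, color u = some c₁ ∧ color v = some c₂ ∧
      (∀ x, ¬ succ u x) ∧ (∀ x, ¬ succ x v) ∧ ¬ Relation.ReflTransGen succ v u) :
    ∃ S', S' ∈ S.addSucc c₁ c₂ := by
  obtain ⟨u, v, hu, hv, hus, hvs, hr⟩ := ha
  obtain ⟨p, hp, hup⟩ := h.exists_path u
  obtain ⟨q, hq, hvq⟩ := h.exists_path v
  have hpu : p.getLast? = some u :=
    List.Consec.getLast?_of_forall_not hup fun x hx => hus x ((h.succ_iff_consec hp hup).mpr hx)
  have hqv : q.head? = some v :=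
    List.Consec.head?_of_forall_not hvq fun x hx => hvs x ((h.succ_iff_consec' hq hvq).mpr hx)
  have hne : p ≠ q := by
    rintro rfl
    exact hr (Relation.ReflTransGen.mono (fun x y hc => (h.succ_iff x y).mpr ⟨p, hp, hc⟩) _ _
      (List.Consec.reachable hqv hup))
  refine ⟨_, List.mem_flatMap.mpr ⟨Piece.ofPath color label p, List.mem_filter.mpr ⟨?_, ?_⟩,
    List.mem_map.mpr ⟨Piece.ofPath color label q, List.mem_filter.mpr ⟨?_, ?_⟩, rfl⟩⟩⟩
  · exact h.pieces_eq ▸ List.mem_map_of_mem hp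
  · simp only [Piece.ofPath, hpu, Option.bind_some, hu, true_and, decide_eq_true_eq, ne_eq,
      Option.bind_eq_some_iff, not_exists, not_and]
    intro x hx hxc
    obtain rfl := h.inj x v c₂ hxc hv
    exact hne (h.eq_of_mem hp hq (List.mem_of_head? hx) hvq)
  · exact h.pieces_eq ▸ List.mem_map_of_mem hq
  · simp only [Piece.ofPath, hqv, Option.bind_some, hv, true_and, decide_eq_true_eq, ne_eq,
      Option.bind_eq_some_iff, not_exists, not_and]
    intro x hx hxc
    obtain rfl := h.inj x u c₁ hxc hu
    exact hne (h.eq_of_mem hp hq hup (List.mem_of_getLast? hx))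

end Represents

/-! ### Abstract evaluation of expressions -/

variable [DecidableEq C]

/-- `S` is a result of the abstract evaluation of `ψ`. -/
inductive LoExpr.AbsEval : LoExpr C T Γ → AbsState C T → Prop
  | bot : AbsEval .bot .empty
  | unary {op : UnaryOp C T Γ} {ψ : LoExpr C T Γ} {S S' : AbsState C T} :
      AbsEval ψ S → S' ∈ S.unary Option.toList op → AbsEval (.unary op ψ) S'
  | join {ψ₁ ψ₂ : LoExpr C T Γ} {S₁ S₂ S' : AbsState C T} :
      AbsEval ψ₁ S₁ → AbsEval ψ₂ S₂ → S' ∈ S₁.join S₂ → AbsEval (.join ψ₁ ψ₂) S'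

/-- `S` represents the graph `G`, with the maximal paths `ps`. -/
abbrev ColoredGraph.Represents (G : ColoredGraph C T Γ) (S : AbsState C T) (ps : List (List G.V)) : Prop :=
  _root_.Represents G.succ G.label G.color S ps

namespace ColoredGraph.Represents

variable {G H : ColoredGraph C T Γ} {S S' : AbsState C T} {ps : List (List G.V)}

theorem of_mem_unary {op : UnaryOp C T Γ} (h : G.Represents S ps)
    (hS : S' ∈ S.unary Option.toList op) : op.Applicable G ∧ ∃ qs, (op.apply G).Represents S' qs := by
  cases op with
  | node c a =>
    simp only [AbsState.unary] at hS
    split_ifs at hS with hc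
    · simp at hS
    · obtain rfl := List.mem_singleton.mp hS
      have hc' : ∀ v, G.color v ≠ some c := fun v hv => hc ((h.mem_used c).mpr ⟨v, hv⟩)
      refine ⟨hc', _, _root_.Represents.union h (.single c a) fun u v c' hu hv => ?_⟩
      obtain rfl : c = c' := Option.some.inj hv
      exact hc' u hu
  | addSucc c₁ c₂ => exact _root_.Represents.of_mem_addSucc h hS
  | addEdge γ c₁ c₂ =>
    obtain rfl := List.mem_singleton.mp hS
    exact ⟨trivial, ps, h⟩
  | forget c =>
    obtain rfl := List.mem_singleton.mp hS
    exact ⟨trivial, _, _root_.Represents.forget h c⟩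

theorem exists_mem_unary {op : UnaryOp C T Γ} (h : G.Represents S ps) (ha : op.Applicable G) :
    ∃ S', S' ∈ S.unary Option.toList op := by
  cases op with
  | node c a =>
    have hc : c ∉ S.used := fun hc => by
      obtain ⟨v, hv⟩ := (h.mem_used c).mp hc
      exact ha v hv
    exact ⟨_, by simp only [AbsState.unary, if_neg hc]; exact List.mem_singleton_self _⟩
  | addSucc c₁ c₂ => exact _root_.Represents.exists_mem_addSucc h ha
  | addEdge γ c₁ c₂ => exact ⟨_, List.mem_singleton_self _⟩
  | forget c => exact ⟨_, List.mem_singleton_self _⟩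

theorem mem_join_iff {S₁ S₂ : AbsState C T} {qs : List (List H.V)} (h₁ : G.Represents S₁ ps)
    (h₂ : H.Represents S₂ qs) : S' ∈ S₁.join S₂ ↔ S' = S₁.append S₂ ∧
      ∀ u v c, G.color u = some c → H.color v ≠ some c := by
  have : (S₁.used.filter (· ∈ S₂.used)).isEmpty ↔
      ∀ u v c, G.color u = some c → H.color v ≠ some c := by
    simp only [List.isEmpty_iff, List.filter_eq_nil_iff, decide_eq_true_eq, h₁.mem_used,
      h₂.mem_used]
    exact ⟨fun h u v c hu hv => h c ⟨u, hu⟩ ⟨v, hv⟩, fun h c ⟨u, hu⟩ ⟨v, hv⟩ => h u v c hu hv⟩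
  rw [AbsState.join, ← this]
  split_ifs with hc <;> simp [hc]

end ColoredGraph.Represents

namespace LoExpr

variable {ψ : LoExpr C T Γ} {S : AbsState C T}

/-- The abstract operations yield a result only if the concrete ones are applicable, and the result
again describes the graph. -/
theorem AbsEval.wellFormed (h : ψ.AbsEval S) : ψ.WellFormed ∧ ∃ ps, ψ.graph.Represents S ps := by
  induction h with
  | bot => exact ⟨trivial, _, Represents.empty _ _ _⟩
  | unary _ hS ih =>
    obtain ⟨hw, ps, hr⟩ := ih
    obtain ⟨ha, hr'⟩ := ColoredGraph.Represents.of_mem_unary hr hS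
    exact ⟨⟨hw, ha⟩, hr'⟩
  | join _ _ hS ih₁ ih₂ =>
    obtain ⟨hw₁, ps₁, hr₁⟩ := ih₁
    obtain ⟨hw₂, ps₂, hr₂⟩ := ih₂
    obtain ⟨rfl, hd⟩ := (ColoredGraph.Represents.mem_join_iff hr₁ hr₂).mp hS
    exact ⟨⟨hw₁, hw₂, hd⟩, _, Represents.union hr₁ hr₂ hd⟩

/-- The converse direction: applicability in the represented graph is detected by the abstract
state, so evaluation never gets stuck. -/
theorem WellFormed.exists_absEval (h : ψ.WellFormed) : ∃ S, ψ.AbsEval S := by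
  induction ψ with
  | bot => exact ⟨_, .bot⟩
  | unary op ψ ih =>
    obtain ⟨S, hS⟩ := ih h.1
    obtain ⟨_, ps, hr⟩ := hS.wellFormed
    obtain ⟨S', hS'⟩ := ColoredGraph.Represents.exists_mem_unary hr h.2
    exact ⟨S', .unary hS hS'⟩
  | join ψ₁ ψ₂ ih₁ ih₂ =>
    obtain ⟨S₁, hS₁⟩ := ih₁ h.1
    obtain ⟨S₂, hS₂⟩ := ih₂ h.2.1
    obtain ⟨_, ps₁, hr₁⟩ := hS₁.wellFormed
    obtain ⟨_, ps₂, hr₂⟩ := hS₂.wellFormed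
    exact ⟨_, .join hS₁ hS₂ ((ColoredGraph.Represents.mem_join_iff hr₁ hr₂).mpr ⟨rfl, h.2.2⟩)⟩

end LoExpr

end

section

variable {C T Γ Z : Type}

/-! ### Abstract states of lo-graphs -/

theorem List.consec_iff_getElem? {V : Type*} {p : List V} {u v : V} :
    p.Consec u v ↔ ∃ i : ℕ, p[i]? = some u ∧ p[i + 1]? = some v := by
  induction p with
  | nil => simp
  | cons a p ih =>
    rw [List.Consec.cons_iff, ih]
    constructor
    · rintro (⟨rfl, h⟩ | ⟨i, h⟩)
      · exact ⟨0, by simp, by simpa [List.head?_eq_getElem?] using h⟩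
      · exact ⟨i + 1, by simpa using h⟩
    · rintro ⟨_ | i, h⟩
      · exact .inl (by simpa [List.head?_eq_getElem?] using h)
      · exact .inr ⟨i, by simpa using h⟩

/-- The members of a duplicate-free list that exhausts a type are linearly ordered by it. -/
theorem List.Nodup.exists_linearOrder {V : Type*} {p : List V} (hp : p.Nodup) (hmem : ∀ v, v ∈ p) :
    ∃ _ : LinearOrder V, ∀ u v : V, p.Consec u v ↔ u ⋖ v := by
  obtain ⟨f, hget, hf⟩ : ∃ f : V → ℕ, (∀ v, p[f v]? = some v) ∧
      ∀ (i : ℕ) (v : V), p[i]? = some v → f v = i := by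
    classical
    refine ⟨fun v => p.idxOf v, fun v => List.getElem?_idxOf (hmem v), fun i v h => ?_⟩
    obtain ⟨hi, rfl⟩ := List.getElem?_eq_some_iff.mp h
    exact hp.idxOf_getElem i hi
  have hinj : Function.Injective f := fun u v h => by
    rw [← Option.some.injEq, ← hget u, ← hget v, h]
  refine ⟨LinearOrder.lift' f hinj, fun u v => ?_⟩
  let _ : LinearOrder V := LinearOrder.lift' f hinj
  have hlt (x y : V) : x < y ↔ f x < f y := Iff.rfl
  rw [List.consec_iff_getElem?]
  constructor
  · rintro ⟨i, hu, hv⟩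
    have hu := hf _ _ hu
    have hv := hf _ _ hv
    refine ⟨?_, fun w h₁ h₂ => ?_⟩
    · rw [hlt]
      omega
    · rw [hlt] at h₁ h₂
      omega
  · rintro ⟨h, hmin⟩
    refine ⟨f u, hget u, ?_⟩
    rw [hlt] at h
    have hv : f v < p.length := (List.getElem?_eq_some_iff.mp (hget v)).1
    have hw := List.getElem?_eq_getElem (l := p) (i := f u + 1) (by omega)
    have hi := hf _ _ hw
    rw [hw]
    by_contra hne
    -- If `v` were not the next entry after `u`, that entry would lie strictly between them.
    refine hmin (c := p[f u + 1]) ?_ ?_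
    · rw [hlt]
      omega
    · rw [hlt, hi]
      refine lt_of_le_of_ne h fun e => hne ?_
      rw [← hget v, ← e, hw]

namespace ColoredGraph.Represents

variable {G : ColoredGraph C T Γ} {S : AbsState C T} {ps : List (List G.V)}

/-- In a finite linear order a vertex that is not the greatest is covered by another one. So the
last vertex of every maximal path is the greatest vertex, and all paths coincide. -/
theorem length_le_one (h : G.Represents S ps) (hG : G.IsLoGraph) : S.pieces.length ≤ 1 := by
  obtain ⟨_, hcov⟩ := hG
  have := G.finite
  have hmax : ∀ p ∈ ps, ∀ u, p.getLast? = some u → ∀ x, x ≤ u := by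
    intro p hp u hu x
    by_contra hx
    obtain ⟨y, hy, -⟩ := exists_covBy_le_of_lt (not_le.mp hx)
    exact List.Consec.not_of_getLast? (h.path_nodup hp) hu
      ((h.succ_iff_consec hp (List.mem_of_getLast? hu)).mp ((hcov u y).mpr hy))
  have heq : ∀ p ∈ ps, ∀ q ∈ ps, p = q := by
    intro p hp q hq
    obtain ⟨u, hu⟩ : ∃ u, p.getLast? = some u :=
      ⟨_, List.getLast?_eq_some_getLast (h.ne_nil p hp)⟩
    obtain ⟨v, hv⟩ : ∃ v, q.getLast? = some v :=
      ⟨_, List.getLast?_eq_some_getLast (h.ne_nil q hq)⟩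
    obtain rfl := le_antisymm (hmax q hq v hv u) (hmax p hp u hu v)
    exact h.eq_of_mem hp hq (List.mem_of_getLast? hu) (List.mem_of_getLast? hv)
  rw [h.pieces_eq, List.length_map]
  match ps, h.paths_nodup, heq with
  | [], _, _ => simp
  | [p], _, _ => simp
  | p :: q :: ps, hn, heq =>
    obtain rfl := heq p (by simp) q (by simp)
    simp at hn

theorem consec_iff (h : G.Represents S ps) (hS : S.pieces.length ≤ 1) (u v : G.V) :
    ps.flatten.Consec u v ↔ G.succ u v := by
  rw [h.succ_iff]
  rw [h.pieces_eq, List.length_map] at hS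
  match ps, hS with
  | [], _ => simp
  | [p], _ => simp

theorem isLoGraph (h : G.Represents S ps) (hS : S.pieces.length ≤ 1) : G.IsLoGraph := by
  obtain ⟨i, hi⟩ := h.nodup.exists_linearOrder h.mem
  exact ⟨i, fun u v => (consec_iff h hS u v).symm.trans (hi u v)⟩

theorem hasWord_iff (h : G.Represents S ps) (hS : S.pieces.length ≤ 1) (w : List T) :
    G.HasWord w ↔ w = S.pieces.flatMap Piece.word := by
  have hflat : S.pieces.flatMap Piece.word = ps.flatten.filterMap G.label := by
    rw [h.pieces_eq, List.flatMap_map, List.filterMap_flatten, List.flatMap_def]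
    rfl
  have hchain : ps.flatten.IsChain G.succ := by
    rw [List.isChain_iff_getElem]
    intro i hi
    exact (consec_iff h hS _ _).mp (List.consec_iff_getElem?.mpr ⟨i, by simp, by simp⟩)
  rw [hflat]
  constructor
  · rintro ⟨vs, hn, hm, hc, rfl⟩
    obtain ⟨_, hcov⟩ := isLoGraph h hS
    have hlt : ∀ l : List G.V, l.IsChain G.succ → l.Pairwise (· < ·) := fun l hl =>
      List.isChain_iff_pairwise.mp (hl.imp fun u v huv => ((hcov u v).mp huv).lt)
    congr 1
    -- Both lists enumerate all vertices in increasing order, so they are equal; the word of an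
    -- lo-graph is unique.
    refine List.Perm.eq_of_pairwise (le := (· < ·)) (fun a b _ _ h₁ h₂ => absurd h₂ h₁.asymm)
      (hlt _ hc) (hlt _ hchain) ?_
    exact (List.perm_ext_iff_of_nodup hn h.nodup).mpr fun v => ⟨fun _ => h.mem v, fun _ => hm v⟩
  · rintro rfl
    exact ⟨_, h.nodup, h.mem, hchain, rfl⟩

end ColoredGraph.Represents

/-- Removes graphs from the problem: what remains is a statement on expressions and abstract states.
Zero pieces are allowed, for the empty graph and the empty word. -/
theorem TreeAutomaton.mem_wordLanguage_iff {Q : Type} [DecidableEq C]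
    (A : TreeAutomaton C T Γ Q) (w : List T) :
    w ∈ A.wordLanguage ↔ ∃ ψ S, LoExpr.AbsEval ψ S ∧ (∃ q ∈ A.accept, A.run ψ = some q) ∧
      S.pieces.length ≤ 1 ∧ w = S.pieces.flatMap Piece.word := by
  constructor
  · rintro ⟨_, ⟨hlo, ψ, ⟨hwf, hq⟩, rfl⟩, hw⟩
    obtain ⟨S, hS⟩ := hwf.exists_absEval
    obtain ⟨_, ps, hr⟩ := hS.wellFormed
    have hlen := ColoredGraph.Represents.length_le_one hr hlo
    exact ⟨ψ, S, hS, hq, hlen, (ColoredGraph.Represents.hasWord_iff hr hlen w).mp hw⟩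
  · rintro ⟨ψ, S, hS, hq, hlen, hw⟩
    obtain ⟨hwf, ps, hr⟩ := hS.wellFormed
    exact ⟨_, ⟨ColoredGraph.Represents.isLoGraph hr hlen, ψ, ⟨hwf, hq⟩, rfl⟩,
      (ColoredGraph.Represents.hasWord_iff hr hlen w).mpr hw⟩

/-! ### Dead states -/

/-- A piece without coloured end cannot be joined to the other pieces any more. -/
def AbsState.Dead (S : AbsState C Z) : Prop :=
  2 ≤ S.pieces.length ∧ ∃ r ∈ S.pieces, r.first = none ∧ r.last = none

namespace AbsState.Dead

variable {S S₁ S₂ S' : AbsState C Z}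

theorem append_left (h : S₁.Dead) : (S₁.append S₂).Dead := by
  obtain ⟨hl, r, hr, h⟩ := h
  exact ⟨by simp only [append, List.length_append]; omega, r, List.mem_append_left _ hr, h⟩

theorem append_right (h : S₂.Dead) : (S₁.append S₂).Dead := by
  obtain ⟨hl, r, hr, h⟩ := h
  exact ⟨by simp only [append, List.length_append]; omega, r, List.mem_append_right _ hr, h⟩

variable [DecidableEq C]

/-- The uncoloured piece is never selected by a successor edge, so it survives next to the piece
created by that edge, and the number of pieces stays at least two. -/
theorem unary {ℓ : Option T → List Z} {op : UnaryOp C T Γ} (h : S.Dead) (hS : S' ∈ S.unary ℓ op) :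
    S'.Dead := by
  cases op with
  | node c a =>
    simp only [AbsState.unary] at hS
    split_ifs at hS with hc
    · simp at hS
    · obtain rfl := List.mem_singleton.mp hS
      exact h.append_left
  | addSucc c₁ c₂ =>
    simp only [AbsState.unary, addSucc, List.mem_flatMap, List.mem_map] at hS
    obtain ⟨r₁, -, r₂, -, rfl⟩ := hS
    obtain ⟨-, r, hr, hf, hl⟩ := h
    have hr' : r ∈ S.pieces.filter fun r => r.last ≠ some c₁ ∧ r.first ≠ some c₂ :=
      List.mem_filter.mpr ⟨hr, by simp [hf, hl]⟩
    refine ⟨?_, r, List.mem_cons_of_mem _ hr', hf, hl⟩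
    have := List.length_pos_of_mem hr'
    rw [List.length_cons]
    omega
  | addEdge γ c₁ c₂ =>
    obtain rfl := List.mem_singleton.mp hS
    exact h
  | forget c =>
    obtain rfl := List.mem_singleton.mp hS
    obtain ⟨hl, r, hr, hr₁, hr₂⟩ := h
    refine ⟨by simpa [forget] using hl, _, List.mem_map_of_mem hr, ?_⟩
    simp [forgetColor, hr₁, hr₂]

theorem join_left (h : S₁.Dead) (hS : S' ∈ S₁.join S₂) : S'.Dead := by
  simp only [AbsState.join] at hS
  split_ifs at hS
  · exact List.mem_singleton.mp hS ▸ h.append_left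
  · simp at hS

theorem join_right (h : S₂.Dead) (hS : S' ∈ S₁.join S₂) : S'.Dead := by
  simp only [AbsState.join] at hS
  split_ifs at hS
  · exact List.mem_singleton.mp hS ▸ h.append_right
  · simp at hS

end AbsState.Dead

/-- In a state that is not dead, there are at most as many pieces as colours. -/
theorem ColoredGraph.Represents.length_le [Fintype C] [Nonempty C] {G : ColoredGraph C T Γ}
    {S : AbsState C T} {ps : List (List G.V)} (h : G.Represents S ps) (hS : ¬ S.Dead) :
    S.pieces.length ≤ Fintype.card C := by
  classical
  -- A single piece may be uncoloured without making the state dead; in this case the bound rests on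
  -- the existence of a colour.
  by_cases hlen : S.pieces.length ≤ 1
  · exact hlen.trans Fintype.card_pos
  have hcol : ∀ p ∈ ps, ∃ c, ∃ v ∈ p, G.color v = some c := by
    intro p hp
    have hp' : Piece.ofPath G.color G.label p ∈ S.pieces := by
      rw [h.pieces_eq]
      exact List.mem_map_of_mem hp
    by_contra! hno
    refine hS ⟨by omega, _, hp', ?_, ?_⟩
    · refine Option.eq_none_iff_forall_ne_some.mpr fun c hc => ?_
      obtain ⟨v, hv, hc⟩ := Option.bind_eq_some_iff.mp hc
      exact hno c v (List.mem_of_head? hv) hc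
    · refine Option.eq_none_iff_forall_ne_some.mpr fun c hc => ?_
      obtain ⟨v, hv, hc⟩ := Option.bind_eq_some_iff.mp hc
      exact hno c v (List.mem_of_getLast? hv) hc
  -- One colour is picked from each path. Paths are disjoint and a colour marks one vertex, so the
  -- choice is injective.
  choose! f hf using hcol
  have : (ps.map f).Nodup := h.paths_nodup.map_on fun p hp q hq hpq => by
    obtain ⟨u, hu, huc⟩ := hf p hp
    obtain ⟨v, hv, hvc⟩ := hf q hq
    obtain rfl := h.inj u v (f p) huc (hpq ▸ hvc)
    exact h.eq_of_mem hp hq hu hv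
  simpa [h.pieces_eq] using this.length_le_card

end

/-! ### The grammar: symbolic evaluation, shapes, rules and language. -/

section

variable {C T Γ Z : Type}

/-! ### Symbolic evaluation of abstract states -/

namespace AbsState

variable {Z' : Type}

/-- The state without its words. -/
def shape (S : AbsState C Z) : List (Option C × Option C) × List C :=
  (S.pieces.map fun r => (r.first, r.last), S.used)

def words (S : AbsState C Z) : List (List Z) := S.pieces.map Piece.word

def mapWord (φ : List Z → List Z') (S : AbsState C Z) : AbsState C Z' :=
  ⟨S.pieces.map fun r => ⟨r.first, r.last, φ r.word⟩, S.used⟩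

@[simp] theorem shape_mapWord (φ : List Z → List Z') (S : AbsState C Z) :
    (S.mapWord φ).shape = S.shape := by
  simp [shape, mapWord]

@[simp] theorem words_mapWord (φ : List Z → List Z') (S : AbsState C Z) :
    (S.mapWord φ).words = S.words.map φ := by
  simp [words, mapWord]

variable [DecidableEq C]

theorem join_mapWord (φ : List Z → List Z') (S₁ S₂ : AbsState C Z) :
    (S₁.mapWord φ).join (S₂.mapWord φ) = (S₁.join S₂).map (mapWord φ) := by
  by_cases h : (S₁.used.filter (· ∈ S₂.used)).isEmpty
  · rw [join, join, if_pos h, if_pos (by exact h)]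
    simp [append, mapWord]
  · rw [join, join, if_neg h, if_neg (by exact h)]
    rfl

/-- All decisions depend on colours only, and words are merely moved, created from labels or
concatenated. Hence symbolic evaluation followed by substitution is evaluation. -/
theorem unary_mapWord {φ : List Z → List Z'} (hφ : ∀ u v, φ (u ++ v) = φ u ++ φ v)
    {ℓ : Option T → List Z} {ℓ' : Option T → List Z'} (hℓ : ∀ a, φ (ℓ a) = ℓ' a)
    (op : UnaryOp C T Γ) (S : AbsState C Z) :
    (S.mapWord φ).unary ℓ' op = (S.unary ℓ op).map (mapWord φ) := by
  cases op with
  | node c a =>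
    by_cases h : c ∈ S.used
    · rw [unary, unary, if_pos h, if_pos (by exact h)]
      rfl
    · rw [unary, unary, if_neg h, if_neg (by exact h)]
      simp [append, single, mapWord, hℓ]
  | addSucc c₁ c₂ =>
    simp only [unary, addSucc, mapWord, List.filter_map, List.flatMap_map, List.map_flatMap,
      List.map_map]
    simp only [Function.comp_def, mapWord, List.map_cons, hφ]
  | addEdge γ c₁ c₂ => rfl
  | forget c => simp [unary, forget, mapWord]

/-- The occurrences of variables in the words of a state. -/
def vars {X : Type} (S : AbsState C (T ⊕ X)) : List X :=
  S.words.flatten.filterMap Sum.getRight?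

omit [DecidableEq C] in
theorem vars_append {X : Type} (S₁ S₂ : AbsState C (T ⊕ X)) :
    (S₁.append S₂).vars = S₁.vars ++ S₂.vars := by
  simp [vars, words, append]

/-- Yields that no variable is used twice in a rule. It has to hold for arbitrary states, because
rules are made for all shapes and not only for those that occur in graphs. -/
theorem vars_subperm_of_mem_unary {X : Type} {S S' : AbsState C (T ⊕ X)} {op : UnaryOp C T Γ}
    (h : S' ∈ S.unary (fun a => a.toList.map Sum.inl) op) : S'.vars.Subperm S.vars := by
  cases op with
  | node c a =>
    simp only [unary] at h
    split_ifs at h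
    · simp at h
    · obtain rfl := List.mem_singleton.mp h
      rw [vars_append]
      have : (single c (a.toList.map Sum.inl) : AbsState C (T ⊕ X)).vars = [] := by
        cases a
        · rfl
        · rfl
      rw [this, List.append_nil]
  | addSucc c₁ c₂ =>
    simp only [unary, addSucc, List.mem_flatMap, List.mem_map] at h
    obtain ⟨r₁, h₁, r₂, h₂, rfl⟩ := h
    -- The three filters of `addSucc` are mutually exclusive, so the two selected pieces and the
    -- rest occupy different positions of the list.
    have key : List.Subperm (r₁ :: r₂ ::
        S.pieces.filter fun r => r.last ≠ some c₁ ∧ r.first ≠ some c₂) S.pieces := by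
      refine List.Subperm.trans ?_
        (List.filter_append_perm (fun r => r.last = some c₁ ∧ r.first ≠ some c₂) S.pieces).subperm
      refine List.Subperm.append (l₁ := [r₁]) (List.singleton_subperm_iff.mpr h₁) ?_
      set L := S.pieces.filter fun r => !decide (r.last = some c₁ ∧ r.first ≠ some c₂) with hL
      refine List.Subperm.trans ?_
        (List.filter_append_perm (fun r => r.first = some c₂ ∧ r.last ≠ some c₁) L).subperm
      refine List.Subperm.append (l₁ := [r₂]) (List.singleton_subperm_iff.mpr ?_) ?_
      · simp only [hL, List.mem_filter, decide_eq_true_eq, Bool.not_eq_true'] at h₂ ⊢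
        exact ⟨⟨h₂.1, by simp [h₂.2]⟩, h₂.2⟩
      · rw [hL, List.filter_filter]
        refine (List.monotone_filter_right _ fun r hr => ?_).subperm
        simp only [decide_eq_true_eq] at hr
        simp [hr]
    obtain ⟨l, hl, hsub⟩ := key
    have h₁ := (((hl.map Piece.word).flatten).filterMap (Sum.getRight? (α := T))).symm
    have h₂ := ((hsub.map Piece.word).flatten).filterMap (Sum.getRight? (α := T))
    simpa [vars, words] using h₁.subperm.trans h₂.subperm
  | addEdge γ c₁ c₂ =>
    obtain rfl := List.mem_singleton.mp h
    exact List.Subperm.refl _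
  | forget c =>
    obtain rfl := List.mem_singleton.mp h
    have : (S.forget c).vars = S.vars := by simp [vars, words, forget, Function.comp_def]
    rw [this]

/-- Symbolic words are single variables and one operation concatenates at most two of them; this
keeps the size of a rule linear in `k`. -/
theorem length_le_two_of_mem_unary {ℓ : Option T → List Z} (hℓ : ∀ a, (ℓ a).length ≤ 1)
    {S S' : AbsState C Z} {op : UnaryOp C T Γ} (hS : ∀ w ∈ S.words, w.length ≤ 1)
    (h : S' ∈ S.unary ℓ op) : ∀ w ∈ S'.words, w.length ≤ 2 := by
  have hS₂ : ∀ w ∈ S.words, w.length ≤ 2 := fun w hw => (hS w hw).trans one_le_two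
  cases op with
  | node c a =>
    simp only [unary] at h
    split_ifs at h
    · simp at h
    · obtain rfl := List.mem_singleton.mp h
      intro w hw
      simp only [words, append, single, List.map_append, List.mem_append] at hw
      rcases hw with hw | hw
      · exact hS₂ w hw
      · obtain rfl : w = ℓ a := by simpa using hw
        exact (hℓ a).trans one_le_two
  | addSucc c₁ c₂ =>
    simp only [unary, addSucc, List.mem_flatMap, List.mem_map] at h
    obtain ⟨r₁, h₁, r₂, h₂, rfl⟩ := h
    simp only [words, List.map_cons, List.mem_cons, forall_eq_or_imp, List.length_append]
    have h₁ := hS _ (List.mem_map_of_mem (List.mem_of_mem_filter h₁))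
    have h₂ := hS _ (List.mem_map_of_mem (List.mem_of_mem_filter h₂))
    refine ⟨by omega, fun w hw => hS₂ w ?_⟩
    obtain ⟨r, hr, rfl⟩ := List.mem_map.mp hw
    exact List.mem_map_of_mem (List.mem_of_mem_filter hr)
  | addEdge γ c₁ c₂ =>
    obtain rfl := List.mem_singleton.mp h
    exact hS₂
  | forget c =>
    obtain rfl := List.mem_singleton.mp h
    intro w hw
    exact hS₂ w (by simpa [words, forget] using hw)

end AbsState

/-! ### Lists of bounded length -/

/-- The lists of length at most `n` with members in `s`. -/
def boundedLists {α : Type*} (s : List α) : ℕ → List (List α)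
  | 0 => [[]]
  | n + 1 => [] :: s.flatMap fun a => (boundedLists s n).map (a :: ·)

theorem mem_boundedLists {α : Type*} {s : List α} {n : ℕ} {l : List α} :
    l ∈ boundedLists s n ↔ l.length ≤ n ∧ l ⊆ s := by
  induction n generalizing l with
  | zero => cases l <;> simp [boundedLists]
  | succ n ih =>
    cases l with
    | nil => simp [boundedLists]
    | cons a l => simp [boundedLists, ih]; tauto

theorem nodup_boundedLists {α : Type*} {s : List α} (hs : s.Nodup) (n : ℕ) :
    (boundedLists s n).Nodup := by
  induction n with
  | zero => simp [boundedLists]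
  | succ n ih =>
    refine List.nodup_cons.mpr ⟨by simp, List.nodup_flatMap.mpr
      ⟨fun a _ => ih.map fun _ _ h => (List.cons.inj h).2, hs.imp fun {a b} hab l h₁ h₂ => ?_⟩⟩
    obtain ⟨l₁, -, rfl⟩ := List.mem_map.mp h₁
    obtain ⟨l₂, -, h⟩ := List.mem_map.mp h₂
    exact hab (List.cons.inj h).1.symm

theorem length_boundedLists_le {α : Type*} (s : List α) (n : ℕ) :
    (boundedLists s n).length ≤ (s.length + 1) ^ n := by
  induction n with
  | zero => simp [boundedLists]
  | succ n ih =>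
    have h := Nat.one_le_pow n (s.length + 1) (by omega)
    simp only [boundedLists, List.length_cons, List.length_flatMap, List.length_map,
      List.map_const', List.sum_replicate, smul_eq_mul, pow_succ]
    nlinarith

/-! ### The grammar -/

namespace LoGrammar

/-- Shapes of states with at most `k` pieces and at most `k` colours in use. -/
abbrev Shape (k : ℕ) : Type :=
  {σ : List (Option (Fin k) × Option (Fin k)) × List (Fin k) // σ.1.length ≤ k ∧ σ.2.length ≤ k}

/-- The start symbol `none`, and pairs of states of the automaton and shapes. -/
abbrev Nonterminal (k : ℕ) (Q : Type) : Type := Option (Q × Shape k)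

/-- Two disjoint sets of `k` variables. -/
abbrev Var (k : ℕ) : Type := Bool × Fin k

/-- Descending order, as the list arises in a recursion that puts each new numeral in front. -/
def colors (k : ℕ) : List (Fin k) := (List.finRange k).reverse

def options (k : ℕ) : List (Option (Fin k)) := none :: (colors k).map some

def optionPairs (k : ℕ) : List (Option (Fin k) × Option (Fin k)) :=
  (options k).flatMap fun a => (options k).map fun b => (a, b)

def shapeList (k : ℕ) : List (List (Option (Fin k) × Option (Fin k)) × List (Fin k)) :=
  (boundedLists (optionPairs k) k).flatMap fun l => (boundedLists (colors k) k).map fun u => (l, u)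

theorem mem_colors {k : ℕ} (c : Fin k) : c ∈ colors k := by simp [colors]

theorem mem_options {k : ℕ} (o : Option (Fin k)) : o ∈ options k := by
  cases o <;> simp [options, mem_colors]

theorem mem_optionPairs {k : ℕ} (p : Option (Fin k) × Option (Fin k)) : p ∈ optionPairs k := by
  simp only [optionPairs, List.mem_flatMap, List.mem_map]
  exact ⟨p.1, mem_options _, p.2, mem_options _, rfl⟩

theorem nodup_colors (k : ℕ) : (colors k).Nodup := by simp [colors, List.nodup_finRange]

theorem nodup_options (k : ℕ) : (options k).Nodup := by
  simp [options, (nodup_colors k).map (Option.some_injective _)]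

theorem nodup_flatMap_map_prod {α β : Type*} {s : List α} {t : List β} (hs : s.Nodup)
    (ht : t.Nodup) : (s.flatMap fun a => t.map fun b => (a, b)).Nodup := by
  refine List.nodup_flatMap.mpr
    ⟨fun a _ => ht.map fun _ _ h => (Prod.ext_iff.mp h).2, hs.imp fun {a b} hab l h₁ h₂ => ?_⟩
  obtain ⟨_, -, rfl⟩ := List.mem_map.mp h₁
  obtain ⟨_, -, h⟩ := List.mem_map.mp h₂
  exact hab (Prod.ext_iff.mp h).1.symm

theorem nodup_shapeList (k : ℕ) : (shapeList k).Nodup :=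
  nodup_flatMap_map_prod
    (nodup_boundedLists (nodup_flatMap_map_prod (nodup_options k) (nodup_options k)) k)
    (nodup_boundedLists (nodup_colors k) k)

theorem mem_shapeList {k : ℕ} {σ : List (Option (Fin k) × Option (Fin k)) × List (Fin k)} :
    σ ∈ shapeList k ↔ σ.1.length ≤ k ∧ σ.2.length ≤ k := by
  simp only [shapeList, List.mem_flatMap, List.mem_map, mem_boundedLists]
  constructor
  · rintro ⟨l, hl, u, hu, rfl⟩
    exact ⟨hl.1, hu.1⟩
  · exact fun ⟨h₁, h₂⟩ => ⟨σ.1, ⟨h₁, fun p _ => mem_optionPairs p⟩, σ.2,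
      ⟨h₂, fun c _ => mem_colors c⟩, rfl⟩

def shapes (k : ℕ) : List (Shape k) := (shapeList k).attachWith _ fun _ => mem_shapeList.mp

theorem shapes_map_val (k : ℕ) : (shapes k).map Subtype.val = shapeList k :=
  List.attachWith_map_subtype_val _

theorem mem_shapes {k : ℕ} (σ : Shape k) : σ ∈ shapes k :=
  (List.mem_attachWith _ _).mpr (mem_shapeList.mpr σ.2)

theorem nodup_shapes (k : ℕ) : (shapes k).Nodup := by
  refine List.Nodup.of_map Subtype.val ?_
  rw [shapes_map_val]
  exact nodup_shapeList k

instance (k : ℕ) : Finite (Shape k) :=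
  .of_surjective (fun i : Fin (shapes k).length => (shapes k)[i]) fun σ =>
    let ⟨i, hi, h⟩ := List.getElem_of_mem (mem_shapes σ)
    ⟨⟨i, hi⟩, h⟩

section

variable {k : ℕ} [NeZero k] {Q : Type}

/-- The variables number `n - 1, …, 1, 0`. -/
def varList (k : ℕ) [NeZero k] (b : Bool) (n : ℕ) : List (Var k) :=
  (List.range n).reverse.map fun j => (b, Fin.ofNat k j)

/-- Pieces with the given colours whose words are single variables. -/
def symPieces (b : Bool) (l : List (Option (Fin k) × Option (Fin k))) :
    List (Piece (Fin k) (T ⊕ Var k)) :=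
  l.foldr (fun y r => ⟨y.1, y.2, [.inr (b, Fin.ofNat k r.length)]⟩ :: r) []

/-- A piece carries the variable whose number counts the pieces behind it, so the words form a
suffix of the full descending list of `k` variables. -/
def symState (b : Bool) (σ : Shape k) : AbsState (Fin k) (T ⊕ Var k) :=
  ⟨symPieces b σ.1.1, σ.1.2⟩

/-- The words of a state as a `k`-tuple. -/
def tuple (k : ℕ) (S : AbsState C Z) : List (List Z) := List.leftpad k [] S.words

theorem varList_succ (b : Bool) (n : ℕ) :
    varList k b (n + 1) = (b, Fin.ofNat k n) :: varList k b n := by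
  simp [varList, List.range_succ]

@[simp] theorem length_varList (b : Bool) (n : ℕ) : (varList k b n).length = n := by
  simp [varList]

theorem varList_suffix (b : Bool) {m n : ℕ} (h : m ≤ n) : varList k b m <:+ varList k b n := by
  induction n, h using Nat.le_induction with
  | base => exact List.suffix_rfl
  | succ n _ ih =>
    rw [varList_succ]
    exact ih.trans (List.suffix_cons _ _)

theorem mem_varList {b : Bool} {n : ℕ} {x : Var k} : x ∈ varList k b n → x.1 = b := by
  simp only [varList, List.mem_map]
  rintro ⟨j, -, rfl⟩
  rfl

theorem nodup_varList (b : Bool) {n : ℕ} (h : n ≤ k) : (varList k b n).Nodup := by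
  refine List.Nodup.map_on (fun i hi j hj hij => ?_) (List.nodup_reverse.mpr List.nodup_range)
  have := congrArg (fun x : Var k => x.2.val) hij
  simp only [List.mem_reverse, List.mem_range] at hi hj
  simpa [Nat.mod_eq_of_lt (hi.trans_le h), Nat.mod_eq_of_lt (hj.trans_le h)] using this

@[simp] theorem length_symPieces (b : Bool) (l : List (Option (Fin k) × Option (Fin k))) :
    (symPieces (T := T) b l).length = l.length := by
  induction l with
  | nil => rfl
  | cons y l ih => simpa [symPieces] using ih

theorem symPieces_cons (b : Bool) (y : Option (Fin k) × Option (Fin k))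
    (l : List (Option (Fin k) × Option (Fin k))) :
    symPieces (T := T) b (y :: l) =
      ⟨y.1, y.2, [.inr (b, Fin.ofNat k l.length)]⟩ :: symPieces b l := by
  rw [← length_symPieces (T := T) b l]
  rfl

theorem vars_symState (b : Bool) (σ : Shape k) :
    (symState (T := T) b σ).vars = varList k b σ.1.1.length := by
  simp only [AbsState.vars, AbsState.words, symState]
  induction σ.1.1 with
  | nil => rfl
  | cons y l ih => simpa [symPieces_cons, varList_succ] using ih

theorem length_le_one_symState (b : Bool) (σ : Shape k) :
    ∀ w ∈ (symState (T := T) b σ).words, w.length ≤ 1 := by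
  simp only [AbsState.words, symState]
  induction σ.1.1 with
  | nil => simp [symPieces]
  | cons y l ih => simpa [symPieces_cons] using ih

theorem exists_map_varList (b : Bool) {W : List (List T)} (hW : W.length = k) :
    ∃ g : Fin k → List T, (varList k b k).map (fun x => g x.2) = W := by
  refine ⟨fun j => W.reverse[j]'(by simp [hW]), ?_⟩
  rw [varList, List.map_map, ← List.reverse_inj, ← List.map_reverse, List.reverse_reverse]
  refine List.ext_getElem (by simp [hW]) fun i h₁ h₂ => ?_
  have : i < k := by simpa using h₁
  simp [Nat.mod_eq_of_lt this]

/-- Substituting the words of a state into the symbolic state of its shape yields the state. -/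
theorem mapWord_symState {b : Bool} {σ : Shape k} {S : AbsState (Fin k) T} (hσ : S.shape = σ.1)
    {η : Var k → List T} (hη : (varList k b k).map η = tuple k S) :
    (symState b σ).mapWord (MCFG.subst η) = S := by
  obtain ⟨⟨l, u⟩, hl, hu⟩ := σ
  obtain ⟨L, U⟩ := S
  obtain ⟨rfl, rfl⟩ : L.map (fun r => (r.first, r.last)) = l ∧ U = u := by
    simpa [AbsState.shape] using hσ
  -- Padding is on the left and variables are numbered from the right, so dropping the padding
  -- leaves exactly the variables of the actual pieces.
  have hη' : (varList k b L.length).map η = L.map Piece.word := by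
    obtain ⟨pre, hpre⟩ := varList_suffix (k := k) b (by simpa using hl)
    rw [tuple, List.leftpad, ← hpre, List.map_append] at hη
    exact (List.append_inj' hη (by simp [AbsState.words])).2
  simp only [symState, AbsState.mapWord, AbsState.mk.injEq, and_true]
  clear hη hσ hu hl
  induction L with
  | nil => rfl
  | cons r L ih =>
    simp only [List.length_cons, varList_succ, List.map_cons, List.cons.injEq] at hη'
    rw [List.map_cons, symPieces_cons, List.map_cons, ih hη'.2, List.length_map, MCFG.subst,
      List.flatMap_singleton, Sum.elim_inr, hη'.1]

/-- The rules with right-hand side `body` that lead to the given states. -/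
def rulesOf (q : Q) (body : List (Nonterminal k Q × List (Var k)))
    (Ss : List (AbsState (Fin k) (T ⊕ Var k))) : List (MCFGRule T (Nonterminal k Q) (Var k)) :=
  Ss.flatMap fun S =>
    if h : S.shape.1.length ≤ k ∧ S.shape.2.length ≤ k then
      [⟨some (q, ⟨S.shape, h⟩), tuple k S, body⟩]
    else []

def symLabel (a : Option T) : List (T ⊕ Var k) := a.toList.map Sum.inl

/-- The right-hand side lists all `k` variables; those beyond the number of pieces stand for the
padding and are discarded. -/
def unaryRules (op : UnaryOp (Fin k) T Γ) (q q' : Q) (σ : Shape k) :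
    List (MCFGRule T (Nonterminal k Q) (Var k)) :=
  rulesOf q' [(some (q, σ), varList k false k)] ((symState false σ).unary symLabel op)

/-- The Boolean tag keeps the variables of the two operands apart. -/
def joinRules (q₁ q₂ q : Q) (σ₁ σ₂ : Shape k) : List (MCFGRule T (Nonterminal k Q) (Var k)) :=
  rulesOf q [(some (q₁, σ₁), varList k false k), (some (q₂, σ₂), varList k true k)]
    ((symState false σ₁).join (symState true σ₂))

/-- Variable 0 stands for the last component of the tuple. That is the word of the only piece, or,
for the empty graph, a padding component and hence the empty word. -/
def startRules (q : Q) (σ : Shape k) : List (MCFGRule T (Nonterminal k Q) (Var k)) :=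
  if σ.1.1.length ≤ 1 then
    [⟨none, [[.inr (false, Fin.ofNat k 0)]], [(some (q, σ), varList k false k)]⟩]
  else []

def rules (q₀ : Q) (acc : List Q) (us : List (UnaryOp (Fin k) T Γ × Q × Q))
    (js : List (Q × Q × Q)) : List (MCFGRule T (Nonterminal k Q) (Var k)) :=
  rulesOf q₀ [] [.empty] ++
  (acc.flatMap (fun q => (shapes k).flatMap fun σ => startRules q σ) ++
  (us.flatMap (fun t => (shapes k).flatMap fun σ => unaryRules t.1 t.2.1 t.2.2 σ) ++
  js.flatMap fun t => (shapes k).flatMap fun σ₁ => (shapes k).flatMap fun σ₂ =>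
    joinRules t.1 t.2.1 t.2.2 σ₁ σ₂))

def arity (k : ℕ) : Nonterminal k Q → ℕ
  | none => 1
  | some _ => k

/-- The requirements on the rules of a grammar, and a bound on their size. -/
structure IsValid (r : MCFGRule T (Nonterminal k Q) (Var k)) : Prop where
  args_length : r.args.length = arity k r.head
  body_length : ∀ b ∈ r.body, b.2.length = arity k b.1
  rightVars_nodup : r.rightVars.Nodup
  leftVars_nodup : r.leftVars.Nodup
  leftVars_subset : r.leftVars ⊆ r.rightVars
  rank : r.body.length ≤ 2
  words : ∀ w ∈ r.args, w.length ≤ 2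

omit [NeZero k] in
theorem length_tuple {S : AbsState C Z} (h : S.shape.1.length ≤ k) :
    (tuple k S).length = k := by
  simp only [AbsState.shape, List.length_map] at h
  simp [tuple, List.leftpad, AbsState.words, h]

omit [NeZero k] in
theorem mem_rulesOf {q : Q} {body : List (Nonterminal k Q × List (Var k))}
    {Ss : List (AbsState (Fin k) (T ⊕ Var k))} {r : MCFGRule T (Nonterminal k Q) (Var k)} :
    r ∈ rulesOf q body Ss ↔ ∃ S ∈ Ss, ∃ h : S.shape.1.length ≤ k ∧ S.shape.2.length ≤ k,
      r = ⟨some (q, ⟨S.shape, h⟩), tuple k S, body⟩ := by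
  simp only [rulesOf, List.mem_flatMap]
  refine exists_congr fun S => and_congr_right fun _ => ?_
  split_ifs with h <;> simp [h]

omit [NeZero k] in
theorem isValid_of_mem_rulesOf {q : Q} {body : List (Nonterminal k Q × List (Var k))}
    {Ss : List (AbsState (Fin k) (T ⊕ Var k))} {r : MCFGRule T (Nonterminal k Q) (Var k)}
    (hr : r ∈ rulesOf q body Ss) (hbody : ∀ b ∈ body, b.2.length = arity k b.1)
    (hlen : body.length ≤ 2) (hnodup : (body.flatMap Prod.snd).Nodup)
    (hSs : ∀ S ∈ Ss, (∃ l, S.vars.Subperm l ∧ l.Nodup ∧ l ⊆ body.flatMap Prod.snd) ∧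
      ∀ w ∈ S.words, w.length ≤ 2) : IsValid r := by
  obtain ⟨S, hS, h, rfl⟩ := mem_rulesOf.mp hr
  obtain ⟨⟨l, hl, hln, hls⟩, hw⟩ := hSs S hS
  have hleft : (⟨some (q, ⟨S.shape, h⟩), tuple k S, body⟩ :
      MCFGRule T (Nonterminal k Q) (Var k)).leftVars = S.vars := by
    simp [MCFGRule.leftVars, AbsState.vars, tuple, List.leftpad]
  refine ⟨length_tuple h.1, hbody, hnodup, ?_, ?_, hlen, ?_⟩
  · rw [hleft]
    obtain ⟨l', hp, hs⟩ := hl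
    exact hp.nodup_iff.mp (hln.sublist hs)
  · rw [hleft]
    exact fun x hx => hls (hl.subset hx)
  · intro w hw'
    rcases List.mem_append.mp hw' with hw' | hw'
    · simp [List.eq_of_mem_replicate hw']
    · exact hw w hw'

theorem isValid_of_mem_unaryRules {op : UnaryOp (Fin k) T Γ} {q q' : Q} {σ : Shape k}
    {r : MCFGRule T (Nonterminal k Q) (Var k)} (hr : r ∈ unaryRules op q q' σ) : IsValid r := by
  refine isValid_of_mem_rulesOf hr (by simp [arity]) (by simp)
    (by simpa using nodup_varList false le_rfl) fun S hS => ⟨⟨_, ?_, nodup_varList false σ.2.1, ?_⟩,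
    AbsState.length_le_two_of_mem_unary (fun a => by cases a <;> simp [symLabel])
      (length_le_one_symState false σ) hS⟩
  · rw [← vars_symState (T := T)]
    exact AbsState.vars_subperm_of_mem_unary hS
  · simpa using (varList_suffix false σ.2.1).subset

theorem isValid_of_mem_joinRules {q₁ q₂ q : Q} {σ₁ σ₂ : Shape k}
    {r : MCFGRule T (Nonterminal k Q) (Var k)} (hr : r ∈ joinRules q₁ q₂ q σ₁ σ₂) : IsValid r := by
  have hdis (m n : ℕ) : List.Disjoint (varList k false m) (varList k true n) := fun x h₁ h₂ =>
    absurd ((mem_varList h₁).symm.trans (mem_varList h₂)) (by simp)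
  refine isValid_of_mem_rulesOf hr (by simp [arity]) (by simp) ?_ fun S hS => ?_
  · simpa using (nodup_varList false le_rfl).append (nodup_varList true le_rfl) (hdis _ _)
  simp only [AbsState.join] at hS
  split_ifs at hS
  · obtain rfl := List.mem_singleton.mp hS
    rw [AbsState.vars_append, vars_symState, vars_symState]
    refine ⟨⟨_, List.Subperm.refl _, (nodup_varList false σ₁.2.1).append
      (nodup_varList true σ₂.2.1) (hdis _ _), ?_⟩, ?_⟩
    · refine List.append_subset.mpr ⟨fun x hx => ?_, fun x hx => ?_⟩
      · have := (varList_suffix false σ₁.2.1).subset hx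
        simp [this]
      · have := (varList_suffix true σ₂.2.1).subset hx
        simp [this]
    · intro w hw
      simp only [AbsState.words, AbsState.append, List.map_append, List.mem_append] at hw
      exact (hw.elim (length_le_one_symState false σ₁ w)
        (length_le_one_symState true σ₂ w)).trans one_le_two
  · simp at hS

theorem isValid_of_mem_startRules {q : Q} {σ : Shape k}
    {r : MCFGRule T (Nonterminal k Q) (Var k)} (hr : r ∈ startRules q σ) : IsValid r := by
  simp only [startRules] at hr
  split_ifs at hr
  · obtain rfl := List.mem_singleton.mp hr
    refine ⟨rfl, by simp [arity], by simpa [MCFGRule.rightVars] using nodup_varList false le_rfl,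
      by simp [MCFGRule.leftVars], ?_, by simp, by simp⟩
    have : varList k false 1 ⊆ varList k false k :=
      (varList_suffix false (NeZero.one_le : 1 ≤ k)).subset
    simpa [MCFGRule.leftVars, MCFGRule.rightVars, varList] using this
  · simp at hr

variable {q₀ : Q} {acc : List Q} {us : List (UnaryOp (Fin k) T Γ × Q × Q)} {js : List (Q × Q × Q)}

theorem mem_rules {r : MCFGRule T (Nonterminal k Q) (Var k)} : r ∈ rules q₀ acc us js ↔
    r ∈ rulesOf q₀ [] [.empty] ∨ (∃ q ∈ acc, ∃ σ, r ∈ startRules q σ) ∨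
    (∃ t ∈ us, ∃ σ, r ∈ unaryRules t.1 t.2.1 t.2.2 σ) ∨
    ∃ t ∈ js, ∃ σ₁ σ₂, r ∈ joinRules t.1 t.2.1 t.2.2 σ₁ σ₂ := by
  simp only [rules, List.mem_append, List.mem_flatMap, mem_shapes, true_and]

theorem isValid_of_mem_rules {r : MCFGRule T (Nonterminal k Q) (Var k)}
    (hr : r ∈ rules q₀ acc us js) : IsValid r := by
  rcases mem_rules.mp hr with h | ⟨q, -, σ, h⟩ | ⟨t, -, σ, h⟩ | ⟨t, -, σ₁, σ₂, h⟩
  · refine isValid_of_mem_rulesOf h (by simp) (by simp) (by simp) fun S hS => ?_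
    obtain rfl := List.mem_singleton.mp hS
    exact ⟨⟨[], by simp [AbsState.vars, AbsState.words, AbsState.empty], by simp, by simp⟩,
      by simp [AbsState.words, AbsState.empty]⟩
  · exact isValid_of_mem_startRules h
  · exact isValid_of_mem_unaryRules h
  · exact isValid_of_mem_joinRules h

/-- The grammar of an automaton with the given lists of transitions. -/
def grammar (q₀ : Q) (acc : List Q) (us : List (UnaryOp (Fin k) T Γ × Q × Q))
    (js : List (Q × Q × Q)) : MCFG T (Nonterminal k Q) (Var k) where
  arity := arity k
  arity_pos := fun
    | none => le_rfl
    | some _ => (NeZero.one_le : 1 ≤ k)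
  start := none
  arity_start := rfl
  rules := rules q₀ acc us js
  args_length := fun _ hr => (isValid_of_mem_rules hr).args_length
  body_length := fun _ hr => (isValid_of_mem_rules hr).body_length
  rightVars_nodup := fun _ hr => (isValid_of_mem_rules hr).rightVars_nodup
  leftVars_nodup := fun _ hr => (isValid_of_mem_rules hr).leftVars_nodup
  leftVars_subset := fun _ hr => (isValid_of_mem_rules hr).leftVars_subset

theorem hasDimRank_grammar : (grammar q₀ acc us js).HasDimRank k 2 :=
  ⟨fun
    | none => NeZero.one_le
    | some _ => le_rfl, fun _ hr => (isValid_of_mem_rules hr).rank⟩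

/-! ### The language of the grammar -/

theorem subst_append {X : Type} (η : X → List T) (u v : List (T ⊕ X)) :
    MCFG.subst η (u ++ v) = MCFG.subst η u ++ MCFG.subst η v := by
  simp [MCFG.subst]

omit [NeZero k] in
theorem subst_symLabel (η : Var k → List T) (a : Option T) :
    MCFG.subst η (symLabel a) = a.toList := by
  cases a <;> simp [symLabel, MCFG.subst]

omit [NeZero k] in
theorem map_subst_tuple (η : Var k → List T) (S : AbsState C (T ⊕ Var k)) :
    (tuple k S).map (MCFG.subst η) = tuple k (S.mapWord (MCFG.subst η)) := by
  simp [tuple, List.leftpad, MCFG.subst, AbsState.words_mapWord]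

theorem tuple_getLast {S : AbsState C T} (h : S.pieces.length ≤ 1) :
    (tuple k S).getLast? = some (S.pieces.flatMap Piece.word) := by
  obtain ⟨n, rfl⟩ := Nat.exists_eq_succ_of_ne_zero (NeZero.ne k)
  obtain ⟨L, U⟩ := S
  match L, h with
  | [], _ => simp [tuple, AbsState.words, List.leftpad, List.replicate_succ']
  | [r], _ => simp [tuple, AbsState.words, List.leftpad]

theorem map_varList_zero {η : Var k → List T} {S : AbsState C T} (h : S.pieces.length ≤ 1)
    (hη : (varList k false k).map η = tuple k S) :
    η (false, Fin.ofNat k 0) = S.pieces.flatMap Piece.word := by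
  have h₁ := tuple_getLast (k := k) h
  obtain ⟨pre, hpre⟩ := varList_suffix (k := k) false (NeZero.one_le : 1 ≤ k)
  rw [← hη, ← hpre] at h₁
  simpa [varList] using h₁

variable {A : TreeAutomaton (Fin k) T Γ Q}
  (hacc : ∀ q, q ∈ acc ↔ q ∈ A.accept)
  (hus : ∀ op q q', (op, q, q') ∈ us ↔ A.unary op q = some q')
  (hjs : ∀ q₁ q₂ q, (q₁, q₂, q) ∈ js ↔ A.join q₁ q₂ = some q)

-- The invariant for a pair `(q, σ)` provides an actual expression with its abstract state. Shapes
-- that no graph has therefore derive nothing, and their rules are harmless.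
include hacc hus hjs in
theorem sound {N : Nonterminal k Q} {w : List (List T)}
    (h : (grammar A.bot acc us js).Derives N w) :
    match N with
    | some (q, σ) => ∃ ψ S, LoExpr.AbsEval ψ S ∧ A.run ψ = some q ∧ S.shape = σ.1 ∧ w = tuple k S
    | none => ∃ v ∈ A.wordLanguage, w = [v] := by
  induction h with
  | rule r hr η _ ih =>
    rcases mem_rules.mp hr with h | ⟨q, hq, σ, h⟩ | ⟨⟨op, q, q'⟩, ht, σ, h⟩ |
      ⟨⟨q₁, q₂, q⟩, ht, σ₁, σ₂, h⟩
    · obtain ⟨S, hS, h, rfl⟩ := mem_rulesOf.mp h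
      obtain rfl := List.mem_singleton.mp hS
      exact ⟨.bot, .empty, .bot, rfl, rfl, map_subst_tuple η _⟩
    · simp only [startRules] at h
      split_ifs at h with hσ
      · obtain rfl := List.mem_singleton.mp h
        obtain ⟨ψ, S, hψ, hrun, hS, hw⟩ := ih _ (List.mem_singleton_self _)
        have hlen : S.pieces.length ≤ 1 := by
          rw [← hS] at hσ
          simpa [AbsState.shape] using hσ
        refine ⟨_, (A.mem_wordLanguage_iff _).mpr ⟨ψ, S, hψ, ⟨q, (hacc q).mp hq, hrun⟩, hlen, rfl⟩,
          ?_⟩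
        rw [← map_varList_zero hlen hw]
        simp [MCFG.subst]
      · simp at h
    · obtain ⟨S', hS', h, rfl⟩ := mem_rulesOf.mp h
      obtain ⟨ψ, S, hψ, hrun, hS, hw⟩ := ih _ (List.mem_singleton_self _)
      refine ⟨.unary op ψ, S'.mapWord (MCFG.subst η), .unary hψ ?_, ?_, by simp,
        map_subst_tuple η _⟩
      -- The state of the subexpression is the symbolic state with the derived words substituted, so
      -- the symbolic result of the rule specialises to a result of the operation.
      · rw [← mapWord_symState hS hw, AbsState.unary_mapWord (subst_append η) (subst_symLabel η)]
        exact List.mem_map_of_mem hS'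
      · simpa [TreeAutomaton.run, hrun] using (hus op q q').mp ht
    · obtain ⟨S', hS', h, rfl⟩ := mem_rulesOf.mp h
      obtain ⟨ψ₁, S₁, hψ₁, hrun₁, hS₁, hw₁⟩ := ih (some (q₁, σ₁), varList k false k) (by simp)
      obtain ⟨ψ₂, S₂, hψ₂, hrun₂, hS₂, hw₂⟩ := ih (some (q₂, σ₂), varList k true k) (by simp)
      refine ⟨.join ψ₁ ψ₂, S'.mapWord (MCFG.subst η), .join hψ₁ hψ₂ ?_, ?_, by simp,
        map_subst_tuple η _⟩
      · rw [← mapWord_symState hS₁ hw₁, ← mapWord_symState hS₂ hw₂, AbsState.join_mapWord]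
        exact List.mem_map_of_mem hS'
      · simpa [TreeAutomaton.run, hrun₁, hrun₂] using (hjs q₁ q₂ q).mp ht

omit [NeZero k] in
theorem shape_bounded {ψ : LoExpr (Fin k) T Γ} {S : AbsState (Fin k) T} [NeZero k]
    (h : ψ.AbsEval S) (hS : ¬ S.Dead) : S.shape.1.length ≤ k ∧ S.shape.2.length ≤ k := by
  obtain ⟨-, ps, hr⟩ := h.wellFormed
  have h₁ := ColoredGraph.Represents.length_le hr hS
  have h₂ := hr.used_nodup.length_le_card
  simp only [Fintype.card_fin] at h₁ h₂
  exact ⟨by simpa [AbsState.shape] using h₁, h₂⟩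

-- Deadness is inherited by all larger expressions, so the subexpressions of an expression with a
-- live state have live states, and their shapes are within the bounds of the nonterminals.
include hus hjs in
theorem complete {ψ : LoExpr (Fin k) T Γ} {S : AbsState (Fin k) T} (h : ψ.AbsEval S)
    (hS : ¬ S.Dead) {q : Q} (hq : A.run ψ = some q) :
    (grammar A.bot acc us js).Derives (some (q, ⟨S.shape, shape_bounded h hS⟩)) (tuple k S) := by
  induction h generalizing q with
  | bot =>
    obtain rfl : A.bot = q := Option.some.inj hq
    have := MCFG.Derives.rule (G := grammar A.bot acc us js)
      ⟨some (A.bot, ⟨AbsState.empty.shape, ⟨Nat.zero_le _, Nat.zero_le _⟩⟩), tuple k .empty, []⟩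
      (mem_rules.mpr (.inl (mem_rulesOf.mpr ⟨_, List.mem_singleton_self _, _, rfl⟩)))
      (fun _ => []) (by simp)
    rw [map_subst_tuple] at this
    exact this
  | @unary op ψ S S' hψ hS' ih =>
    have hd : ¬ S.Dead := fun hd => hS (hd.unary hS')
    simp only [TreeAutomaton.run, Option.bind_eq_some_iff] at hq
    obtain ⟨q₁, hrun, hq⟩ := hq
    obtain ⟨g, hg⟩ := exists_map_varList (T := T) (k := k) false
      (length_tuple (shape_bounded hψ hd).1)
    have hsym := mapWord_symState (σ := ⟨S.shape, shape_bounded hψ hd⟩) rfl hg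
    have hmem := hS'
    rw [← hsym, AbsState.unary_mapWord (subst_append _) (subst_symLabel _)] at hmem
    -- The actual result lifts to a symbolic one, whose rule is the one to apply.
    obtain ⟨S'', hS'', rfl⟩ := List.mem_map.mp hmem
    have hb : S''.shape.1.length ≤ k ∧ S''.shape.2.length ≤ k := by
      simpa using shape_bounded (LoExpr.AbsEval.unary hψ hS') hS
    have := MCFG.Derives.rule (G := grammar A.bot acc us js)
      ⟨some (q, ⟨S''.shape, hb⟩), tuple k S'',
        [(some (q₁, ⟨S.shape, shape_bounded hψ hd⟩), varList k false k)]⟩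
      (mem_rules.mpr (.inr (.inr (.inl ⟨(op, q₁, q), (hus op q₁ q).mpr hq, _,
        mem_rulesOf.mpr ⟨S'', hS'', hb, rfl⟩⟩))))
      (fun x => g x.2) (by
        intro b hb
        obtain rfl := List.mem_singleton.mp hb
        rw [hg]
        exact ih hd hrun)
    rw [map_subst_tuple] at this
    simpa using this
  | @join ψ₁ ψ₂ S₁ S₂ S' hψ₁ hψ₂ hS' ih₁ ih₂ =>
    have hd₁ : ¬ S₁.Dead := fun hd => hS (hd.join_left hS')
    have hd₂ : ¬ S₂.Dead := fun hd => hS (hd.join_right hS')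
    simp only [TreeAutomaton.run, Option.bind_eq_some_iff] at hq
    obtain ⟨q₁, hrun₁, q₂, hrun₂, hq⟩ := hq
    obtain ⟨g₁, hg₁⟩ := exists_map_varList (T := T) (k := k) false
      (length_tuple (shape_bounded hψ₁ hd₁).1)
    obtain ⟨g₂, hg₂⟩ := exists_map_varList (T := T) (k := k) true
      (length_tuple (shape_bounded hψ₂ hd₂).1)
    -- A single substitution has to serve both members of the right-hand side; the tag decides
    -- between the two tuples.
    set η : Var k → List T := fun x => if x.1 then g₂ x.2 else g₁ x.2 with hη
    have hη₁ : (varList k false k).map η = tuple k S₁ := by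
      rw [← hg₁]
      exact List.map_congr_left fun x hx => by simp [hη, mem_varList hx]
    have hη₂ : (varList k true k).map η = tuple k S₂ := by
      rw [← hg₂]
      exact List.map_congr_left fun x hx => by simp [hη, mem_varList hx]
    have hsym₁ := mapWord_symState (σ := ⟨S₁.shape, shape_bounded hψ₁ hd₁⟩) rfl hη₁
    have hsym₂ := mapWord_symState (σ := ⟨S₂.shape, shape_bounded hψ₂ hd₂⟩) rfl hη₂
    have hmem := hS'
    rw [← hsym₁, ← hsym₂, AbsState.join_mapWord] at hmem
    obtain ⟨S'', hS'', rfl⟩ := List.mem_map.mp hmem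
    have hb : S''.shape.1.length ≤ k ∧ S''.shape.2.length ≤ k := by
      simpa using shape_bounded (LoExpr.AbsEval.join hψ₁ hψ₂ hS') hS
    have := MCFG.Derives.rule (G := grammar A.bot acc us js)
      ⟨some (q, ⟨S''.shape, hb⟩), tuple k S'',
        [(some (q₁, ⟨S₁.shape, shape_bounded hψ₁ hd₁⟩), varList k false k),
          (some (q₂, ⟨S₂.shape, shape_bounded hψ₂ hd₂⟩), varList k true k)]⟩
      (mem_rules.mpr (.inr (.inr (.inr ⟨(q₁, q₂, q), (hjs q₁ q₂ q).mpr hq, _, _,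
        mem_rulesOf.mpr ⟨S'', hS'', hb, rfl⟩⟩))))
      η (by
        intro b hb
        simp only [List.mem_cons, List.not_mem_nil, or_false] at hb
        rcases hb with rfl | rfl
        · rw [hη₁]
          exact ih₁ hd₁ hrun₁
        · rw [hη₂]
          exact ih₂ hd₂ hrun₂)
    rw [map_subst_tuple] at this
    simpa using this

include hacc hus hjs in
theorem language_grammar : (grammar A.bot acc us js).language = A.wordLanguage := by
  ext w
  constructor
  · intro h
    obtain ⟨v, hv, hw⟩ := sound hacc hus hjs h
    obtain rfl := List.singleton_injective hw
    exact hv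
  · intro h
    obtain ⟨ψ, S, hψ, ⟨q, hq, hrun⟩, hlen, rfl⟩ := (A.mem_wordLanguage_iff w).mp h
    -- A dead state has at least two pieces, an accepted lo-graph at most one.
    have hd : ¬ S.Dead := fun hd => by have := hd.1; omega
    obtain ⟨g, hg⟩ := exists_map_varList (T := T) (k := k) false
      (length_tuple (shape_bounded hψ hd).1)
    have := MCFG.Derives.rule (G := grammar A.bot acc us js)
      ⟨none, [[.inr (false, Fin.ofNat k 0)]],
        [(some (q, ⟨S.shape, shape_bounded hψ hd⟩), varList k false k)]⟩
      (mem_rules.mpr (.inr (.inl ⟨q, (hacc q).mpr hq, ⟨S.shape, shape_bounded hψ hd⟩, by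
        simpa [startRules, AbsState.shape] using hlen⟩)))
      (fun x => g x.2) (by
        intro b hb
        obtain rfl := List.mem_singleton.mp hb
        rw [hg]
        exact complete hus hjs hψ hd hrun)
    have h₀ : MCFG.subst (fun x => g x.2) [Sum.inr (false, Fin.ofNat k 0)] =
        S.pieces.flatMap Piece.word := by
      rw [← map_varList_zero hlen hg]
      exact List.append_nil _
    rw [← h₀]
    exact this

end

end LoGrammar

end

/-! ### The construction as a program: data, states, rules, the whole grammar. -/

/-! ### Numerals, truth values and lists as data -/

namespace Data

def ofBool : Bool → Data
  | true => cons nil nil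
  | false => nil

theorem ofList_injective : Function.Injective ofList := by
  intro l
  induction l with
  | nil => rintro (_ | ⟨a, l⟩) h <;> first | rfl | cases h
  | cons a l ih =>
    rintro (_ | ⟨b, l'⟩) h
    · cases h
    · injection h with h₁ h₂
      rw [h₁, ih h₂]

theorem num_injective : Function.Injective num := fun a b h => by
  simpa using congrArg List.length (ofList_injective h)

@[simp] theorem num_inj {a b : ℕ} : num a = num b ↔ a = b := num_injective.eq_iff

theorem num_zero : num 0 = nil := rfl

theorem num_succ (n : ℕ) : num (n + 1) = cons nil (num n) := rfl

theorem num_eq_nil {n : ℕ} : num n = nil ↔ n = 0 := by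
  rw [← num_zero, num_inj]

@[simp] theorem ofBool_eq_nil {b : Bool} : ofBool b = nil ↔ b = false := by
  cases b <;> simp [ofBool]

theorem ofList_eq_nil {l : List Data} : ofList l = nil ↔ l = [] := by
  cases l <;> simp [ofList]

theorem tail_num (n : ℕ) : (num n).tail = num (n - 1) := by
  cases n <;> rfl

end Data

open Data (ofBool)

namespace Comp

variable {ι : Type*} {n m : ι → ℕ} {inp out out₁ out₂ : ι → Data} {α β : ι → Type*}
  {ls : ∀ i, List (α i)} {e : ∀ i, α i → Data}

/-! ### Contexts -/

theorem inElem (h : Comp n m inp out) {y : ListElem ls → Data} :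
    Comp (fun p : ListElem ls => n p.idx) (fun p => m p.idx)
      (fun p => .cons (inp p.idx) (y p)) (fun p => out p.idx) :=
  h.lift ListElem.idx y

/-- A computation for the members of a list, in the context of a recursion over the list. -/
theorem ofElem {r : ListSuffix ls → Data} {g : ∀ i, α i → Data}
    (h : Comp (fun _ => 0) (fun p : ListElem ls => m p.idx)
      (fun p => .cons (inp p.idx) (e _ p.elem)) (fun p => g _ p.elem)) :
    Comp (fun _ => 0) (fun p : ListSuffix ls => m p.idx)
      (fun p => .cons (inp p.idx) (.cons (e _ p.hd) (r p))) (fun p => g _ p.hd) :=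
  (id.head.cons id.tail.head).comp
    (h.pull fun p : ListSuffix ls => ⟨p.idx, p.hd, p.suffix.subset (by simp)⟩)

/-! ### Case distinctions -/

theorem byCases {b : ι → Bool} (hb : Comp n m inp fun i => ofBool (b i))
    (h₁ : Comp (fun i : {i // b i = true} => n i) (fun i => m i) (fun i => inp i) (fun i => out i))
    (h₂ : Comp (fun i : {i // b i = false} => n i) (fun i => m i) (fun i => inp i)
      (fun i => out i)) :
    Comp n m inp out :=
  hb.ite
    (h₁.pull fun i : {i // ofBool (b i) ≠ .nil} => ⟨i, by simpa using i.2⟩)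
    (h₂.pull fun i : {i // ofBool (b i) = .nil} => ⟨i, by simpa using i.2⟩)

theorem bcond {b : ι → Bool} (hb : Comp n m inp fun i => ofBool (b i)) (h₁ : Comp n m inp out₁)
    (h₂ : Comp n m inp out₂) : Comp n m inp fun i => if b i then out₁ i else out₂ i :=
  hb.byCases ((h₁.pull _).of_eq fun i => by simp [i.2]) ((h₂.pull _).of_eq fun i => by simp [i.2])

theorem ofTrue : Comp n m inp fun _ => ofBool true := nil.cons nil

theorem ofFalse : Comp n m inp fun _ => ofBool false := nil

theorem and {a b : ι → Bool} (ha : Comp n m inp fun i => ofBool (a i))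
    (hb : Comp n m inp fun i => ofBool (b i)) : Comp n m inp fun i => ofBool (a i && b i) :=
  (ha.bcond hb ofFalse).of_eq fun i => by cases a i <;> rfl

theorem not {a : ι → Bool} (ha : Comp n m inp fun i => ofBool (a i)) :
    Comp n m inp fun i => ofBool (!a i) :=
  (ha.bcond ofFalse ofTrue).of_eq fun i => by cases a i <;> rfl

theorem isNil (h : Comp n m inp out) {b : ι → Bool} (hb : ∀ i, b i ↔ out i = .nil) :
    Comp n m inp fun i => ofBool (b i) :=
  h.ite (ofFalse.of_eq fun i => by
      rw [(Bool.not_eq_true _).mp fun h => i.2 ((hb i).mp h)])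
    (ofTrue.of_eq fun i => by rw [(hb i).mpr i.2])

/-! ### Lists -/

theorem singleton (h : Comp n m inp out) : Comp n m inp fun i => .ofList [out i] := h.cons nil

theorem map {g : ∀ i, α i → Data}
    (hl : Comp n m inp fun i => .ofList ((ls i).map (e i)))
    (hlen : Bdd n m fun i => (ls i).length)
    (hg : Comp (fun _ => 0) (fun p : ListElem ls => m p.idx)
      (fun p => .cons (inp p.idx) (e _ p.elem)) (fun p => g _ p.elem)) :
    Comp n m inp fun i => .ofList ((ls i).map (g i)) :=
  hl.foldr (fun i l => .ofList (l.map (g i))) hlen nil (hg.ofElem.cons id.tail.tail)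

theorem append {l₁ l₂ : ∀ i, List (α i)} (h₁ : Comp n m inp fun i => .ofList ((l₁ i).map (e i)))
    (h₂ : Comp n m inp fun i => .ofList ((l₂ i).map (e i)))
    (hlen : Bdd n m fun i => (l₁ i).length) :
    Comp n m inp fun i => .ofList ((l₁ i ++ l₂ i).map (e i)) :=
  h₁.foldr (fun i l => .ofList ((l ++ l₂ i).map (e i))) hlen h₂ (id.tail.head.cons id.tail.tail)

/-- Every block is copied by `append` at the cost of its length, which is why `hglen` must not
involve `n`: the total is then the length of the outer list times a polynomial in `m`. -/
theorem flatMap {g : ∀ i, α i → List (β i)} {e' : ∀ i, β i → Data}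
    (hl : Comp n m inp fun i => .ofList ((ls i).map (e i)))
    (hlen : Bdd n m fun i => (ls i).length)
    (hg : Comp (fun _ => 0) (fun p : ListElem ls => m p.idx)
      (fun p => .cons (inp p.idx) (e _ p.elem)) (fun p => .ofList ((g _ p.elem).map (e' _))))
    (hglen : Bdd (fun _ => 0) (fun p : ListElem ls => m p.idx) fun p => (g _ p.elem).length) :
    Comp n m inp fun i => .ofList (((ls i).flatMap (g i)).map (e' i)) := by
  refine hl.foldr (fun i l => .ofList ((l.flatMap (g i)).map (e' i))) hlen nil ?_
  simp only [List.flatMap_cons]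
  exact append (ofElem (g := fun i a => .ofList ((g i a).map (e' i))) hg) id.tail.tail
    (hglen.pull fun p : ListSuffix ls => ⟨p.idx, p.hd, p.suffix.subset (by simp)⟩)

theorem filter {b : ∀ i, α i → Bool}
    (hl : Comp n m inp fun i => .ofList ((ls i).map (e i)))
    (hlen : Bdd n m fun i => (ls i).length)
    (hb : Comp (fun _ => 0) (fun p : ListElem ls => m p.idx)
      (fun p => .cons (inp p.idx) (e _ p.elem)) (fun p => ofBool (b _ p.elem))) :
    Comp n m inp fun i => .ofList (((ls i).filter (b i)).map (e i)) := by
  refine hl.foldr (fun i l => .ofList ((l.filter (b i)).map (e i))) hlen nil ?_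
  refine ((hb.ofElem (g := fun i a => ofBool (b i a))).bcond (id.tail.head.cons id.tail.tail) id.tail.tail).of_eq fun p => ?_
  simp only [List.filter_cons]
  split_ifs <;> rfl

theorem isEmpty (hl : Comp n m inp fun i => .ofList ((ls i).map (e i))) :
    Comp n m inp fun i => ofBool (ls i).isEmpty :=
  hl.isNil fun i => by simp [Data.ofList_eq_nil]

/-! ### Numerals -/

/-- A numeral is a list of `nil`s, so this is list recursion. The step receives the context and the
previous value but not the counter; the inequality in its index type is available for bounds only.
-/
theorem natRec {a : ι → ℕ} (F : ∀ _ : ι, ℕ → Data) (ha : Comp n m inp fun i => .num (a i))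
    (hbd : Bdd n m a) (h₀ : Comp n m inp fun i => F i 0)
    (hs : Comp (fun _ => 0) (fun p : {p : ι × ℕ // p.2 < a p.1} => m p.1.1)
      (fun p => .cons (inp p.1.1) (F p.1.1 p.1.2)) (fun p => F p.1.1 (p.1.2 + 1))) :
    Comp n m inp fun i => F i (a i) := by
  have hl : Comp n m inp fun i => .ofList ((List.replicate (a i) ()).map fun _ => Data.nil) :=
    ha.of_eq fun i => by simp [Data.num]
  refine (hl.foldr (ls := fun i => List.replicate (a i) ()) (fun i l => F i l.length)
    (by simpa using hbd) h₀ ?_).of_eq fun i => by simp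
  exact (id.head.cons id.tail.tail).comp (hs.pull fun p : ListSuffix fun i =>
    List.replicate (a i) () => ⟨(p.idx, p.tl.length), by simpa using p.suffix.length_le⟩)

theorem zero : Comp n m inp fun _ => .num 0 := nil

theorem succ {a : ι → ℕ} (h : Comp n m inp fun i => .num (a i)) :
    Comp n m inp fun i => .num (a i + 1) := nil.cons h

theorem pred {a : ι → ℕ} (h : Comp n m inp fun i => .num (a i)) :
    Comp n m inp fun i => .num (a i - 1) := h.tail.of_eq fun _ => Data.tail_num _

theorem sub {a b : ι → ℕ} (ha : Comp n m inp fun i => .num (a i))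
    (hb : Comp n m inp fun i => .num (b i)) (hbd : Bdd n m b) :
    Comp n m inp fun i => .num (a i - b i) := by
  refine hb.natRec (fun i j => .num (a i - j)) hbd ha ?_
  simp only [← Nat.sub_sub]
  exact pred id.tail

theorem le {a b : ι → ℕ} (ha : Comp n m inp fun i => .num (a i))
    (hb : Comp n m inp fun i => .num (b i)) (hbd : Bdd n m b) :
    Comp n m inp fun i => ofBool (a i ≤ b i) :=
  (ha.sub hb hbd).isNil fun i => by simp [Data.num_eq_nil, Nat.sub_eq_zero_iff_le]

theorem natEq {a b : ι → ℕ} (ha : Comp n m inp fun i => .num (a i))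
    (hb : Comp n m inp fun i => .num (b i)) (had : Bdd n m a) (hbd : Bdd n m b) :
    Comp n m inp fun i => ofBool (a i = b i) :=
  ((ha.le hb hbd).and (hb.le ha had)).of_eq fun i => by
    rw [← Bool.decide_and, Bool.decide_congr Nat.le_antisymm_iff]

theorem length (hl : Comp n m inp fun i => .ofList ((ls i).map (e i)))
    (hlen : Bdd n m fun i => (ls i).length) : Comp n m inp fun i => .num (ls i).length :=
  hl.foldr (fun _ l => .num l.length) hlen nil (succ id.tail.tail)

/-- Descending numerals. -/
theorem range {a : ι → ℕ} (ha : Comp n m inp fun i => .num (a i)) (hbd : Bdd n m a) :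
    Comp n m inp fun i => .ofList ((List.range (a i)).reverse.map .num) := by
  refine ha.natRec (fun i j => .ofList ((List.range j).reverse.map .num)) hbd nil ?_
  refine Comp.cons (out₁ := fun p : {p : ι × ℕ // p.2 < a p.1} => .num p.1.2) ?_ id.tail
    |>.of_eq fun p => by simp [List.range_succ, Data.ofList, Data.tail]
  -- The counter is recovered from the list built so far: it is 0 if the list is empty, and
  -- otherwise the successor of its head.
  refine ((id.tail.isNil (b := fun p => p.1.2 == 0) fun p => ?_).bcond nil
    (nil.cons id.tail.head)).of_eq fun p => ?_
  · rw [Data.tail, Data.ofList_eq_nil]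
    simp
  · obtain ⟨⟨i, _ | j⟩, h⟩ := p
    · rfl
    · simp [Data.tail, Data.head, List.range_succ, Data.ofList, Data.num_succ]

/-- All intermediate lists are at most as long as the bound for the last one, so `hpow` controls
every round. The base list is traversed anew in each round and must be computable in time
independent of `n`. -/
theorem boundedLists {a : ι → ℕ} (ha : Comp n m inp fun i => .num (a i))
    (hl₀ : Comp (fun _ => 0) m inp fun i => .ofList ((ls i).map (e i)))
    (hbd : Bdd n m a) (hlen : Bdd (fun _ => 0) m fun i => (ls i).length)
    (hpow : Bdd (fun _ => 0) m fun i => ((ls i).length + 1) ^ a i) :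
    Comp n m inp fun i =>
      .ofList ((_root_.boundedLists (ls i) (a i)).map fun l => .ofList (l.map (e i))) := by
  have hb : ∀ i j, j ≤ a i →
      (_root_.boundedLists (ls i) j).length ≤ ((ls i).length + 1) ^ a i := fun i j hj =>
    (length_boundedLists_le _ _).trans (Nat.pow_le_pow_right (by omega) hj)
  refine ha.natRec (fun i j => .ofList ((_root_.boundedLists (ls i) j).map fun l =>
    .ofList (l.map (e i)))) hbd (nil.cons nil) ?_
  refine Comp.cons nil (flatMap (ls := fun p : {p : ι × ℕ // p.2 < a p.1} => ls p.1.1)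
    (e := fun p => e p.1.1) (β := fun p => List (α p.1.1))
    (e' := fun p l => .ofList (l.map (e p.1.1)))
    (g := fun p x => (_root_.boundedLists (ls p.1.1) p.1.2).map (x :: ·))
    (hl₀.lift _ _) (hlen.pull _) ?_ ?_)
  · simp only [List.map_map]
    exact map (ls := fun p : ListElem fun p : {p : ι × ℕ // p.2 < a p.1} => ls p.1.1 =>
        _root_.boundedLists (ls p.idx.1.1) p.idx.1.2)
      (e := fun p l => .ofList (l.map (e p.idx.1.1))) id.head.tail
      ((hpow.pull fun p : ListElem fun p : {p : ι × ℕ // p.2 < a p.1} => ls p.1.1 =>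
        p.idx.1.1).mono fun p => hb _ _ p.idx.2.le) (id.head.tail.cons id.tail)
  · simp only [List.length_map]
    exact (hpow.pull fun p : ListElem fun p : {p : ι × ℕ // p.2 < a p.1} => ls p.1.1 =>
      p.idx.1.1).mono fun p => hb _ _ p.idx.2.le

end Comp

/-- Computability in time polynomial in `m`. -/
abbrev PComp {ι : Type*} (m : ι → ℕ) (inp out : ι → Data) : Prop := Comp (fun _ => 0) m inp out

/-- Boundedness by a polynomial in `m`. -/
abbrev PBdd {ι : Type*} (m f : ι → ℕ) : Prop := Bdd (fun _ => 0) m f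

/-! ### Colours, pieces and states as data -/

section Encoding

variable {k : ℕ} {Z : Type}

def encodeOption (o : Option (Fin k)) : Data := .num (o.elim 0 fun c => c + 1)

def encodePair (p : Option (Fin k) × Option (Fin k)) : Data :=
  .cons (encodeOption p.1) (encodeOption p.2)

def encodeColor (c : Fin k) : Data := .num c

def encodeShape (σ : List (Option (Fin k) × Option (Fin k)) × List (Fin k)) : Data :=
  .cons (.ofList (σ.1.map encodePair)) (.ofList (σ.2.map encodeColor))

def Piece.encode (sym : Z → Data) (r : Piece (Fin k) Z) : Data :=
  .cons (encodeOption r.first) (.cons (encodeOption r.last) (.ofList (r.word.map sym)))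

def AbsState.encode (sym : Z → Data) (S : AbsState (Fin k) Z) : Data :=
  .cons (.ofList (S.pieces.map (Piece.encode sym))) (.ofList (S.used.map encodeColor))

theorem encodeColor_injective : Function.Injective (encodeColor (k := k)) := fun _ _ h =>
  Fin.ext (Data.num_injective h)

theorem encodeOption_injective : Function.Injective (encodeOption (k := k)) := fun a b h => by
  have := Data.num_injective h
  cases a <;> cases b <;> simp [Fin.ext_iff] at this ⊢
  exact this

theorem encodePair_injective : Function.Injective (encodePair (k := k)) := fun a b h => by
  injection h with h₁ h₂
  exact Prod.ext (encodeOption_injective h₁) (encodeOption_injective h₂)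

theorem encodeShape_injective : Function.Injective (encodeShape (k := k)) := fun a b h => by
  injection h with h₁ h₂
  exact Prod.ext (encodePair_injective.list_map (Data.ofList_injective h₁))
    (encodeColor_injective.list_map (Data.ofList_injective h₂))

end Encoding

/-- A state of bounded size whose words have at most one letter. -/
structure AbsState.IsSmall {k : ℕ} {Z : Type} (S : AbsState (Fin k) Z) : Prop where
  pieces : S.pieces.length ≤ k
  used : S.used.length ≤ k
  word : ∀ r ∈ S.pieces, r.word.length ≤ 1

theorem AbsState.length_of_mem_unary {C T Γ Z : Type} [DecidableEq C] {ℓ : Option T → List Z}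
    {S S' : AbsState C Z} {op : UnaryOp C T Γ} (h : S' ∈ S.unary ℓ op) :
    S'.pieces.length ≤ S.pieces.length + 1 ∧ S'.used.length ≤ S.used.length + 1 := by
  cases op with
  | node c a =>
    simp only [unary] at h
    split_ifs at h
    · simp at h
    · obtain rfl := List.mem_singleton.mp h
      simp [append, single]
  | addSucc c₁ c₂ =>
    simp only [unary, addSucc, List.mem_flatMap, List.mem_map] at h
    obtain ⟨r₁, h₁, r₂, h₂, rfl⟩ := h
    exact ⟨Nat.succ_le_succ (List.length_filter_le _ _), Nat.le_succ _⟩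
  | addEdge γ c₁ c₂ =>
    obtain rfl := List.mem_singleton.mp h
    exact ⟨Nat.le_succ _, Nat.le_succ _⟩
  | forget c =>
    obtain rfl := List.mem_singleton.mp h
    refine ⟨by simp [forget], ?_⟩
    exact (List.length_filter_le _ _).trans (Nat.le_succ _)

theorem List.length_flatMap_le {α β : Type*} {l : List α} {f : α → List β} {b : ℕ}
    (h : ∀ a ∈ l, (f a).length ≤ b) : (l.flatMap f).length ≤ l.length * b := by
  rw [List.length_flatMap]
  simpa using List.sum_le_card_nsmul (l.map fun a => (f a).length) b (by simpa using h)

theorem AbsState.length_unary_le {C T Γ Z : Type} [DecidableEq C] {ℓ : Option T → List Z}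
    (S : AbsState C Z) (op : UnaryOp C T Γ) :
    (S.unary ℓ op).length ≤ S.pieces.length * S.pieces.length + 1 := by
  cases op with
  | node c a =>
    simp only [unary]
    split_ifs <;> simp
  | addSucc c₁ c₂ =>
    refine (List.length_flatMap_le (b := S.pieces.length) fun r _ => ?_).trans
      ((Nat.mul_le_mul_right _ (List.length_filter_le _ _)).trans (Nat.le_succ _))
    rw [List.length_map]
    exact List.length_filter_le _ _
  | addEdge γ c₁ c₂ => simp [unary]
  | forget c => simp [unary]

theorem AbsState.length_join_le {C Z : Type} [DecidableEq C] (S₁ S₂ : AbsState C Z) :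
    (S₁.join S₂).length ≤ 1 := by
  unfold join
  split_ifs <;> simp

namespace PComp

variable {ι : Type*} {m : ι → ℕ} {inp : ι → Data} {k : ι → ℕ}

/-! ### Computing with colours -/

theorem optionEq (hk : PBdd m k) {o o' : ∀ i, Option (Fin (k i))}
    (h : PComp m inp fun i => encodeOption (o i)) (h' : PComp m inp fun i => encodeOption (o' i)) :
    PComp m inp fun i => ofBool (o i = o' i) := by
  have hb : ∀ o : ∀ i, Option (Fin (k i)), PBdd m fun i => (o i).elim 0 fun c => c.val + 1 :=
    fun o => hk.mono fun i => by
      cases o i with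
      | none => exact Nat.zero_le _
      | some c => exact c.2
  refine (Comp.natEq h h' (hb o) (hb o')).of_eq fun i => ?_
  congr 1
  refine Bool.decide_congr ⟨fun e => ?_, fun e => by rw [e]⟩
  exact encodeOption_injective (congrArg Data.num e)

theorem colorEq (hk : PBdd m k) {c c' : ∀ i, Fin (k i)}
    (h : PComp m inp fun i => encodeColor (c i)) (h' : PComp m inp fun i => encodeColor (c' i)) :
    PComp m inp fun i => ofBool (c i = c' i) :=
  (Comp.natEq h h' (hk.mono fun i => (c i).2.le) (hk.mono fun i => (c' i).2.le)).of_eq fun i => by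
    congr 1
    exact Bool.decide_congr Fin.ext_iff.symm

theorem some {c : ∀ i, Fin (k i)} (h : PComp m inp fun i => encodeColor (c i)) :
    PComp m inp fun i => encodeOption (some (c i)) := Comp.nil.cons h

theorem memColor (hk : PBdd m k) {c : ∀ i, Fin (k i)} {U : ∀ i, List (Fin (k i))}
    (h : PComp m inp fun i => encodeColor (c i))
    (hU : PComp m inp fun i => .ofList ((U i).map encodeColor))
    (hlen : PBdd m fun i => (U i).length) :
    PComp m inp fun i => ofBool (c i ∈ U i) := by
  refine (Comp.not (Comp.isEmpty (Comp.filter (b := fun i x => decide (x = c i)) hU hlen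
    (colorEq (hk.pull ListElem.idx) Comp.id.tail h.inElem)))).of_eq fun i => ?_
  congr 1
  rw [Bool.eq_iff_iff]
  simp

/-! ### Computing with states -/

variable {Z : ι → Type} {sym : ∀ i, Z i → Data} {S S₁ S₂ : ∀ i, AbsState (Fin (k i)) (Z i)}

theorem append (h₁ : PComp m inp fun i => (S₁ i).encode (sym i))
    (h₂ : PComp m inp fun i => (S₂ i).encode (sym i)) (hk : PBdd m k)
    (hS : ∀ i, (S₁ i).IsSmall) :
    PComp m inp fun i => ((S₁ i).append (S₂ i)).encode (sym i) :=
  (Comp.append h₁.head h₂.head (hk.mono fun i => (hS i).pieces)).cons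
    (Comp.append h₁.tail h₂.tail (hk.mono fun i => (hS i).used))

theorem join (h₁ : PComp m inp fun i => (S₁ i).encode (sym i))
    (h₂ : PComp m inp fun i => (S₂ i).encode (sym i)) (hk : PBdd m k)
    (hS₁ : ∀ i, (S₁ i).IsSmall) (hS₂ : ∀ i, (S₂ i).IsSmall) :
    PComp m inp fun i => .ofList (((S₁ i).join (S₂ i)).map (AbsState.encode (sym i))) := by
  have hU₁ : PComp m inp fun i => .ofList ((S₁ i).used.map encodeColor) := h₁.tail
  have hU₂ : PComp m inp fun i => .ofList ((S₂ i).used.map encodeColor) := h₂.tail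
  refine (Comp.bcond (Comp.isEmpty (Comp.filter (b := fun i x => decide (x ∈ (S₂ i).used)) hU₁
    (hk.mono fun i => (hS₁ i).used) (memColor (hk.pull ListElem.idx) Comp.id.tail hU₂.inElem
      ((hk.mono fun i => (hS₂ i).used).pull ListElem.idx))))
    (append h₁ h₂ hk hS₁).singleton Comp.nil).of_eq fun i => ?_
  simp only [AbsState.join]
  split_ifs <;> rfl

theorem addSucc {c₁ c₂ : ∀ i, Fin (k i)} (h : PComp m inp fun i => (S i).encode (sym i))
    (h₁ : PComp m inp fun i => encodeColor (c₁ i)) (h₂ : PComp m inp fun i => encodeColor (c₂ i))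
    (hk : PBdd m k) (hS : ∀ i, (S i).IsSmall) :
    PComp m inp fun i => .ofList (((S i).addSucc (c₁ i) (c₂ i)).map (AbsState.encode (sym i))) := by
  have hL : PComp m inp fun i => .ofList ((S i).pieces.map (Piece.encode (sym i))) := h.head
  have hU : PComp m inp fun i => .ofList ((S i).used.map encodeColor) := h.tail
  have hlen : PBdd m fun i => (S i).pieces.length := hk.mono fun i => (hS i).pieces
  have hk' := hk.pull (ListElem.idx (ls := fun i => (S i).pieces))
  have hlast : PComp (fun p : ListElem fun i => (S i).pieces => m p.idx)
      (fun p => .cons (inp p.idx) (p.elem.encode (sym _)))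
      (fun p => ofBool (p.elem.last = Option.some (c₁ p.idx))) :=
    optionEq hk' Comp.id.tail.tail.head (some h₁).inElem
  have hfirst : PComp (fun p : ListElem fun i => (S i).pieces => m p.idx)
      (fun p => .cons (inp p.idx) (p.elem.encode (sym _)))
      (fun p => ofBool (p.elem.first = Option.some (c₂ p.idx))) :=
    optionEq hk' Comp.id.tail.head (some h₂).inElem
  have hA := Comp.filter
    (b := fun i r => decide (r.last = Option.some (c₁ i) ∧ r.first ≠ Option.some (c₂ i))) hL hlen
    ((hlast.and hfirst.not).of_eq fun p => by simp)
  have hB := Comp.filter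
    (b := fun i r => decide (r.first = Option.some (c₂ i) ∧ r.last ≠ Option.some (c₁ i))) hL hlen
    ((hfirst.and hlast.not).of_eq fun p => by simp)
  have hR := Comp.filter
    (b := fun i r => decide (r.last ≠ Option.some (c₁ i) ∧ r.first ≠ Option.some (c₂ i))) hL hlen
    ((hlast.not.and hfirst.not).of_eq fun p => by simp)
  refine Comp.flatMap hA (hlen.mono fun i => List.length_filter_le _ _) ?_
    ((hlen.pull ListElem.idx).mono fun p => by
      rw [List.length_map]
      exact List.length_filter_le _ _)
  simp only [List.map_map]
  have hR' := hR.inElem (ls := fun i => (S i).pieces.filter fun r => r.last = Option.some (c₁ i) ∧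
    r.first ≠ Option.some (c₂ i)) (y := fun p => p.elem.encode (sym p.idx))
  have hU' := hU.inElem (ls := fun i => (S i).pieces.filter fun r => r.last = Option.some (c₁ i) ∧
    r.first ≠ Option.some (c₂ i)) (y := fun p => p.elem.encode (sym p.idx))
  refine Comp.map hB.inElem ((hlen.pull ListElem.idx).mono fun p => List.length_filter_le _ _) ?_
  refine Comp.cons (Comp.cons (Comp.cons Comp.id.head.tail.head (Comp.cons Comp.id.tail.tail.head
    (Comp.append Comp.id.head.tail.tail.tail Comp.id.tail.tail.tail
      ((Bdd.const 1).mono fun p => ?_)))) hR'.inElem) hU'.inElem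
  -- Concatenation costs the length of its left operand, which is at most one symbol in a small
  -- state.
  exact (hS _).word _ (List.mem_of_mem_filter p.idx.mem)

theorem forget {c : ∀ i, Fin (k i)} (h : PComp m inp fun i => (S i).encode (sym i))
    (hc : PComp m inp fun i => encodeColor (c i)) (hk : PBdd m k) (hS : ∀ i, (S i).IsSmall) :
    PComp m inp fun i => ((S i).forget (c i)).encode (sym i) := by
  have hL : PComp m inp fun i => .ofList ((S i).pieces.map (Piece.encode (sym i))) := h.head
  have hU : PComp m inp fun i => .ofList ((S i).used.map encodeColor) := h.tail
  have hforget : ∀ {o : ∀ p : ListElem fun i => (S i).pieces, Option (Fin (k p.idx))},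
      PComp (fun p => m p.idx) (fun p => .cons (inp p.idx) (p.elem.encode (sym _)))
        (fun p => encodeOption (o p)) →
      PComp (fun p => m p.idx) (fun p => .cons (inp p.idx) (p.elem.encode (sym _)))
        (fun p => encodeOption (AbsState.forgetColor (c p.idx) (o p))) := fun ho =>
    ((optionEq (o' := fun p : ListElem fun i => (S i).pieces => Option.some (c p.idx)) (hk.pull _) ho (some hc).inElem).bcond
        Comp.zero ho).of_eq fun p => by
      simp only [AbsState.forgetColor, decide_eq_true_eq]
      split_ifs <;> rfl
  refine Comp.cons ?_ (Comp.filter (b := fun i x => decide (x ≠ c i)) hU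
    (hk.mono fun i => (hS i).used)
    ((colorEq (hk.pull ListElem.idx) Comp.id.tail hc.inElem).not.of_eq fun p => by simp))
  simp only [AbsState.forget, List.map_map]
  exact Comp.map hL (hk.mono fun i => (hS i).pieces)
    (Comp.cons (hforget Comp.id.tail.head) (Comp.cons (hforget Comp.id.tail.tail.head)
      Comp.id.tail.tail.tail))

variable {T Γ : ι → Type} {nT : ∀ i, T i ↪ Data} {nΓ : ∀ i, Γ i ↪ Data}
  {op : ∀ i, UnaryOp (Fin (k i)) (T i) (Γ i)} {ℓ : ∀ i, Option (T i) → List (Z i)}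

/-- Case distinction on a unary operation. -/
theorem opCases {out : ι → Data} (hop : PComp m inp fun i => (op i).encode (nT i) (nΓ i))
    (h₀ : PComp (fun p : {p : Σ i, Fin (k i) × Option (T i) // op p.1 = .node p.2.1 p.2.2} => m p.1.1)
      (fun p => inp p.1.1) (fun p => out p.1.1))
    (h₁ : PComp (fun p : {p : Σ i, Fin (k i) × Fin (k i) // op p.1 = .addSucc p.2.1 p.2.2} =>
      m p.1.1) (fun p => inp p.1.1) (fun p => out p.1.1))
    (h₂ : PComp (fun p : {i // ∃ γ c₁ c₂, op i = .addEdge γ c₁ c₂} => m p.1)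
      (fun p => inp p.1) (fun p => out p.1))
    (h₃ : PComp (fun p : {p : Σ i, Fin (k i) // op p.1 = .forget p.2} => m p.1.1)
      (fun p => inp p.1.1) (fun p => out p.1.1)) :
    PComp m inp out := by
  set d : ι → Data := fun i => ((op i).encode (nT i) (nΓ i)).head with hd
  have hdC : PComp m inp d := hop.head
  have tag (i : ι) : d i = match op i with
      | .node _ _ => .num 0
      | .addSucc _ _ => .num 1
      | .addEdge _ _ _ => .num 2
      | .forget _ => .num 3 := by
    simp only [hd]
    cases op i <;> rfl
  clear_value d
  simp only [Data.num, List.replicate, Data.ofList] at tag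
  -- The tag is one of the numerals 0 to 3, so testing it and its first two tails for `nil`
  -- separates the four operations.
  refine hdC.ite ((hdC.tail.pull _).ite ((hdC.tail.tail.pull _).ite ?_ ?_) ?_) ?_
  · have (i : ι) (h : d i ≠ .nil)
        (h' : (d i).tail ≠ .nil)
        (h'' : (d i).tail.tail ≠ .nil) : ∃ c, op i = .forget c := by
      rw [tag] at h h' h''
      cases hi : op i <;> simp [hi, Data.tail] at h h' h'' ⊢
    choose c hc using this
    exact h₃.pull fun i : {x : {x : {i // d i ≠ .nil} // (d x).tail ≠ .nil} // (d x).tail.tail ≠ .nil} =>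
      ⟨⟨i.1.1.1, c _ i.1.1.2 i.1.2 i.2⟩, hc _ _ _ _⟩
  · have (i : ι) (h : d i ≠ .nil)
        (h' : (d i).tail ≠ .nil)
        (h'' : (d i).tail.tail = .nil) :
        ∃ γ c₁ c₂, op i = .addEdge γ c₁ c₂ := by
      rw [tag] at h h' h''
      cases hi : op i <;> simp [hi, Data.tail] at h h' h'' ⊢
    exact h₂.pull fun i : {x : {x : {i // d i ≠ .nil} // (d x).tail ≠ .nil} // (d x).tail.tail = .nil} =>
      ⟨i.1.1.1, this _ i.1.1.2 i.1.2 i.2⟩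
  · have (i : ι) (h : d i ≠ .nil)
        (h' : (d i).tail = .nil) :
        ∃ c₁ c₂, op i = .addSucc c₁ c₂ := by
      rw [tag] at h h'
      cases hi : op i <;> simp [hi, Data.tail] at h h' ⊢
    choose c₁ c₂ hc using this
    exact h₁.pull fun i : {x : {i // d i ≠ .nil} // (d x).tail = .nil} =>
      ⟨⟨i.1.1, c₁ _ i.1.2 i.2, c₂ _ i.1.2 i.2⟩, hc _ _ _⟩
  · have (i : ι) (h : d i = .nil) :
        ∃ c a, op i = .node c a := by
      rw [tag] at h
      cases hi : op i <;> simp [hi] at h ⊢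
    choose c a hc using this
    exact h₀.pull fun i : {i // d i = .nil} => ⟨⟨i.1, c _ i.2, a _ i.2⟩, hc _ _⟩

theorem unary (h : PComp m inp fun i => (S i).encode (sym i))
    (hop : PComp m inp fun i => (op i).encode (nT i) (nΓ i))
    (hℓ : ∀ i a, (ℓ i a).map (sym i) = (a.toList.map (nT i)).map fun d => .ofList [.num 0, d])
    (hk : PBdd m k) (hS : ∀ i, (S i).IsSmall) :
    PComp m inp fun i => .ofList (((S i).unary (ℓ i) (op i)).map (AbsState.encode (sym i))) := by
  refine opCases hop ?_ ?_ ?_ ?_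
  · have hop' := (hop.pull fun p : {p : Σ i, Fin (k i) × Option (T i) //
      op p.1 = .node p.2.1 p.2.2} => p.1.1).of_eq fun p => congrArg _ p.2
    have hc : PComp (fun p : {p : Σ i, Fin (k i) × Option (T i) // op p.1 = .node p.2.1 p.2.2} =>
      m p.1.1) (fun p => inp p.1.1) (fun p => encodeColor p.1.2.1) := hop'.tail.head
    have ha : PComp (fun p : {p : Σ i, Fin (k i) × Option (T i) // op p.1 = .node p.2.1 p.2.2} =>
      m p.1.1) (fun p => inp p.1.1) (fun p => .ofList (p.1.2.2.toList.map (nT p.1.1))) :=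
      hop'.tail.tail.head
    have hw : PComp (fun p : {p : Σ i, Fin (k i) × Option (T i) // op p.1 = .node p.2.1 p.2.2} =>
        m p.1.1) (fun p => inp p.1.1)
        (fun p => .ofList ((ℓ p.1.1 p.1.2.2).map (sym p.1.1))) := by
      simp only [hℓ, List.map_map]
      refine Comp.map ha ((Bdd.const 1).mono fun p => by cases p.1.2.2 <;> simp)
        (Comp.cons Comp.zero (Comp.cons Comp.id.tail Comp.nil))
    have hU : PComp m inp fun i => .ofList ((S i).used.map encodeColor) := h.tail
    have hsingle : PComp (fun p : {p : Σ i, Fin (k i) × Option (T i) //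
        op p.1 = .node p.2.1 p.2.2} => m p.1.1) (fun p => inp p.1.1)
        (fun p => (AbsState.single p.1.2.1 (ℓ p.1.1 p.1.2.2)).encode (sym p.1.1)) :=
      (Comp.singleton ((some hc).cons ((some hc).cons hw))).cons hc.singleton
    refine (Comp.bcond (memColor (hk.pull _) hc (hU.pull _)
      ((hk.mono fun i => (hS i).used).pull _)) Comp.nil (Comp.singleton (append (h.pull _) hsingle
        (hk.pull _) fun p => hS p.1.1))).of_eq fun p => ?_
    simp only [p.2, AbsState.unary, decide_eq_true_eq]
    split_ifs <;> rfl
  · have hop' := (hop.pull fun p : {p : Σ i, Fin (k i) × Fin (k i) //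
      op p.1 = .addSucc p.2.1 p.2.2} => p.1.1).of_eq fun p => congrArg _ p.2
    refine (addSucc (c₁ := fun p => p.1.2.1) (c₂ := fun p => p.1.2.2) (h.pull _) hop'.tail.head
      hop'.tail.tail.head (hk.pull _) fun p => hS p.1.1).of_eq fun p => ?_
    simp only [p.2, AbsState.unary]
  · refine (h.pull _).singleton.of_eq fun p => ?_
    obtain ⟨γ, c₁, c₂, hp⟩ := p.2
    rw [hp]
    rfl
  · have hop' := (hop.pull fun p : {p : Σ i, Fin (k i) // op p.1 = .forget p.2} =>
      p.1.1).of_eq fun p => congrArg _ p.2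
    refine (forget (c := fun p => p.1.2) (h.pull _) hop'.tail.head (hk.pull _)
      fun p => hS p.1.1).singleton.of_eq fun p => ?_
    rw [p.2]
    rfl

end PComp

namespace LoGrammar

/-! ### Names -/

def varName (k : ℕ) : Var k ↪ Data where
  toFun x := .cons (ofBool x.1) (encodeColor x.2)
  inj' x y h := by
    injection h with h₁ h₂
    refine Prod.ext ?_ (encodeColor_injective h₂)
    cases hx : x.1 <;> cases hy : y.1 <;> simp [hx, hy, ofBool] at h₁ ⊢

def nonterminalName {k : ℕ} {Q : Type} (nQ : Q ↪ Data) : Nonterminal k Q ↪ Data where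
  toFun
    | none => .nil
    | some (q, σ) => .cons (nQ q) (encodeShape σ.1)
  inj' := by
    rintro (_ | ⟨q, σ⟩) (_ | ⟨q', σ'⟩) h
    · rfl
    · cases h
    · cases h
    · injection h with h₁ h₂
      rw [nQ.injective h₁, Subtype.ext (encodeShape_injective h₂)]

def encodeSymbol {k : ℕ} {T : Type} (nT : T ↪ Data) : T ⊕ Var k → Data :=
  Sum.elim (fun a => .ofList [.num 0, nT a]) fun x => .ofList [.num 1, varName k x]

def encodeBody {k : ℕ} {Q : Type} (nQ : Q ↪ Data) (b : Nonterminal k Q × List (Var k)) : Data :=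
  .ofList [nonterminalName nQ b.1, .ofList (b.2.map (varName k))]

theorem encode_rule {k : ℕ} {T Q : Type} (nT : T ↪ Data) (nQ : Q ↪ Data)
    (r : MCFGRule T (Nonterminal k Q) (Var k)) :
    r.encode nT (nonterminalName nQ) (varName k) = .ofList [nonterminalName nQ r.head,
      .ofList (r.args.map fun w => .ofList (w.map (encodeSymbol nT))),
      .ofList (r.body.map (encodeBody nQ))] := rfl

section

variable {k : ℕ} [NeZero k] {T Q Γ : Type}

theorem isSmall_symState (b : Bool) (σ : Shape k) : (symState (T := T) b σ).IsSmall where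
  pieces := by simpa [symState] using σ.2.1
  used := σ.2.2
  word r hr := length_le_one_symState b σ r.word (List.mem_map_of_mem hr)

omit [NeZero k] in
theorem length_rulesOf_le (q : Q) (body : List (Nonterminal k Q × List (Var k)))
    (Ss : List (AbsState (Fin k) (T ⊕ Var k))) : (rulesOf q body Ss).length ≤ Ss.length := by
  refine (List.length_flatMap_le (b := 1) fun S _ => ?_).trans (Nat.mul_one _).le
  split_ifs <;> simp

theorem length_startRules_le (q : Q) (σ : Shape k) :
    (startRules (T := T) q σ).length ≤ 1 := by
  unfold startRules
  split_ifs <;> simp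

theorem length_joinRules_le (q₁ q₂ q : Q) (σ₁ σ₂ : Shape k) :
    (joinRules (T := T) q₁ q₂ q σ₁ σ₂).length ≤ 1 :=
  (length_rulesOf_le _ _ _).trans (AbsState.length_join_le _ _)

theorem length_unaryRules_le (op : UnaryOp (Fin k) T Γ) (q q' : Q) (σ : Shape k) :
    (unaryRules op q q' σ).length ≤ k * k + 1 := by
  refine (length_rulesOf_le _ _ _).trans ((AbsState.length_unary_le _ _).trans ?_)
  have := (isSmall_symState (T := T) false σ).pieces
  gcongr

end

end LoGrammar

namespace PComp

open LoGrammar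

variable {ι : Type*} {m : ι → ℕ} {inp : ι → Data} {k : ι → ℕ}

/-! ### Computing rules -/

theorem tuple {Z : ι → Type} {sym : ∀ i, Z i → Data} {S : ∀ i, AbsState (Fin (k i)) (Z i)}
    (h : PComp m inp fun i => (S i).encode (sym i)) (hkC : PComp m inp fun i => .num (k i))
    (hk : PBdd m k) (hlen : PBdd m fun i => (S i).pieces.length) :
    PComp m inp fun i =>
      .ofList ((LoGrammar.tuple (k i) (S i)).map fun w => .ofList (w.map (sym i))) := by
  have hL : PComp m inp fun i => .ofList ((S i).pieces.map (Piece.encode (sym i))) := h.head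
  have hW : PComp m inp fun i => .ofList ((S i).pieces.map fun r => .ofList (r.word.map (sym i))) :=
    Comp.map hL hlen Comp.id.tail.tail.tail
  refine ((Comp.sub hkC (Comp.length hL hlen) hlen).natRec (fun i j => .ofList
    (List.replicate j .nil ++ (S i).pieces.map fun r => .ofList (r.word.map (sym i))))
    (hk.mono fun i => Nat.sub_le _ _) hW (Comp.nil.cons Comp.id.tail)).of_eq fun i => ?_
  simp [LoGrammar.tuple, List.leftpad, AbsState.words, Function.comp_def, Data.ofList]

variable {T Q Γ : ι → Type} {nT : ∀ i, T i ↪ Data} {nQ : ∀ i, Q i ↪ Data} {nΓ : ∀ i, Γ i ↪ Data}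

/-- States may exceed `k` pieces or colours before the size test discards them; `2 * k + 1` covers
both a join (twice `k`) and a new vertex (one more than `k`). -/
theorem rulesOf {q : ∀ i, Q i} {body : ∀ i, List (Nonterminal (k i) (Q i) × List (Var (k i)))}
    {Ss : ∀ i, List (AbsState (Fin (k i)) (T i ⊕ Var (k i)))}
    (hq : PComp m inp fun i => nQ i (q i))
    (hbody : PComp m inp fun i => .ofList ((body i).map (encodeBody (nQ i))))
    (hSs : PComp m inp fun i => .ofList ((Ss i).map (AbsState.encode (encodeSymbol (nT i)))))
    (hkC : PComp m inp fun i => .num (k i)) (hk : PBdd m k) (hlen : PBdd m fun i => (Ss i).length)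
    (hsize : ∀ i, ∀ S ∈ Ss i, S.pieces.length ≤ 2 * k i + 1 ∧ S.used.length ≤ 2 * k i + 1) :
    PComp m inp fun i => .ofList ((LoGrammar.rulesOf (q i) (body i) (Ss i)).map
      (MCFGRule.encode (nT i) (nonterminalName (nQ i)) (varName (k i)))) := by
  refine Comp.flatMap hSs hlen ?_ ((Bdd.const 1).mono fun p => by split_ifs <;> simp)
  have hk' := hk.pull (ListElem.idx (ls := Ss))
  have hb : PBdd (fun p : ListElem Ss => m p.idx) fun p => 2 * k p.idx + 1 :=
    ((Bdd.const 2).mul hk').add (.const 1)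
  have hP : PBdd (fun p : ListElem Ss => m p.idx) fun p => p.elem.pieces.length :=
    hb.mono fun p => (hsize _ _ p.mem).1
  have hU : PBdd (fun p : ListElem Ss => m p.idx) fun p => p.elem.used.length :=
    hb.mono fun p => (hsize _ _ p.mem).2
  have hS : PComp (fun p : ListElem Ss => m p.idx)
      (fun p => .cons (inp p.idx) (p.elem.encode (encodeSymbol (nT p.idx))))
      (fun p => p.elem.encode (encodeSymbol (nT p.idx))) := Comp.id.tail
  have hSP : PComp (fun p : ListElem Ss => m p.idx)
      (fun p => .cons (inp p.idx) (p.elem.encode (encodeSymbol (nT p.idx))))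
      (fun p => .ofList (p.elem.pieces.map (Piece.encode (encodeSymbol (nT p.idx))))) := hS.head
  have hSU : PComp (fun p : ListElem Ss => m p.idx)
      (fun p => .cons (inp p.idx) (p.elem.encode (encodeSymbol (nT p.idx))))
      (fun p => .ofList (p.elem.used.map encodeColor)) := hS.tail
  have hcond := (Comp.le (Comp.length hSP hP) hkC.inElem hk').and
    (Comp.le (Comp.length hSU hU) hkC.inElem hk')
  have hshape := Comp.cons (Comp.map hSP hP
    (g := fun p r => encodePair (r.first, r.last)) (Comp.id.tail.head.cons Comp.id.tail.tail.head))
    hSU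
  refine (hcond.bcond (Comp.singleton (Comp.cons (Comp.cons hq.inElem hshape) (Comp.cons
    (tuple hS hkC.inElem hk' hP) (Comp.cons hbody.inElem Comp.nil)))) Comp.nil).of_eq fun p => ?_
  by_cases h : p.elem.shape.1.length ≤ k p.idx ∧ p.elem.shape.2.length ≤ k p.idx
  · rw [dif_pos h, if_pos (by simpa [AbsState.shape] using h), List.map_singleton, encode_rule]
    simp [nonterminalName, encodeShape, AbsState.shape, Data.ofList, Function.comp_def]
  · rw [dif_neg h, if_neg (by simpa [AbsState.shape] using h)]
    rfl

/-! ### Computing lists of shapes -/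

theorem colors (hkC : PComp m inp fun i => .num (k i)) (hk : PBdd m k) :
    PComp m inp fun i => .ofList ((LoGrammar.colors (k i)).map encodeColor) := by
  refine (Comp.range hkC hk).of_eq fun i => ?_
  rw [LoGrammar.colors, List.map_reverse, List.map_reverse, ← List.map_coe_finRange_eq_range,
    List.map_map]
  rfl

theorem options (hkC : PComp m inp fun i => .num (k i)) (hk : PBdd m k) :
    PComp m inp fun i => .ofList ((LoGrammar.options (k i)).map encodeOption) := by
  refine Comp.cons Comp.zero ?_
  simp only [List.map_map]
  exact Comp.map (colors hkC hk) (by simpa [LoGrammar.colors] using hk) (some Comp.id.tail)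

theorem optionPairs (hkC : PComp m inp fun i => .num (k i)) (hk : PBdd m k) :
    PComp m inp fun i => .ofList ((LoGrammar.optionPairs (k i)).map encodePair) := by
  have hlen : PBdd m fun i => (LoGrammar.options (k i)).length := by
    simpa [LoGrammar.options, LoGrammar.colors] using hk.add (.const 1)
  have h := options hkC hk
  refine Comp.flatMap h hlen ?_ (by simpa using hlen.pull ListElem.idx)
  simp only [List.map_map]
  exact Comp.map h.inElem (hlen.pull ListElem.idx) (Comp.id.head.tail.cons Comp.id.tail)

/-- With `(k + 2) ^ k` as the parameter, polynomials in `k` come for free. -/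
theorem bdd_of_pow (hpow : PBdd m fun i => (k i + 2) ^ k i) : PBdd m k :=
  hpow.mono fun i => ((Nat.lt_pow_self (by omega)).le.trans
    (Nat.pow_le_pow_left (show k i + 1 + 1 ≤ k i + 2 by omega) _))

theorem length_optionPairs (k : ℕ) : (LoGrammar.optionPairs k).length = (k + 1) * (k + 1) := by
  simp [LoGrammar.optionPairs, LoGrammar.options, LoGrammar.colors, Function.comp_def]
  ring

theorem bdd_boundedLists_optionPairs (hpow : PBdd m fun i => (k i + 2) ^ k i) :
    PBdd m fun i => ((LoGrammar.optionPairs (k i)).length + 1) ^ k i :=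
  (hpow.mul hpow).mono fun i => by
    -- There are `(k + 1) ^ 2` pairs and `(k + 1) ^ 2 + 1 ≤ (k + 2) ^ 2`, so two powers of the
    -- parameter suffice.
    rw [← Nat.mul_pow, length_optionPairs]
    exact Nat.pow_le_pow_left (by nlinarith) _

theorem bdd_boundedLists_colors (hpow : PBdd m fun i => (k i + 2) ^ k i) :
    PBdd m fun i => ((LoGrammar.colors (k i)).length + 1) ^ k i :=
  hpow.mono fun i => Nat.pow_le_pow_left (by simp [LoGrammar.colors]) _

theorem bdd_length_shapes (hpow : PBdd m fun i => (k i + 2) ^ k i) :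
    PBdd m fun i => (LoGrammar.shapes (k i)).length :=
  ((bdd_boundedLists_optionPairs hpow).mul (bdd_boundedLists_colors hpow)).mono fun i => by
    rw [← List.length_map Subtype.val, LoGrammar.shapes_map_val]
    refine (List.length_flatMap_le fun _ _ => ?_).trans
      (Nat.mul_le_mul_right _ (length_boundedLists_le _ _))
    rw [List.length_map]
    exact length_boundedLists_le _ _

theorem shapes (hkC : PComp m inp fun i => .num (k i)) (hpow : PBdd m fun i => (k i + 2) ^ k i) :
    PComp m inp fun i =>
      .ofList ((LoGrammar.shapes (k i)).map fun σ => encodeShape σ.1) := by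
  have hk := bdd_of_pow hpow
  have hP := bdd_boundedLists_optionPairs hpow
  have hC := bdd_boundedLists_colors hpow
  have h₁ := Comp.boundedLists hkC (optionPairs hkC hk) hk
    (by simpa [length_optionPairs] using (hk.add (.const 1)).mul (hk.add (.const 1))) hP
  have h₂ := Comp.boundedLists hkC (colors hkC hk) hk (by simpa [LoGrammar.colors] using hk) hC
  have hC' : PBdd m fun i => (boundedLists (LoGrammar.colors (k i)) (k i)).length :=
    hC.mono fun i => length_boundedLists_le _ _
  refine (Comp.flatMap (g := fun i l => (boundedLists (LoGrammar.colors (k i)) (k i)).map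
    fun u => (l, u)) (e' := fun _ => encodeShape) h₁ (hP.mono fun i => length_boundedLists_le _ _)
    ?_ (by simpa using hC'.pull ListElem.idx)).of_eq fun i => ?_
  · simp only [List.map_map]
    exact Comp.map h₂.inElem (hC'.pull ListElem.idx) (Comp.id.head.tail.cons Comp.id.tail)
  · rw [← LoGrammar.shapeList, ← LoGrammar.shapes_map_val, List.map_map]
    rfl

/-! ### Computing rules with given shapes -/

variable [∀ i, NeZero (k i)] {σ σ₁ σ₂ : ∀ i, Shape (k i)} {q q' q₁ q₂ : ∀ i, Q i}

theorem bool (b : Bool) : PComp m inp fun _ => ofBool b := by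
  cases b
  · exact Comp.ofFalse
  · exact Comp.ofTrue

theorem varList (hkC : PComp m inp fun i => .num (k i)) (hk : PBdd m k) (b : Bool) :
    PComp m inp fun i =>
      .ofList ((LoGrammar.varList (k i) b (k i)).map (varName (k i))) := by
  simp only [LoGrammar.varList, List.map_map]
  refine Comp.map (Comp.range hkC hk) (by simpa using hk) (Comp.of_eq
    ((bool b).cons Comp.id.tail) fun p => ?_)
  have : p.elem < k p.idx := by simpa using p.mem
  simp [varName, encodeColor, Nat.mod_eq_of_lt this, Data.tail]

/-- The number of a variable is the length of the list already built, so no separate counter is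
carried through the recursion. -/
theorem symState (hσ : PComp m inp fun i => encodeShape (σ i).1) (hk : PBdd m k) (b : Bool) :
    PComp m inp fun i =>
      (LoGrammar.symState b (σ i)).encode (encodeSymbol (nT i)) := by
  have hL : PComp m inp fun i => .ofList ((σ i).1.1.map encodePair) := hσ.head
  refine Comp.cons (hL.foldr (fun i l => .ofList ((symPieces (T := T i) b l).map
    (Piece.encode (encodeSymbol (nT i))))) (hk.mono fun i => (σ i).2.1) Comp.nil ?_) hσ.tail
  have hlt (p : ListSuffix fun i => (σ i).1.1) : p.tl.length < k p.idx :=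
    (Nat.lt_of_succ_le p.suffix.length_le).trans_le (σ p.idx).2.1
  have hlen := Comp.length (n := fun _ => 0)
    (inp := fun p : ListSuffix fun i => (σ i).1.1 => .cons (inp p.idx) (.cons (encodePair p.hd)
      (.ofList ((symPieces (T := T p.idx) b p.tl).map (Piece.encode (encodeSymbol (nT p.idx)))))))
    Comp.id.tail.tail ((hk.pull ListSuffix.idx).mono fun p => by
      rw [length_symPieces]
      exact (hlt p).le)
  refine Comp.of_eq (Comp.cons (Comp.cons Comp.id.tail.head.head (Comp.cons Comp.id.tail.head.tail
    (Comp.singleton (Comp.cons Comp.zero.succ (Comp.singleton ((bool b).cons hlen))))))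
    Comp.id.tail.tail) fun p => ?_
  rw [symPieces_cons]
  simp [Piece.encode, encodeSymbol, varName, encodeColor, Nat.mod_eq_of_lt (hlt p), Data.ofList,
    Data.head, Data.tail, encodePair]

theorem bodyAtom (hq : PComp m inp fun i => nQ i (q i))
    (hσ : PComp m inp fun i => encodeShape (σ i).1) (hkC : PComp m inp fun i => .num (k i))
    (hk : PBdd m k) (b : Bool) :
    PComp m inp fun i => encodeBody (nQ i)
      (Option.some (q i, σ i), LoGrammar.varList (k i) b (k i)) :=
  Comp.cons (hq.cons hσ) (Comp.singleton (varList hkC hk b))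

theorem unaryRules {op : ∀ i, UnaryOp (Fin (k i)) (T i) (Γ i)}
    (hop : PComp m inp fun i => (op i).encode (nT i) (nΓ i))
    (hq : PComp m inp fun i => nQ i (q i)) (hq' : PComp m inp fun i => nQ i (q' i))
    (hσ : PComp m inp fun i => encodeShape (σ i).1) (hkC : PComp m inp fun i => .num (k i))
    (hk : PBdd m k) :
    PComp m inp fun i => .ofList ((LoGrammar.unaryRules (op i) (q i) (q' i) (σ i)).map
      (MCFGRule.encode (nT i) (nonterminalName (nQ i)) (varName (k i)))) := by
  refine rulesOf hq' (bodyAtom hq hσ hkC hk false).singleton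
    (unary (symState hσ hk false) hop (fun i a => ?_) hk fun i => isSmall_symState _ _) hkC hk
    (((hk.mul hk).add (.const 1)).mono fun i => ?_) fun i S hS => ?_
  · cases a <;> simp [symLabel, encodeSymbol]
  · refine (AbsState.length_unary_le _ _).trans ?_
    have := (isSmall_symState (T := T i) false (σ i)).pieces
    gcongr
  · have h₁ := AbsState.length_of_mem_unary hS
    have h₂ := isSmall_symState (T := T i) false (σ i)
    have := h₂.pieces
    have := h₂.used
    omega

theorem joinRules (hq₁ : PComp m inp fun i => nQ i (q₁ i)) (hq₂ : PComp m inp fun i => nQ i (q₂ i))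
    (hq : PComp m inp fun i => nQ i (q i))
    (hσ₁ : PComp m inp fun i => encodeShape (σ₁ i).1)
    (hσ₂ : PComp m inp fun i => encodeShape (σ₂ i).1) (hkC : PComp m inp fun i => .num (k i))
    (hk : PBdd m k) :
    PComp m inp fun i => .ofList ((LoGrammar.joinRules (q₁ i) (q₂ i) (q i) (σ₁ i) (σ₂ i)).map
      (MCFGRule.encode (nT i) (nonterminalName (nQ i)) (varName (k i)))) := by
  refine rulesOf hq ((bodyAtom hq₁ hσ₁ hkC hk false).cons (bodyAtom hq₂ hσ₂ hkC hk true).singleton)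
    (join (symState hσ₁ hk false) (symState hσ₂ hk true) hk (fun i => isSmall_symState _ _)
      fun i => isSmall_symState _ _) hkC hk
    ((Bdd.const 1).mono fun i => AbsState.length_join_le _ _) fun i S hS => ?_
  have h₁ := isSmall_symState (T := T i) false (σ₁ i)
  have h₂ := isSmall_symState (T := T i) true (σ₂ i)
  have := h₁.pieces
  have := h₁.used
  have := h₂.pieces
  have := h₂.used
  simp only [AbsState.join] at hS
  split_ifs at hS
  · obtain rfl := List.mem_singleton.mp hS
    simp only [AbsState.append, List.length_append]
    omega
  · simp at hS

theorem startRules (hq : PComp m inp fun i => nQ i (q i))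
    (hσ : PComp m inp fun i => encodeShape (σ i).1) (hkC : PComp m inp fun i => .num (k i))
    (hk : PBdd m k) :
    PComp m inp fun i => .ofList ((LoGrammar.startRules (T := T i) (q i) (σ i)).map
      (MCFGRule.encode (nT i) (nonterminalName (nQ i)) (varName (k i)))) := by
  have hL : PComp m inp fun i => .ofList ((σ i).1.1.map encodePair) := hσ.head
  have hvar : PComp m inp fun _ : ι => .ofList [.num 1, .cons (ofBool Bool.false) (.num 0)] :=
    Comp.cons Comp.zero.succ (Comp.singleton (Comp.cons (bool _) Comp.zero))
  refine ((Comp.le (Comp.length hL (hk.mono fun i => (σ i).2.1)) Comp.zero.succ (.const 1)).bcond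
    (Comp.singleton (Comp.cons Comp.nil (Comp.cons hvar.singleton.singleton
      (bodyAtom hq hσ hkC hk Bool.false).singleton.singleton))) Comp.nil).of_eq fun i => ?_
  simp only [LoGrammar.startRules, decide_eq_true_eq, Nat.zero_add]
  split_ifs
  · rw [List.map_singleton, encode_rule]
    simp [encodeSymbol, varName, encodeColor, Data.ofList]
    rfl
  · rfl

end PComp

namespace LoGrammar

section

variable {k : ℕ} [NeZero k] {T Γ Q : Type}

/-! ### Lists of nonterminals and variables -/

omit [NeZero k] in
def nonterminals (k : ℕ) (states : List Q) : List (Nonterminal k Q) :=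
  none :: states.flatMap fun q => (shapes k).map fun σ => some (q, σ)

def allVars (k : ℕ) [NeZero k] : List (Var k) := varList k false k ++ varList k true k

omit [NeZero k] in
theorem mem_nonterminals {states : List Q} (h : ∀ q, q ∈ states) (A : Nonterminal k Q) :
    A ∈ nonterminals k states := by
  rcases A with _ | ⟨q, σ⟩
  · exact List.mem_cons_self
  · exact List.mem_cons_of_mem _ (List.mem_flatMap.mpr
      ⟨q, h q, List.mem_map.mpr ⟨σ, mem_shapes σ, rfl⟩⟩)

omit [NeZero k] in
theorem nodup_nonterminals {states : List Q} (h : states.Nodup) :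
    (nonterminals k states).Nodup := by
  have := (nodup_flatMap_map_prod h (nodup_shapes k)).map (Option.some_injective _)
  rw [List.map_flatMap] at this
  simp only [List.map_map] at this
  exact List.nodup_cons.mpr ⟨by simp, this⟩

theorem mem_allVars (x : Var k) : x ∈ allVars k := by
  have (b : Bool) (c : Fin k) : (b, c) ∈ varList k b k :=
    List.mem_map.mpr ⟨c, by simp, by simp⟩
  obtain ⟨b, c⟩ := x
  cases b
  · exact List.mem_append_left _ (this _ _)
  · exact List.mem_append_right _ (this _ _)

theorem nodup_allVars : (allVars k).Nodup :=
  (nodup_varList false le_rfl).append (nodup_varList true le_rfl) fun _ h₁ h₂ =>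
    absurd ((mem_varList h₁).symm.trans (mem_varList h₂)) (by simp)

/-! ### The size of the grammar -/

-- The bound is `1 + 3k + 2(1 + k)`: at most `k` components with at most two symbols each, and at
-- most two members of the right-hand side with at most `k` variables each.
omit [NeZero k] in
theorem IsValid.size_le [NeZero k] {r : MCFGRule T (Nonterminal k Q) (Var k)} (h : IsValid r) :
    r.size ≤ 5 * k + 3 := by
  have harity (A : Nonterminal k Q) : arity k A ≤ k := by
    cases A
    · exact NeZero.one_le
    · exact le_rfl
  have h₁ := List.sum_le_card_nsmul (r.args.map fun s => 1 + s.length) 3 (by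
    simp only [List.mem_map, forall_exists_index, and_imp, forall_apply_eq_imp_iff₂]
    intro w hw
    have := h.words w hw
    omega)
  have h₂ := List.sum_le_card_nsmul (r.body.map fun b => 1 + b.2.length) (1 + k) (by
    simp only [List.mem_map, forall_exists_index, and_imp, forall_apply_eq_imp_iff₂]
    intro b hb
    have := h.body_length b hb
    have := harity b.1
    omega)
  have h₃ := harity r.head
  have h₄ := Nat.mul_le_mul_right (1 + k) h.rank
  rw [List.length_map, smul_eq_mul] at h₁ h₂
  rw [h.args_length] at h₁
  rw [MCFGRule.size]
  omega

theorem length_rules_le (q₀ : Q) (acc : List Q) (us : List (UnaryOp (Fin k) T Γ × Q × Q))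
    (js : List (Q × Q × Q)) : (rules q₀ acc us js).length ≤
      1 + (acc.length * ((shapes k).length * 1) +
        (us.length * ((shapes k).length * (k * k + 1)) +
          js.length * ((shapes k).length * ((shapes k).length * 1)))) := by
  simp only [rules, List.length_append]
  gcongr
  · exact length_rulesOf_le _ _ _
  · exact List.length_flatMap_le fun _ _ => List.length_flatMap_le fun _ _ =>
      length_startRules_le _ _
  · exact List.length_flatMap_le fun _ _ => List.length_flatMap_le fun _ _ =>
      length_unaryRules_le _ _ _ _
  · exact List.length_flatMap_le fun _ _ => List.length_flatMap_le fun _ _ =>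
      List.length_flatMap_le fun _ _ => length_joinRules_le _ _ _ _ _

end

/-! ### The construction as a program -/

/-- The components of the representation of a tree automaton. -/
structure Input : Type 1 where
  k : ℕ
  [neZero : NeZero k]
  T : Type
  Γ : Type
  Q : Type
  nT : T ↪ Data
  nΓ : Γ ↪ Data
  nQ : Q ↪ Data
  states : List Q
  bot : Q
  acc : List Q
  us : List (UnaryOp (Fin k) T Γ × Q × Q)
  js : List (Q × Q × Q)

namespace Input

attribute [instance] neZero

def encode (i : Input) : Data :=
  .ofList [.num i.k, .ofList (i.states.map i.nQ), i.nQ i.bot, .ofList (i.acc.map i.nQ),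
    .ofList (i.us.map fun t => .ofList [t.1.encode i.nT i.nΓ, i.nQ t.2.1, i.nQ t.2.2]),
    .ofList (i.js.map fun t => .ofList [i.nQ t.1, i.nQ t.2.1, i.nQ t.2.2])]

def length (i : Input) : ℕ := i.states.length + i.acc.length + i.us.length + i.js.length

/-- A parameter of order `2 ^ O(k log k)`. -/
def param (i : Input) : ℕ := (i.k + 2) ^ i.k

def grammar (i : Input) : MCFG i.T (Nonterminal i.k i.Q) (Var i.k) :=
  LoGrammar.grammar i.bot i.acc i.us i.js

/-- The size of the grammar, if the list of states is complete. -/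
def grammarSize (i : Input) : ℕ :=
  (nonterminals i.k i.states).length + (allVars i.k).length +
    (i.grammar.rules.map MCFGRule.size).sum

def encodeGrammar (i : Input) : Data :=
  .ofList [.ofList ((nonterminals i.k i.states).map fun A =>
      .ofList [nonterminalName i.nQ A, .num (arity i.k A)]),
    .ofList ((allVars i.k).map (varName i.k)),
    .ofList (i.grammar.rules.map (MCFGRule.encode i.nT (nonterminalName i.nQ) (varName i.k))),
    .nil]

theorem bdd_pow : PBdd param fun i => (i.k + 2) ^ i.k := Bdd.param

theorem bdd_k : PBdd param k := PComp.bdd_of_pow bdd_pow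

theorem bdd_shapes : PBdd param fun i => (shapes i.k).length := PComp.bdd_length_shapes bdd_pow

theorem bdd_states : Bdd length param fun i => i.states.length :=
  Bdd.linear.mono fun i => by unfold length; omega

theorem bdd_acc : Bdd length param fun i => i.acc.length :=
  Bdd.linear.mono fun i => by unfold length; omega

theorem bdd_us : Bdd length param fun i => i.us.length :=
  Bdd.linear.mono fun i => by unfold length; omega

theorem bdd_js : Bdd length param fun i => i.js.length :=
  Bdd.linear.mono fun i => by unfold length; omega

/-- Number of rules times the largest size of a rule: only the lists of states and transitions
contribute the linear factor, all numbers of shapes go into the polynomial one. -/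
theorem bdd_grammarSize : Bdd length param grammarSize := by
  have hN : Bdd length param fun i => (nonterminals i.k i.states).length := by
    refine ((bdd_states.mul bdd_shapes).add (.const 1)).mono fun i => ?_
    rw [nonterminals, List.length_cons]
    gcongr
    exact List.length_flatMap_le fun _ _ => (List.length_map _).le
  have hX : Bdd length param fun i => (allVars i.k).length := by
    simpa [allVars] using (bdd_k.add bdd_k).of_zero
  have hr := (((Bdd.const 1).add ((bdd_acc.mul (bdd_shapes.mul (.const 1))).add
    ((bdd_us.mul (bdd_shapes.mul ((bdd_k.mul bdd_k).add (.const 1)))).add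
      (bdd_js.mul (bdd_shapes.mul (bdd_shapes.mul (.const 1))))))).mul
    (((Bdd.const 5).mul bdd_k).add (.const 3)))
  refine ((hN.add hX).add hr).mono fun i => Nat.add_le_add_left ?_ _
  refine (List.sum_le_card_nsmul _ (5 * i.k + 3) ?_).trans ?_
  · simp only [List.mem_map, forall_exists_index, and_imp, forall_apply_eq_imp_iff₂]
    exact fun r hr => (isValid_of_mem_rules hr).size_le
  · rw [List.length_map, smul_eq_mul]
    exact Nat.mul_le_mul_right _ (length_rules_le _ _ _ _)

theorem comp_k : PComp param encode fun i => .num i.k := Comp.id.head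

theorem comp_shapes : PComp param encode fun i =>
    .ofList ((shapes i.k).map fun σ => encodeShape σ.1) :=
  PComp.shapes comp_k bdd_pow

theorem comp_nonterminals : Comp length param encode fun i =>
    .ofList ((nonterminals i.k i.states).map fun A =>
      .ofList [nonterminalName i.nQ A, .num (arity i.k A)]) := by
  refine Comp.cons (Comp.cons Comp.nil (Comp.singleton Comp.zero.succ)) (Comp.flatMap
    (ls := states) (e := fun i => i.nQ) Comp.id.tail.head bdd_states ?_
    (by simpa using bdd_shapes.pull ListElem.idx))
  simp only [List.map_map]
  exact Comp.map comp_shapes.inElem (bdd_shapes.pull ListElem.idx)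
    -- The context of the inner loop is the input paired with a state and then with a shape; two
    -- heads lead back to the input and the third one to the numeral `k`.
    (Comp.cons (Comp.id.head.tail.cons Comp.id.tail) (Comp.singleton Comp.id.head.head.head))

theorem comp_allVars : PComp param encode fun i =>
    .ofList ((allVars i.k).map (varName i.k)) :=
  Comp.append (PComp.varList comp_k bdd_k false) (PComp.varList comp_k bdd_k true)
    (by simpa using bdd_k)

theorem comp_botRules : PComp param encode fun i => .ofList
    ((rulesOf (T := i.T) i.bot [] [.empty]).map
      (MCFGRule.encode i.nT (nonterminalName i.nQ) (varName i.k))) :=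
  PComp.rulesOf Comp.id.tail.tail.head Comp.nil (Comp.singleton (Comp.nil.cons Comp.nil)) comp_k
    bdd_k (Bdd.const 1) fun i S hS => by
      obtain rfl := List.mem_singleton.mp hS
      simp [AbsState.empty]

theorem comp_startRules : Comp length param encode fun i => .ofList
    ((i.acc.flatMap fun q => (shapes i.k).flatMap fun σ => startRules (T := i.T) q σ).map
      (MCFGRule.encode i.nT (nonterminalName i.nQ) (varName i.k))) := by
  refine Comp.flatMap (ls := acc) (e := fun i => i.nQ) Comp.id.tail.tail.tail.head bdd_acc
    (Comp.flatMap comp_shapes.inElem (bdd_shapes.pull ListElem.idx)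
      (PComp.startRules Comp.id.head.tail Comp.id.tail Comp.id.head.head.head
        ((bdd_k.pull ListElem.idx).pull ListElem.idx))
      ((Bdd.const 1).mono fun _ => length_startRules_le _ _)) ?_
  exact ((bdd_shapes.mul (.const 1)).pull ListElem.idx).mono fun _ =>
    List.length_flatMap_le fun _ _ => length_startRules_le _ _

theorem comp_unaryRules : Comp length param encode fun i => .ofList
    ((i.us.flatMap fun t => (shapes i.k).flatMap fun σ => unaryRules t.1 t.2.1 t.2.2 σ).map
      (MCFGRule.encode i.nT (nonterminalName i.nQ) (varName i.k))) := by
  have hb := (bdd_k.mul bdd_k).add (.const 1)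
  refine Comp.flatMap (ls := us)
    (e := fun i t => .ofList [t.1.encode i.nT i.nΓ, i.nQ t.2.1, i.nQ t.2.2])
    Comp.id.tail.tail.tail.tail.head bdd_us
    (Comp.flatMap comp_shapes.inElem (bdd_shapes.pull ListElem.idx)
      (PComp.unaryRules Comp.id.head.tail.head Comp.id.head.tail.tail.head
        Comp.id.head.tail.tail.tail.head Comp.id.tail Comp.id.head.head.head
        ((bdd_k.pull ListElem.idx).pull ListElem.idx))
      (((hb.pull ListElem.idx).pull ListElem.idx).mono fun _ => length_unaryRules_le _ _ _ _)) ?_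
  exact ((bdd_shapes.mul hb).pull ListElem.idx).mono fun _ =>
    List.length_flatMap_le fun _ _ => length_unaryRules_le _ _ _ _

theorem comp_joinRules : Comp length param encode fun i => .ofList
    ((i.js.flatMap fun t => (shapes i.k).flatMap fun σ₁ => (shapes i.k).flatMap fun σ₂ =>
      joinRules (T := i.T) t.1 t.2.1 t.2.2 σ₁ σ₂).map
      (MCFGRule.encode i.nT (nonterminalName i.nQ) (varName i.k))) := by
  have hS₁ := (bdd_shapes.pull (ListElem.idx (ls := js)))
  have hS₂ := hS₁.pull (ListElem.idx (ls := fun p : ListElem js => shapes p.idx.k))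
  have hS := comp_shapes.inElem (y := fun p : ListElem js =>
    .ofList [p.idx.nQ p.elem.1, p.idx.nQ p.elem.2.1, p.idx.nQ p.elem.2.2])
  refine Comp.flatMap (ls := js) (e := fun i t => .ofList [i.nQ t.1, i.nQ t.2.1, i.nQ t.2.2])
    Comp.id.tail.tail.tail.tail.tail.head bdd_js
    (Comp.flatMap hS hS₁ (Comp.flatMap hS.inElem hS₂
        (PComp.joinRules Comp.id.head.head.tail.head Comp.id.head.head.tail.tail.head
          Comp.id.head.head.tail.tail.tail.head Comp.id.head.tail Comp.id.tail
          Comp.id.head.head.head.head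
          (((bdd_k.pull ListElem.idx).pull ListElem.idx).pull ListElem.idx))
        ((Bdd.const 1).mono fun _ => length_joinRules_le _ _ _ _ _))
      ((hS₂.mul (.const 1)).mono fun _ =>
        List.length_flatMap_le fun _ _ => length_joinRules_le _ _ _ _ _)) ?_
  exact (hS₁.mul (hS₁.mul (.const 1))).mono fun _ => List.length_flatMap_le fun _ _ =>
    List.length_flatMap_le fun _ _ => length_joinRules_le _ _ _ _ _

theorem comp_encodeGrammar : Comp length param encode encodeGrammar := by
  have hb := bdd_shapes.mul ((bdd_k.mul bdd_k).add (.const 1))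
  refine comp_nonterminals.cons (comp_allVars.of_zero.cons (Comp.cons ?_
    (Comp.singleton Comp.nil)))
  refine Comp.append comp_botRules.of_zero (Comp.append comp_startRules
    (Comp.append comp_unaryRules comp_joinRules ?_) ?_)
    ((Bdd.const 1).mono fun _ => length_rulesOf_le _ _ _)
  · exact (bdd_us.mul hb).mono fun i => List.length_flatMap_le fun _ _ =>
      List.length_flatMap_le fun _ _ => length_unaryRules_le _ _ _ _
  · exact (bdd_acc.mul (bdd_shapes.mul (.const 1))).mono fun i => List.length_flatMap_le
      fun _ _ => List.length_flatMap_le fun _ _ => length_startRules_le _ _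

end Input

/-! ### Bounds -/

theorem _root_.Set.ncard_eq_length_of_nodup {α : Type*} {s : Set α} {l : List α} (hl : l.Nodup)
    (h : ∀ a, a ∈ l ↔ a ∈ s) : s.ncard = l.length := by
  classical
  rw [← List.toFinset_card_of_nodup hl, ← Set.ncard_coe_finset]
  congr 1
  ext a
  simp [h]

theorem _root_.Nat.card_eq_length_of_nodup {α : Type*} {l : List α} (hl : l.Nodup)
    (h : ∀ a, a ∈ l) : Nat.card α = l.length := by
  rw [← Set.ncard_univ, Set.ncard_eq_length_of_nodup hl (by simpa using h)]

/-- By determinism a transition is known from its arguments, so the lists are as long as the domains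
that `size` counts. There is at least one state, and there are at most as many accepting states as
states; hence three times the number of states covers both lists and the summand 1. -/
theorem length_le_two_mul_size {k : ℕ} {T Γ Q : Type} {A : TreeAutomaton (Fin k) T Γ Q}
    {states acc : List Q} {us : List (UnaryOp (Fin k) T Γ × Q × Q)} {js : List (Q × Q × Q)}
    (hs : states.Nodup) (hs' : ∀ q, q ∈ states) (hacc : acc.Nodup)
    (hus : us.Nodup) (hus' : ∀ op q q', (op, q, q') ∈ us ↔ A.unary op q = some q')
    (hjs : js.Nodup) (hjs' : ∀ q₁ q₂ q, (q₁, q₂, q) ∈ js ↔ A.join q₁ q₂ = some q) :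
    states.length + acc.length + us.length + js.length + 1 ≤ 4 * A.size := by
  have h₁ := Nat.card_eq_length_of_nodup hs hs'
  have h₂ : acc.length ≤ states.length := (hacc.subperm fun q _ => hs' q).length_le
  have h₃ : {p : UnaryOp (Fin k) T Γ × Q | (A.unary p.1 p.2).isSome}.ncard = us.length := by
    rw [← List.length_map (as := us) fun t => (t.1, t.2.1)]
    refine Set.ncard_eq_length_of_nodup (List.Nodup.map_on ?_ hus) ?_
    · rintro ⟨op, q, q'⟩ h ⟨op₂, q₂, q₂'⟩ h₂ he
      obtain ⟨rfl, rfl⟩ := Prod.ext_iff.mp he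
      rw [hus'] at h h₂
      rw [Option.some.inj (h.symm.trans h₂)]
    · simp [Option.isSome_iff_exists, hus']
  have h₄ : {p : Q × Q | (A.join p.1 p.2).isSome}.ncard = js.length := by
    rw [← List.length_map (as := js) fun t => (t.1, t.2.1)]
    refine Set.ncard_eq_length_of_nodup (List.Nodup.map_on ?_ hjs) ?_
    · rintro ⟨op, q, q'⟩ h ⟨op₂, q₂, q₂'⟩ h₂ he
      obtain ⟨rfl, rfl⟩ := Prod.ext_iff.mp he
      rw [hjs'] at h h₂
      rw [Option.some.inj (h.symm.trans h₂)]
    · simp [Option.isSome_iff_exists, hjs']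
  have h₅ := List.length_pos_of_mem (hs' A.bot)
  rw [TreeAutomaton.size]
  omega

/-- An exponent of order `k log k`. -/
def exponent (k : ℕ) : ℕ := (Nat.log 2 (k + 2) + 1) * (k + 1)

/-- Turns the base `m + 2` of the time bounds into a power of two; one additional factor `k + 2`
swallows the summand 2. -/
theorem pow_add_two_le {k : ℕ} (hk : 1 ≤ k) : (k + 2) ^ k + 2 ≤ 2 ^ exponent k :=
  calc (k + 2) ^ k + 2 ≤ (k + 2) ^ (k + 1) := by
        have := Nat.one_le_pow k (k + 2) (by omega)
        rw [pow_succ]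
        nlinarith
    _ ≤ (2 ^ (Nat.log 2 (k + 2) + 1)) ^ (k + 1) :=
        Nat.pow_le_pow_left (Nat.lt_pow_succ_log_self one_lt_two _).le _
    _ = 2 ^ exponent k := (pow_mul _ _ _).symm

theorem isBigO_exponent (c : ℕ) : (fun k : ℕ => ((c * exponent k : ℕ) : ℝ)) =O[Filter.atTop]
    fun k : ℕ => (k : ℝ) * Real.log k := by
  -- For `k ≥ 2` one has `k + 2 ≤ k ^ 2`, which bounds the logarithmic factor by three times the
  -- binary logarithm of `k`, and `k + 1 ≤ 2k`; this gives the 6.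
  refine .of_bound (c * (6 / Real.log 2)) (Filter.eventually_atTop.mpr ⟨2, fun k hk => ?_⟩)
  have hk' : (2 : ℝ) ≤ k := by exact_mod_cast hk
  have h2 : 0 < Real.log 2 := Real.log_pos one_lt_two
  have hlog : Real.log 2 ≤ Real.log k := Real.log_le_log two_pos hk'
  have h₁ : ((Nat.log 2 (k + 2) + 1 : ℕ) : ℝ) ≤ 3 * (Real.log k / Real.log 2) := by
    have h₃ : (Nat.log 2 (k + 2) : ℝ) ≤ Real.log (k + 2 : ℝ) / Real.log 2 := by
      simpa [Real.logb] using Real.natLog_le_logb (k + 2) 2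
    have h₄ : Real.log (k + 2 : ℝ) ≤ 2 * Real.log k := by
      rw [← Real.log_rpow (by linarith)]
      refine Real.log_le_log (by linarith) ?_
      norm_num
      nlinarith
    have h₅ : Real.log (k + 2 : ℝ) / Real.log 2 ≤ 2 * (Real.log k / Real.log 2) := by
      rw [← mul_div_assoc]
      gcongr
    have h₆ : 1 ≤ Real.log k / Real.log 2 := (one_le_div h2).mpr hlog
    push_cast
    linarith
  rw [Real.norm_of_nonneg (by positivity), Real.norm_of_nonneg (by positivity), exponent]
  push_cast at h₁ ⊢
  calc (c : ℝ) * ((Nat.log 2 (k + 2) + 1) * (k + 1))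
      ≤ c * (3 * (Real.log k / Real.log 2) * (2 * k)) := by
        gcongr
        linarith
    _ = c * (6 / Real.log 2) * (k * Real.log k) := by ring

end LoGrammar

open LoGrammar

theorem mainTheorem2 :
    ∃ (P : List Code) (f : ℕ → ℕ),
      ((fun k : ℕ => (f k : ℝ)) =O[Filter.atTop] fun k : ℕ => (k : ℝ) * Real.log k) ∧
      ∀ (k : ℕ), 1 ≤ k →
      ∀ (T Γ Q : Type) [Finite T] [Finite Γ] [Finite Q]
        (nT : T ↪ Data) (nΓ : Γ ↪ Data) (nQ : Q ↪ Data)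
        (A : TreeAutomaton (Fin k) T Γ Q) (d : Data), A.EncodedBy nT nΓ nQ d →
      ∃ (d' : Data) (t : ℕ), RunsInSteps P d d' t ∧ t ≤ A.size * 2 ^ f k ∧
        ∃ (N X : Type) (_ : Finite N) (_ : Finite X) (nN : N ↪ Data) (nX : X ↪ Data)
          (G : MCFG T N X),
          G.EncodedBy nT nN nX d' ∧ G.HasDimRank k 2 ∧ G.language = A.wordLanguage ∧
          G.size ≤ A.size * 2 ^ f k := by
  obtain ⟨P, b, ⟨C, hC⟩, hP⟩ := Input.comp_encodeGrammar.exists_program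
  obtain ⟨D, hD⟩ := Input.bdd_grammarSize
  refine ⟨P, fun k => (C + D + 2) * exponent k, isBigO_exponent _, ?_⟩
  intro k hk T Γ Q _ _ _ nT nΓ nQ A d hd
  obtain ⟨states, acc, us, js, hs, hs', hacc, hacc', hus, hus', hjs, hjs', rfl⟩ := hd
  have : NeZero k := ⟨by omega⟩
  let i : Input := ⟨k, T, Γ, Q, nT, nΓ, nQ, states, A.bot, acc, us, js⟩
  -- One estimate for both the running time, with exponent `C`, and the size, with exponent `D`. The
  -- factor 4 from the length of the input costs two more powers of two, covered by the summand 2 in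
  -- `C + D + 2` as `exponent k` is positive.
  have hbound {E : ℕ} (hE : E ≤ C + D) :
      (i.length + 1) * (i.param + 2) ^ E ≤ A.size * 2 ^ ((C + D + 2) * exponent k) := by
    have hexp : 1 ≤ exponent k := Nat.mul_pos (by omega) (by omega)
    calc (i.length + 1) * (i.param + 2) ^ E
        ≤ 4 * A.size * (2 ^ exponent k) ^ (C + D) := Nat.mul_le_mul
          (length_le_two_mul_size hs hs' hacc hus hus' hjs hjs')
          ((Nat.pow_le_pow_left (pow_add_two_le hk) E).trans
            (Nat.pow_le_pow_right (by positivity) hE))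
      _ = A.size * 2 ^ (2 + exponent k * (C + D)) := by ring
      _ ≤ _ := Nat.mul_le_mul_left _ (Nat.pow_le_pow_right two_pos (by nlinarith))
  obtain ⟨t, ht, hrun⟩ := hP i
  refine ⟨_, t, hrun, (ht.trans (hC i)).trans (hbound (by omega)), Nonterminal k Q, Var k,
    inferInstance, inferInstance, nonterminalName nQ, varName k, i.grammar,
    ⟨nonterminals k states, allVars k, nodup_nonterminals hs, mem_nonterminals hs',
      nodup_allVars, mem_allVars, rfl⟩, hasDimRank_grammar,
    language_grammar hacc' hus' hjs', ?_⟩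
  refine le_trans (le_of_eq ?_) ((hD i).trans (hbound (by omega)))
  rw [MCFG.size, Nat.card_eq_length_of_nodup (nodup_nonterminals hs) (mem_nonterminals hs'),
    Nat.card_eq_length_of_nodup nodup_allVars mem_allVars]
  rfl
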